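/- **Theorem (Coverage probability).** *Parameters.* Let $\lambda_u,\lambda_t,h,r_c,c_1,c_2,\rho_u,\rho_t,\eta_l,\eta_n,\alpha_l,\alpha_n,\alpha_t,\gamma>0$, $\sigma^2\ge 0$, $P_a\in[0,1]$, let $m_l,m_n\ge 1$ be integers, and put $\lambda_u'=P_a\lambda_u$. For $r\ge h$ let $$P_l(r)=\frac{1}{1+c_1\exp\!\big(-c_2\big(\tfrac{180}{\pi}\arctan\tfrac{h}{\sqrt{r^2-h^2}}-c_1\big)\big)},\qquad P_n(r)=1-P_l(r)$$ (with $\arctan(h/0)=\pi/2$). *Model.* A typical user is uniformly distributed in the disk of radius $r_c$ around the origin of the ground plane. A cluster UAV hovers at altitude $h$ above the origin; the other UAVs hover at altitude $h$ above the points of a homogeneous Poisson process of density $\lambda_u$ in the plane; terrestrial base stations (TBSs) form a homogeneous Poisson process of density $\lambda_t$ on the ground. Each UAV is available with probability $P_a$, and, if its Euclidean distance to the user is $D$, its link to the user is LoS with probability $P_l(D)$ and NLoS otherwise. The power received from a UAV at distance $D$ is $\eta_l\rho_uG_lD^{-\alpha_l}$ if LoS and $\eta_n\rho_uG_nD^{-\alpha_n}$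 if NLoS; from a TBS at distance $D$ it is $\rho_tHD^{-\alpha_t}$. Here $G_l$, $G_n$ are gamma distributed with shape $m_l$, $m_n$ and scale $1/m_l$, $1/m_n$, and $H$ is exponential with mean $1$. User position, point processes, availabilities, LoS states given the distances, and fading gains are independent. Available UAVs and all TBSs transmit. The user is associated with the cluster UAV if that is available, and otherwise with the transmitter of largest average (over the fading) received power, which is the nearest of its class (available LoS UAVs, available NLoS UAVs, TBSs). With $p$ the power received from the serving transmitter and $I\in[0,\infty]$ the total power received from all other transmitters, ${\rm SINR}=p/(I+\sigma^2)$, and the user is covered if ${\rm SINR}\ge\gamma$. Let * $P_{{\rm cov},U_o,l}$, $P_{{\rm cov},U_o,n}$ be the conditional probabilities, given that the cluster UAV is available, that its link is LoS (respectively NLoS) and the user is covered (for $P_a>0$); * $P_{{\rm cov},\hat U_o,l}$, $P_{{\rm cov},\hat U_o,n}$, $P_{{\rm cov},t}$ be the conditional probabilities, given that the cluster UAV is unavailable, that the user is associated with the nearest available LoS UAV, the nearest available NLoS UAV, the nearest TBS, respectively, and is covered (for $P_a<1$). *Auxiliary functions.* Let $d_n(r)=\max\{(\frac{\eta_n}{\eta_l})^{1/\alpha_n}r^{\alpha_l/\alpha_n},h\}$,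 $d_l(r)=\max\{h,(\frac{\eta_l}{\eta_n})^{1/\alpha_l}r^{\alpha_n/\alpha_l}\}$, $d_{lt}(r)=(\frac{\rho_t}{\rho_u\eta_l})^{1/\alpha_t}r^{\alpha_l/\alpha_t}$, $d_{nt}(r)=(\frac{\rho_t}{\rho_u\eta_n})^{1/\alpha_t}r^{\alpha_n/\alpha_t}$, $d_{tl}(r)=\max\{h,(\frac{\rho_u\eta_l}{\rho_t})^{1/\alpha_l}r^{\alpha_t/\alpha_l}\}$, $d_{tn}(r)=\max\{h,(\frac{\rho_u\eta_n}{\rho_t})^{1/\alpha_n}r^{\alpha_t/\alpha_n}\}$. For $q\in\{l,n\}$ let $$V_q(d)=\exp\Big(-2\pi\lambda_u'\int_0^{\sqrt{d^2-h^2}}zP_q(\sqrt{z^2+h^2})\,dz\Big),\qquad V_t(d)=\exp(-\pi\lambda_td^2),$$ $$\mathcal A_{\rm LoS}(r)=V_n(d_n(r))V_t(d_{lt}(r)),\quad \mathcal A_{\rm NLoS}(r)=V_l(d_l(r))V_t(d_{nt}(r)),\quad \mathcal A_{\rm TBS}(r)=V_l(d_{tl}(r))V_n(d_{tn}(r)),$$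 $$f_l(r)=2\pi\lambda_u'P_l(r)\,r\,V_l(r),\quad f_n(r)=2\pi\lambda_u'P_n(r)\,r\,V_n(r),\quad f_t(r)=2\pi\lambda_t\,r\,e^{-\pi\lambda_tr^2},$$ $$g_l(r)=\gamma(\eta_l\rho_u)^{-1}r^{\alpha_l},\qquad g_n(r)=\gamma(\eta_n\rho_u)^{-1}r^{\alpha_n}.$$ For $s>0$ and a serving transmitter at distance $r$ let $$\mathcal L_{\sigma^2+I}(s,r)=e^{-s\sigma^2}\prod_{q\in\{l,n\}}\exp\Big(-2\pi\lambda_u'\int_{a_q}^\infty\Big[1-\Big(\tfrac{m_q}{m_q+s\eta_q\rho_u(z^2+h^2)^{-\alpha_q/2}}\Big)^{m_q}\Big]zP_q(\sqrt{z^2+h^2})\,dz\Big)\cdot\exp\Big(-2\pi\lambda_t\int_{a_t}^\infty\Big[1-\tfrac1{1+s\rho_tz^{-\alpha_t}}\Big]z\,dz\Big)$$ (with $e^{-\infty}=0$ where an integral diverges, and $0\cdot\infty=0$), where $(a_n,a_l,a_t)$ is * $(0,0,0)$ if the cluster UAV serves, * $(\sqrt{d_n^2(r)-h^2},\sqrt{r^2-h^2},d_{lt}(r))$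 if a LoS UAV serves, * $(\sqrt{r^2-h^2},\sqrt{d_l^2(r)-h^2},d_{nt}(r))$ if a NLoS UAV serves, * $(\sqrt{d_{tn}^2(r)-h^2},\sqrt{d_{tl}^2(r)-h^2},r)$ if a TBS serves. *Conclusion.* In each case $s\mapsto\mathcal L_{\sigma^2+I}(s,r)$ is smooth on $(0,\infty)$, the integrands below are integrable, and, with $\mathcal L_{\sigma^2+I}$ taken for the respective serving transmitter: if $P_a>0$, then for $q\in\{l,n\}$ $$P_{{\rm cov},U_o,q}=\int_h^{\sqrt{h^2+r_c^2}}\sum_{k=0}^{m_q-1}\frac{(-m_qg_q(r))^k}{k!}\,\frac{\partial^k}{\partial s^k}\mathcal L_{\sigma^2+I}(s,r)\Big|_{s=m_qg_q(r)}P_q(r)\frac{2r}{r_c^2}\,dr ;$$ if $P_a<1$, then $$P_{{\rm cov},\hat U_o,l}=\int_h^\infty\mathcal A_{\rm LoS}(r)\sum_{k=0}^{m_l-1}\frac{(-m_lg_l(r))^k}{k!}\,\frac{\partial^k}{\partial s^k}\mathcal L_{\sigma^2+I}(s,r)\Big|_{s=m_lg_l(r)}f_l(r)\,dr,$$ $$P_{{\rm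 cov},\hat U_o,n}=\int_h^\infty\mathcal A_{\rm NLoS}(r)\sum_{k=0}^{m_n-1}\frac{(-m_ng_n(r))^k}{k!}\,\frac{\partial^k}{\partial s^k}\mathcal L_{\sigma^2+I}(s,r)\Big|_{s=m_ng_n(r)}f_n(r)\,dr,$$ $$P_{{\rm cov},t}=\int_0^\infty\mathcal L_{\sigma^2+I}(s,r)\Big|_{s=\gamma\rho_t^{-1}r^{\alpha_t}}\mathcal A_{\rm TBS}(r)f_t(r)\,dr.$$ -/

import Mathlib

open MeasureTheory ProbabilityTheory Set

namespace UavNet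

noncomputable section

/-- The horizontal plane. -/
abbrev Plane := EuclideanSpace ℝ (Fin 2)

/-- The numerical parameters of the network. -/
structure NetParams where
  /-- density of the UAVs -/
  lamU : ℝ
  /-- density of the terrestrial base stations (TBSs) -/
  lamT : ℝ
  /-- availability probability of a UAV -/
  Pa : ℝ
  /-- altitude of the UAVs -/
  h : ℝ
  /-- radius of the disk of users around the cluster centre -/
  rc : ℝ
  /-- first environment constant of the line-of-sight probability -/
  c1 : ℝ
  /-- second environment constant of the line-of-sight probability -/
  c2 : ℝ
  /-- transmission power of the UAVs -/
  rhoU : ℝ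
  /-- transmission power of the TBSs -/
  rhoT : ℝ
  /-- mean additional loss, LoS -/
  etaL : ℝ
  /-- mean additional loss, NLoS -/
  etaN : ℝ
  /-- path-loss exponent, LoS -/
  alphaL : ℝ
  /-- path-loss exponent, NLoS -/
  alphaN : ℝ
  /-- path-loss exponent, TBS -/
  alphaT : ℝ
  /-- Nakagami shape parameter, LoS -/
  mL : ℕ
  /-- Nakagami shape parameter, NLoS -/
  mN : ℕ
  /-- SINR threshold -/
  gam : ℝ
  /-- noise power `σ²` -/
  noise : ℝ
  lamU_pos : 0 < lamU
  lamT_pos : 0 < lamT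
  Pa_nonneg : 0 ≤ Pa
  Pa_le_one : Pa ≤ 1
  h_pos : 0 < h
  rc_pos : 0 < rc
  c1_pos : 0 < c1
  c2_pos : 0 < c2
  rhoU_pos : 0 < rhoU
  rhoT_pos : 0 < rhoT
  etaL_pos : 0 < etaL
  etaN_pos : 0 < etaN
  alphaL_pos : 0 < alphaL
  alphaN_pos : 0 < alphaN
  alphaT_pos : 0 < alphaT
  mL_pos : 0 < mL
  mN_pos : 0 < mN
  gam_pos : 0 < gam
  noise_nonneg : 0 ≤ noise

namespace NetParams

variable (p : NetParams)

/-- Elevation angle, in degrees, of a UAV at Euclidean distance `r` from the user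
(`90` when the UAV is right overhead, `r = h`). -/
def elevation (r : ℝ) : ℝ :=
  if r ≤ p.h then 90 else 180 / Real.pi * Real.arctan (p.h / √(r ^ 2 - p.h ^ 2))

/-- Probability `P_l(r)` that the link to a UAV at Euclidean distance `r` is LoS. -/
def pLoS (r : ℝ) : ℝ := 1 / (1 + p.c1 * Real.exp (-p.c2 * (p.elevation r - p.c1)))

/-- Probability `P_n(r)` that the link to a UAV at Euclidean distance `r` is NLoS. -/
def pNLoS (r : ℝ) : ℝ := 1 - p.pLoS r

/-- Density of the available UAVs. -/
def lamA : ℝ := p.Pa * p.lamU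

end NetParams

/-! ### The probabilistic model -/

/-- The counting measure of the points `X 0, X 1, …`, as a random measure. -/
def counting {Ω : Type*} (X : Ω → ℕ → Plane) (ω : Ω) : Measure Plane :=
  Measure.sum fun i => Measure.dirac (X ω i)

/-- `X` enumerates the points of a Poisson point process with intensity measure `Λ`:
the number of points in a set of finite intensity is Poisson distributed, and the numbers of
points in pairwise disjoint sets are independent. -/
structure IsPoissonProcess {Ω : Type*} [MeasurableSpace Ω] (P : Measure Ω)
    (X : Ω → ℕ → Plane) (Λ : Measure Plane) : Prop where
  measurable : Measurable X
  law : ∀ B : Set Plane, MeasurableSet B → Λ B ≠ ⊤ →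
    P.map (fun ω => counting X ω B) =
      (poissonMeasure (Λ B).toNNReal).map (Nat.cast : ℕ → ENNReal)
  indep : ∀ (n : ℕ) (B : Fin n → Set Plane), (∀ i, MeasurableSet (B i)) →
    Pairwise (fun i j => Disjoint (B i) (B j)) →
    iIndepFun (fun i ω => counting X ω (B i)) P

/-- The random inputs of the network. UAVs are indexed by `Option ℕ`: `none` is the cluster
UAV, `some i` is the `i`-th point of the UAV process. TBSs are indexed by `ℕ`. -/
structure Inputs (Ω : Type*) where
  /-- position of the typical user; its cluster is centred at the origin -/
  user : Ω → Plane
  /-- horizontal positions of the UAVs other than the cluster UAV -/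
  uavPos : Ω → ℕ → Plane
  /-- positions of the TBSs -/
  tbsPos : Ω → ℕ → Plane
  /-- is the UAV available? -/
  avail : Option ℕ → Ω → Bool
  /-- uniform mark that decides between LoS and NLoS -/
  losMark : Option ℕ → Ω → ℝ
  /-- fading gain of a UAV link if it is LoS -/
  gL : Option ℕ → Ω → ℝ
  /-- fading gain of a UAV link if it is NLoS -/
  gN : Option ℕ → Ω → ℝ
  /-- fading gain of a TBS link -/
  gT : ℕ → Ω → ℝ

/-- Labels of the sources of randomness. -/
inductive Source where
  | user
  | uavPos
  | tbsPos
  | avail (i : Option ℕ)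
  | losMark (i : Option ℕ)
  | gL (i : Option ℕ)
  | gN (i : Option ℕ)
  | gT (k : ℕ)

/-- A transmitter: `Sum.inl none` is the cluster UAV, `Sum.inl (some i)` is the `i`-th other
UAV, `Sum.inr k` is the `k`-th TBS. -/
abbrev BS := Option ℕ ⊕ ℕ

namespace Inputs

variable {Ω : Type*} (S : Inputs Ω) (p : NetParams)

/-- The sigma-algebra generated by each source of randomness. -/
abbrev sourceSigma : Source → MeasurableSpace Ω
  | .user => MeasurableSpace.comap S.user inferInstance
  | .uavPos => MeasurableSpace.comap S.uavPos inferInstance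
  | .tbsPos => MeasurableSpace.comap S.tbsPos inferInstance
  | .avail i => MeasurableSpace.comap (S.avail i) inferInstance
  | .losMark i => MeasurableSpace.comap (S.losMark i) inferInstance
  | .gL i => MeasurableSpace.comap (S.gL i) inferInstance
  | .gN i => MeasurableSpace.comap (S.gN i) inferInstance
  | .gT k => MeasurableSpace.comap (S.gT k) inferInstance

/-- The laws of the random inputs. All sources of randomness are independent; the user is
uniform in the disk of its cluster; UAVs and TBSs form homogeneous Poisson processes; UAVs
are available with probability `Pa`; the fading gains of LoS and NLoS links are gamma
distributed with shape `m` and scale `1 / m` (rate `m`), those of TBS links are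
exponential with mean one. -/
structure IsModel [MeasurableSpace Ω] (P : Measure Ω) : Prop where
  measurable_user : Measurable S.user
  measurable_avail : ∀ i, Measurable (S.avail i)
  measurable_losMark : ∀ i, Measurable (S.losMark i)
  measurable_gL : ∀ i, Measurable (S.gL i)
  measurable_gN : ∀ i, Measurable (S.gN i)
  measurable_gT : ∀ k, Measurable (S.gT k)
  user_law : pdf.IsUniform S.user (Metric.closedBall 0 p.rc) P volume
  uav_law : IsPoissonProcess P S.uavPos (ENNReal.ofReal p.lamU • volume)
  tbs_law : IsPoissonProcess P S.tbsPos (ENNReal.ofReal p.lamT • volume)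
  avail_law : ∀ i, P {ω | S.avail i ω = true} = ENNReal.ofReal p.Pa
  losMark_law : ∀ i, pdf.IsUniform (S.losMark i) (Icc 0 1) P volume
  gL_law : ∀ i, P.map (S.gL i) = gammaMeasure p.mL p.mL
  gN_law : ∀ i, P.map (S.gN i) = gammaMeasure p.mN p.mN
  gT_law : ∀ k, P.map (S.gT k) = expMeasure 1
  indep : iIndep S.sourceSigma P

/-- Horizontal position of a UAV; the cluster UAV hovers above the cluster centre. -/
def uavAt : Option ℕ → Ω → Plane
  | none, _ => 0
  | some i, ω => S.uavPos ω i

/-- Euclidean distance between the user and a UAV at altitude `h`. -/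
def distUav (i : Option ℕ) (ω : Ω) : ℝ :=
  √(dist (S.uavAt i ω) (S.user ω) ^ 2 + p.h ^ 2)

/-- Distance between the user and a TBS. -/
def distTbs (k : ℕ) (ω : Ω) : ℝ := dist (S.tbsPos ω k) (S.user ω)

/-- The link to UAV `i` is LoS; given the positions this has probability `P_l(distance)`,
independently for all UAVs. -/
def IsLoS (i : Option ℕ) (ω : Ω) : Prop := S.losMark i ω ≤ p.pLoS (S.distUav p i ω)

/-- The transmitters that are on the air: available UAVs, and all TBSs. -/
def Active : BS → Ω → Prop
  | .inl i, ω => S.avail i ω = true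
  | .inr _, _ => True

open Classical in
/-- Average received power. -/
def avgPower : BS → Ω → ℝ
  | .inl i, ω =>
      if S.IsLoS p i ω then p.etaL * p.rhoU * S.distUav p i ω ^ (-p.alphaL)
      else p.etaN * p.rhoU * S.distUav p i ω ^ (-p.alphaN)
  | .inr k, ω => p.rhoT * S.distTbs k ω ^ (-p.alphaT)

open Classical in
/-- Received power, fading included. -/
def rxPower : BS → Ω → ℝ
  | .inl i, ω =>
      if S.IsLoS p i ω then p.etaL * p.rhoU * S.gL i ω * S.distUav p i ω ^ (-p.alphaL)
      else p.etaN * p.rhoU * S.gN i ω * S.distUav p i ω ^ (-p.alphaN)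
  | .inr k, ω => p.rhoT * S.gT k ω * S.distTbs k ω ^ (-p.alphaT)

open Classical in
/-- Aggregate interference when `b` is the serving transmitter, possibly infinite. -/
def interference (b : BS) (ω : Ω) : ENNReal :=
  ∑' c : BS, if c ≠ b ∧ S.Active c ω then ENNReal.ofReal (S.rxPower p c ω) else 0

/-- Signal to interference plus noise ratio when `b` is the serving transmitter. -/
def sinr (b : BS) (ω : Ω) : ENNReal :=
  ENNReal.ofReal (S.rxPower p b ω) / (S.interference p b ω + ENNReal.ofReal p.noise)

/-- The user is associated with `b`: with the cluster UAV if that is available, otherwise with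
the active transmitter of largest average received power. In each of the three classes
(LoS UAVs, NLoS UAVs, TBSs) the average power decreases with the distance, so that `b` is the
nearest one of its class. -/
def Serves (b : BS) (ω : Ω) : Prop :=
  S.Active b ω ∧ (b = .inl none ∨
    (S.avail none ω = false ∧ ∀ c, c ≠ b → S.Active c ω → S.avgPower p c ω < S.avgPower p b ω))

/-- The user is associated with `b` and the SINR reaches the threshold. -/
def Covers (b : BS) (ω : Ω) : Prop := S.Serves p b ω ∧ ENNReal.ofReal p.gam ≤ S.sinr p b ω

variable [MeasurableSpace Ω] (P : Measure Ω)

/-- Given that the cluster UAV is available: probability that it has a LoS link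
and covers the user. -/
def covClusterL : ℝ :=
  (P[|{ω | S.avail none ω = true}]).real {ω | S.IsLoS p none ω ∧ S.Covers p (.inl none) ω}

/-- Given that the cluster UAV is available: probability that it has a NLoS link
and covers the user. -/
def covClusterN : ℝ :=
  (P[|{ω | S.avail none ω = true}]).real {ω | ¬ S.IsLoS p none ω ∧ S.Covers p (.inl none) ω}

/-- Given that the cluster UAV is unavailable: probability that the user is associated with,
and covered by, the nearest available LoS UAV. -/
def covOtherL : ℝ :=
  (P[|{ω | S.avail none ω = false}]).real
    {ω | ∃ i : ℕ, S.IsLoS p (some i) ω ∧ S.Covers p (.inl (some i)) ω}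

/-- Given that the cluster UAV is unavailable: probability that the user is associated with,
and covered by, the nearest available NLoS UAV. -/
def covOtherN : ℝ :=
  (P[|{ω | S.avail none ω = false}]).real
    {ω | ∃ i : ℕ, ¬ S.IsLoS p (some i) ω ∧ S.Covers p (.inl (some i)) ω}

/-- Given that the cluster UAV is unavailable: probability that the user is associated with,
and covered by, the nearest TBS. -/
def covTbs : ℝ :=
  (P[|{ω | S.avail none ω = false}]).real {ω | ∃ k : ℕ, S.Covers p (.inr k) ω}

end Inputs

/-! ### The closed forms -/

/-- `exp (-x)`, with `exp (-∞) = 0`. -/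
def expNeg (x : ENNReal) : ℝ := if x = ⊤ then 0 else Real.exp (-x.toReal)

/-- The kind of the serving transmitter. -/
inductive Serving where
  | cluster
  | los
  | nlos
  | tbs

namespace NetParams

variable (p : NetParams)

/-- Minimal distance of a NLoS UAV when the serving LoS UAV is at distance `r`. -/
def dN (r : ℝ) : ℝ := max ((p.etaN / p.etaL) ^ (1 / p.alphaN) * r ^ (p.alphaL / p.alphaN)) p.h

/-- Minimal distance of a LoS UAV when the serving NLoS UAV is at distance `r`. -/
def dL (r : ℝ) : ℝ := max p.h ((p.etaL / p.etaN) ^ (1 / p.alphaL) * r ^ (p.alphaN / p.alphaL))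

/-- Minimal distance of a TBS when the serving LoS UAV is at distance `r`. -/
def dLT (r : ℝ) : ℝ := (p.rhoT / (p.rhoU * p.etaL)) ^ (1 / p.alphaT) * r ^ (p.alphaL / p.alphaT)

/-- Minimal distance of a TBS when the serving NLoS UAV is at distance `r`. -/
def dNT (r : ℝ) : ℝ := (p.rhoT / (p.rhoU * p.etaN)) ^ (1 / p.alphaT) * r ^ (p.alphaN / p.alphaT)

/-- Minimal distance of a LoS UAV when the serving TBS is at distance `r`. -/
def dTL (r : ℝ) : ℝ :=
  max p.h ((p.rhoU * p.etaL / p.rhoT) ^ (1 / p.alphaL) * r ^ (p.alphaT / p.alphaL))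

/-- Minimal distance of a NLoS UAV when the serving TBS is at distance `r`. -/
def dTN (r : ℝ) : ℝ :=
  max p.h ((p.rhoU * p.etaN / p.rhoT) ^ (1 / p.alphaN) * r ^ (p.alphaT / p.alphaN))

/-- Probability that no available NLoS UAV is closer than `d`. -/
def voidN (d : ℝ) : ℝ :=
  Real.exp (-(2 * Real.pi * p.lamA *
    ∫ z in (0 : ℝ)..√(d ^ 2 - p.h ^ 2), z * p.pNLoS (√(z ^ 2 + p.h ^ 2))))

/-- Probability that no available LoS UAV is closer than `d`. -/
def voidL (d : ℝ) : ℝ :=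
  Real.exp (-(2 * Real.pi * p.lamA *
    ∫ z in (0 : ℝ)..√(d ^ 2 - p.h ^ 2), z * p.pLoS (√(z ^ 2 + p.h ^ 2))))

/-- Probability that no TBS is closer than `d`. -/
def voidT (d : ℝ) : ℝ := Real.exp (-(Real.pi * p.lamT * d ^ 2))

/-- Association probability, LoS UAV at distance `r`. -/
def assocL (r : ℝ) : ℝ := p.voidN (p.dN r) * p.voidT (p.dLT r)

/-- Association probability, NLoS UAV at distance `r`. -/
def assocN (r : ℝ) : ℝ := p.voidL (p.dL r) * p.voidT (p.dNT r)

/-- Association probability, TBS at distance `r`. -/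
def assocT (r : ℝ) : ℝ := p.voidL (p.dTL r) * p.voidN (p.dTN r)

/-- Density of the distance to the nearest available LoS UAV. -/
def densL (r : ℝ) : ℝ := 2 * Real.pi * p.lamA * p.pLoS r * r * p.voidL r

/-- Density of the distance to the nearest available NLoS UAV. -/
def densN (r : ℝ) : ℝ := 2 * Real.pi * p.lamA * p.pNLoS r * r * p.voidN r

/-- Density of the distance to the nearest TBS. -/
def densT (r : ℝ) : ℝ := 2 * Real.pi * r * p.lamT * Real.exp (-(Real.pi * p.lamT * r ^ 2))

/-- Lower limit (horizontal distance) for the interfering NLoS UAVs. -/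
def lowerN : Serving → ℝ → ℝ
  | .cluster, _ => 0
  | .los, r => √(p.dN r ^ 2 - p.h ^ 2)
  | .nlos, r => √(r ^ 2 - p.h ^ 2)
  | .tbs, r => √(p.dTN r ^ 2 - p.h ^ 2)

/-- Lower limit (horizontal distance) for the interfering LoS UAVs. -/
def lowerL : Serving → ℝ → ℝ
  | .cluster, _ => 0
  | .los, r => √(r ^ 2 - p.h ^ 2)
  | .nlos, r => √(p.dL r ^ 2 - p.h ^ 2)
  | .tbs, r => √(p.dTL r ^ 2 - p.h ^ 2)

/-- Lower limit (distance) for the interfering TBSs. -/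
def lowerT : Serving → ℝ → ℝ
  | .cluster, _ => 0
  | .los, r => p.dLT r
  | .nlos, r => p.dNT r
  | .tbs, r => r

/-- Laplace transform of the interference, for `s > 0`. The integrals over `z` have nonnegative
integrands and may diverge when a path-loss exponent is at most two, hence their values in
`[0, ∞]`. -/
def laplaceI (t : Serving) (s r : ℝ) : ℝ :=
  expNeg (ENNReal.ofReal (2 * Real.pi * p.lamA) * ∫⁻ z in Ioi (p.lowerN t r),
      ENNReal.ofReal ((1 - (p.mN / (p.mN + s * p.etaN * p.rhoU *
        (z ^ 2 + p.h ^ 2) ^ (-p.alphaN / 2))) ^ p.mN) * (z * p.pNLoS (√(z ^ 2 + p.h ^ 2))))) *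
  expNeg (ENNReal.ofReal (2 * Real.pi * p.lamA) * ∫⁻ z in Ioi (p.lowerL t r),
      ENNReal.ofReal ((1 - (p.mL / (p.mL + s * p.etaL * p.rhoU *
        (z ^ 2 + p.h ^ 2) ^ (-p.alphaL / 2))) ^ p.mL) * (z * p.pLoS (√(z ^ 2 + p.h ^ 2))))) *
  expNeg (ENNReal.ofReal (2 * Real.pi * p.lamT) * ∫⁻ z in Ioi (p.lowerT t r),
      ENNReal.ofReal ((1 - 1 / (1 + s * p.rhoT * z ^ (-p.alphaT))) * z))

/-- Laplace transform of the interference plus noise, for `s > 0`. -/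
def laplace (t : Serving) (s r : ℝ) : ℝ := Real.exp (-(s * p.noise)) * p.laplaceI t s r

/-- The function `g_l`. -/
def gl (r : ℝ) : ℝ := p.gam * (p.etaL * p.rhoU)⁻¹ * r ^ p.alphaL

/-- The function `g_n`. -/
def gn (r : ℝ) : ℝ := p.gam * (p.etaN * p.rhoU)⁻¹ * r ^ p.alphaN

/-- The finite sum of derivatives of the Laplace transform, with shape `m`, for a serving
transmitter at distance `r`, evaluated at `s = m g`. -/
def derivSum (t : Serving) (m : ℕ) (g r : ℝ) : ℝ :=
  ∑ k ∈ Finset.range m, (-(m * g)) ^ k / (k.factorial : ℝ) *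
    iteratedDeriv k (fun s => p.laplace t s r) (m * g)

/-- Integrand for the LoS cluster UAV. -/
def integrandClusterL (r : ℝ) : ℝ :=
  p.derivSum .cluster p.mL (p.gl r) r * p.pLoS r * (2 * r / p.rc ^ 2)

/-- Integrand for the NLoS cluster UAV. -/
def integrandClusterN (r : ℝ) : ℝ :=
  p.derivSum .cluster p.mN (p.gn r) r * p.pNLoS r * (2 * r / p.rc ^ 2)

/-- Integrand for the nearest available LoS UAV. -/
def integrandOtherL (r : ℝ) : ℝ := p.assocL r * p.derivSum .los p.mL (p.gl r) r * p.densL r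

/-- Integrand for the nearest available NLoS UAV. -/
def integrandOtherN (r : ℝ) : ℝ := p.assocN r * p.derivSum .nlos p.mN (p.gn r) r * p.densN r

/-- Integrand for the nearest TBS. -/
def integrandTbs (r : ℝ) : ℝ :=
  p.laplace .tbs (p.gam * p.rhoT⁻¹ * r ^ p.alphaT) r * p.assocT r * p.densT r

end NetParams

end

end UavNet

namespace UavNet

noncomputable section

open Filter Topology
open scoped ENNReal

/-! ### The exponential of a nonpositive extended number -/

/-! Seen from the user, every transmitter except the cluster UAV is a point of `State`: kind of
link, horizontal distance, fading gain. Unavailable UAVs are parked at `offState`, where every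
functional of interest vanishes. The first half of the proof shows that these points have the
Laplace functional of a Poisson process with intensity `intensity`, even on events that depend on
the user position and the marks of the cluster UAV (`setLIntegral_laplace`). The counts in disjoint
sets give the Laplace functional of the positions (`IsPoissonProcess.laplace`); the independent
marks are integrated out one at a time (`lintegral_mul_eexp_marks`); translation invariance makes
the answer independent of the user position, and polar coordinates give the densities `weight`. From
here on only the property `HasPoissonLaplace` is used.

Differentiating the Laplace functional in a direction `g` yields Mecke's formula for exponential
functionals. Functionals that are infinite above a threshold record the supremum of one function
over the other points, and their finite part records the sum of another one. Uniqueness of Laplace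
transforms then gives Mecke's formula for all measurable functions of a point, this supremum and
this sum (`HasPoissonLaplace.mecke`). A serving and covering transmitter is, up to null sets, a
point whose average power bounds the supremum of the others and whose received power is at least `γ
(I + σ²)`, so its probability becomes an integral over the distance (`measure_wins`).

At a fixed distance, write `J` for interference plus noise. A gamma variable of integer shape `m`
and rate `m` exceeds `g J` with probability `∑_{k<m} (s J)^k / k! · e^{-sJ}`, where `s = m g`. If
`Φ(s)` is the expectation of `e^{-sJ}` on the event that no transmitter beats the serving one, the
expectation of this sum on the same event is `∑_{k<m} (-s)^k / k! · Φ^{(k)}(s)`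
(`lintegral_erlangTail`). Here `Φ` is the moment generating function of `-J` on the part of the
event where `J` is finite, hence analytic for `s > 0`. The Laplace functional evaluates it as a void
probability times `laplace` (`setLIntegral_eexp_interferenceNoise`). The void event is expressed by
the lower limits of the statement because comparing average powers amounts to comparing distances
(`meanPower_le_iff`).

For the cluster UAV there is no competition: its link is independent of the interference, and the
distance of the user from the centre has density `2 z / rc ^ 2`. All integrals are first obtained in
the horizontal distance `z` and moved to `r = √(z² + h²)` by `integral_slant`. The interference may
be infinite, so everything is done in `[0, ∞]` with `eexp ⊤ = 0`. Integrability follows from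
nonnegativity, since each lower integral is a probability. -/

/-- `exp (-x)` as an extended nonnegative number. -/
def eexp (x : ℝ≥0∞) : ℝ≥0∞ := EReal.exp (-(x : EReal))

lemma eexp_eq_inv (x : ℝ≥0∞) : eexp x = (EReal.exp (x : EReal))⁻¹ := EReal.exp_neg _

@[simp] lemma eexp_zero : eexp 0 = 1 := by simp [eexp]

@[simp] lemma eexp_top : eexp ⊤ = 0 := by simp [eexp]

lemma eexp_add (x y : ℝ≥0∞) : eexp (x + y) = eexp x * eexp y := by
  -- No element of `[0, ∞]` is coerced to `⊥`, the only zero of the exponential. This excludes `0 *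
  -- ⊤` when the product is inverted.
  have h (z : ℝ≥0∞) : EReal.exp (z : EReal) ≠ 0 := by
    rw [Ne, EReal.exp_eq_zero_iff]
    exact EReal.coe_ennreal_ne_bot z
  rw [eexp_eq_inv, eexp_eq_inv, eexp_eq_inv, EReal.coe_ennreal_add, EReal.exp_add,
    ENNReal.mul_inv (Or.inl (h x)) (Or.inr (h y))]

lemma continuous_eexp : Continuous eexp :=
  ENNReal.continuous_exp.comp (continuous_neg.comp continuous_coe_ennreal_ereal)

@[fun_prop]
lemma measurable_eexp : Measurable eexp := continuous_eexp.measurable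

lemma antitone_eexp : Antitone eexp := fun _ _ h =>
  EReal.exp_monotone (EReal.neg_le_neg_iff.2 (EReal.coe_ennreal_le_coe_ennreal_iff.2 h))

lemma eexp_le_one (x : ℝ≥0∞) : eexp x ≤ 1 := by
  simpa using antitone_eexp (zero_le (a := x))

lemma eexp_ne_top (x : ℝ≥0∞) : eexp x ≠ ⊤ := ((eexp_le_one x).trans_lt ENNReal.one_lt_top).ne

lemma eexp_ofReal {x : ℝ} (hx : 0 ≤ x) :
    eexp (ENNReal.ofReal x) = ENNReal.ofReal (Real.exp (-x)) := by
  rw [eexp, EReal.coe_ennreal_ofReal, max_eq_left hx, ← EReal.coe_neg, EReal.exp_coe]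

lemma eexp_of_ne_top {x : ℝ≥0∞} (hx : x ≠ ⊤) : eexp x = ENNReal.ofReal (Real.exp (-x.toReal)) := by
  rw [← eexp_ofReal ENNReal.toReal_nonneg, ENNReal.ofReal_toReal hx]

lemma eexp_ne_zero {x : ℝ≥0∞} (hx : x ≠ ⊤) : eexp x ≠ 0 := by
  rw [eexp_of_ne_top hx]
  simp [Real.exp_pos]

lemma eexp_eq_zero_iff {x : ℝ≥0∞} : eexp x = 0 ↔ x = ⊤ :=
  ⟨fun h => by_contra fun h' => eexp_ne_zero h' h, fun h => by rw [h, eexp_top]⟩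

lemma toReal_eexp (x : ℝ≥0∞) : (eexp x).toReal = expNeg x := by
  unfold expNeg
  split_ifs with h
  · simp [h]
  · rw [eexp_of_ne_top h, ENNReal.toReal_ofReal (Real.exp_pos _).le]

lemma ofReal_expNeg (x : ℝ≥0∞) : ENNReal.ofReal (expNeg x) = eexp x := by
  rw [← toReal_eexp, ENNReal.ofReal_toReal (eexp_ne_top x)]

lemma expNeg_nonneg (x : ℝ≥0∞) : 0 ≤ expNeg x := by
  rw [← toReal_eexp]; exact ENNReal.toReal_nonneg

lemma eexp_natCast_mul (k : ℕ) (x : ℝ≥0∞) : eexp (k * x) = eexp x ^ k := by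
  induction k with
  | zero => simp
  | succ k ih => rw [Nat.cast_succ, add_mul, one_mul, eexp_add, ih, pow_succ]

lemma eexp_sum {ι : Type*} (s : Finset ι) (f : ι → ℝ≥0∞) :
    eexp (∑ i ∈ s, f i) = ∏ i ∈ s, eexp (f i) := by
  classical
  induction s using Finset.induction_on with
  | empty => simp
  | insert a s ha ih => rw [Finset.sum_insert ha, Finset.prod_insert ha, eexp_add, ih]

lemma injective_eexp : Function.Injective eexp := fun x y h => by
  have := EReal.exp_strictMono.injective h
  exact EReal.coe_ennreal_injective (neg_injective this)

/-- Dominated convergence for sums. -/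
lemma tendsto_tsum_of_le {ι : Type*} {f : ℕ → ι → ℝ≥0∞} {F bound : ι → ℝ≥0∞}
    (hb : ∀ n i, f n i ≤ bound i) (hfin : ∑' i, bound i ≠ ⊤)
    (hlim : ∀ i, Tendsto (fun n => f n i) atTop (𝓝 (F i))) :
    Tendsto (fun n => ∑' i, f n i) atTop (𝓝 (∑' i, F i)) := by
  let : MeasurableSpace ι := ⊤
  simp_rw [← lintegral_count] at hfin ⊢
  exact tendsto_lintegral_of_dominated_convergence bound (fun n => measurable_from_top)
    (fun n => ae_of_all _ (hb n)) hfin (ae_of_all _ hlim)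

/-! ### A finite measure is determined by its Laplace transform -/

/-- On `[0, 1]` the exponential series is dominated by `‖z‖ ^ k / k!`, so the moments are the Taylor
coefficients of the complex moment generating function, which determines the measure. -/
lemma ext_of_moments {μ ν : Measure ℝ} [IsFiniteMeasure μ] [IsFiniteMeasure ν]
    (hμ : ∀ᵐ x ∂μ, x ∈ Icc (0 : ℝ) 1) (hν : ∀ᵐ x ∂ν, x ∈ Icc (0 : ℝ) 1)
    (h : ∀ k : ℕ, ∫ x, x ^ k ∂μ = ∫ x, x ^ k ∂ν) : μ = ν := by
  have key (ρ : Measure ℝ) [IsFiniteMeasure ρ] (hρ : ∀ᵐ x ∂ρ, x ∈ Icc (0 : ℝ) 1) (z : ℂ) :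
      HasSum (fun k : ℕ => z ^ k / (k.factorial : ℂ) * ((∫ x, x ^ k ∂ρ : ℝ) : ℂ))
        (complexMGF id ρ z) := by
    have h1 : HasSum (fun k : ℕ => ∫ x : ℝ, (z * x) ^ k / (k.factorial : ℂ) ∂ρ)
        (∫ x : ℝ, Complex.exp (z * x) ∂ρ) := by
      refine hasSum_integral_of_dominated_convergence
        (fun k _ => ‖z‖ ^ k / (k.factorial : ℝ)) (fun k => by fun_prop) ?_ ?_ ?_ ?_
      · intro k
        filter_upwards [hρ] with x hx
        rw [norm_div, norm_pow, norm_mul, Complex.norm_real, Complex.norm_natCast]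
        gcongr
        rw [Real.norm_of_nonneg hx.1]
        exact mul_le_of_le_one_right (norm_nonneg _) hx.2
      · exact ae_of_all _ fun _ => Real.summable_pow_div_factorial _
      · exact integrable_const _
      · refine ae_of_all _ fun x => ?_
        rw [Complex.exp_eq_exp_ℂ]
        exact NormedSpace.expSeries_div_hasSum_exp _
    have h2 : complexMGF id ρ z = ∫ x : ℝ, Complex.exp (z * x) ∂ρ := rfl
    rw [h2]
    convert h1 using 2 with k
    rw [← integral_complex_ofReal, ← integral_const_mul]
    congr 1
    ext x
    push_cast
    ring
  refine Measure.ext_of_complexMGF_id_eq (funext fun z => ?_)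
  have h1 := key μ hμ z
  simp_rw [h] at h1
  exact h1.unique (key ν hν z)

/-- `eexp` embeds `[0, ∞]` into `[0, 1]`, and the hypothesis lists the moments of the image
measures. An atom at `⊤` becomes an atom at `0`, which the moment `k = 0` still sees. -/
lemma ext_of_lintegral_eexp_pow {μ ν : Measure ℝ≥0∞} [IsFiniteMeasure μ] [IsFiniteMeasure ν]
    (h : ∀ k : ℕ, ∫⁻ x, eexp x ^ k ∂μ = ∫⁻ x, eexp x ^ k ∂ν) : μ = ν := by
  have hcont : Continuous fun x => (eexp x).toReal :=
    ENNReal.continuousOn_toReal.comp_continuous continuous_eexp eexp_ne_top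
  have hinj : Function.Injective fun x => (eexp x).toReal := fun x y hxy =>
    injective_eexp ((ENNReal.toReal_eq_toReal_iff' (eexp_ne_top _) (eexp_ne_top _)).1 hxy)
  have hemb : MeasurableEmbedding fun x => (eexp x).toReal :=
    hcont.measurableEmbedding hinj
  have hmem (ρ : Measure ℝ≥0∞) : ∀ᵐ x ∂ρ.map (fun x => (eexp x).toReal), x ∈ Icc (0 : ℝ) 1 := by
    refine (ae_map_iff (p := fun x => x ∈ Icc (0 : ℝ) 1) hcont.measurable.aemeasurable
      measurableSet_Icc).2 (ae_of_all _ fun x => ⟨ENNReal.toReal_nonneg,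
      ENNReal.toReal_le_of_le_ofReal zero_le_one (by simpa using eexp_le_one x)⟩)
  have hmom (ρ : Measure ℝ≥0∞) (k : ℕ) : ∫ x, x ^ k ∂ρ.map (fun x => (eexp x).toReal) =
      (∫⁻ x, eexp x ^ k ∂ρ).toReal := by
    rw [hemb.integral_map, ← integral_toReal]
    · simp
    · exact (measurable_eexp.pow_const k).aemeasurable
    · exact ae_of_all _ fun x => ENNReal.pow_lt_top (eexp_ne_top x).lt_top
  have := ext_of_moments (hmem μ) (hmem ν) fun k => by rw [hmom, hmom, h]
  rw [← hemb.comap_map μ, this, hemb.comap_map]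

/-! ### Point processes with a Poisson Laplace functional -/

/-- The points `Y b` different from `off` have the Laplace functional of a Poisson process with
intensity `Λ`. -/
def HasPoissonLaplace {Ω E ι : Type*} [MeasurableSpace Ω] [MeasurableSpace E] (P : Measure Ω)
    (Y : ι → Ω → E) (Λ : Measure E) (off : E) : Prop :=
  ∀ ψ : E → ℝ≥0∞, Measurable ψ → ψ off = 0 →
    ∫⁻ ω, eexp (∑' b, ψ (Y b ω)) ∂P = eexp (∫⁻ y, (1 - eexp (ψ y)) ∂Λ)

/-- Difference quotients of `exp (-x)`, increasing to `x`. -/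
def expQuot (n : ℕ) (x : ℝ≥0∞) : ℝ≥0∞ := 2 ^ n * (1 - eexp ((2 ^ n)⁻¹ * x))

@[fun_prop]
lemma measurable_expQuot (n : ℕ) : Measurable (expQuot n) := by
  unfold expQuot
  fun_prop

lemma expQuot_mono_right (n : ℕ) : Monotone (expQuot n) := fun x y h => by
  unfold expQuot
  gcongr
  exact antitone_eexp (by gcongr)

/-- With `q = e^{-x / 2^(n+1)} ≤ 1` this is `1 - q² = (1 - q)(1 + q) ≤ 2 (1 - q)`. Monotone
difference quotients allow monotone instead of dominated convergence below. -/
lemma expQuot_le_succ (n : ℕ) (x : ℝ≥0∞) : expQuot n x ≤ expQuot (n + 1) x := by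
  unfold expQuot
  set q := eexp ((2 ^ (n + 1))⁻¹ * x)
  have hq : eexp ((2 ^ n)⁻¹ * x) = q * q := by
    rw [← eexp_add, ← two_mul, ← mul_assoc, pow_succ', ENNReal.mul_inv (by simp) (by simp),
      ← mul_assoc, ENNReal.mul_inv_cancel (by simp) (by simp), one_mul]
  rw [hq, pow_succ, mul_assoc]
  gcongr
  have h1 : q ≤ 1 := eexp_le_one _
  rw [tsub_le_iff_right]
  have h2 : 1 - q + q = 1 := tsub_add_cancel_of_le h1
  calc (1 : ℝ≥0∞) = (1 - q) + q := h2.symm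
    _ = (1 - q) + ((1 - q) + q) * q := by rw [h2, one_mul, h2]
    _ = (1 - q) + (1 - q) * q + q * q := by ring
    _ ≤ 2 * (1 - q) + q * q := by
        rw [two_mul]; gcongr; exact mul_le_of_le_one_right (zero_le) h1

lemma expQuot_mono_left (x : ℝ≥0∞) : Monotone fun n => expQuot n x :=
  monotone_nat_of_le_succ fun n => expQuot_le_succ n x

lemma tendsto_expQuot (x : ℝ≥0∞) : Tendsto (fun n => expQuot n x) atTop (𝓝 x) := by
  by_cases hx : x = ⊤
  · subst hx
    have (n : ℕ) : expQuot n ⊤ = 2 ^ n := by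
      simp [expQuot, ENNReal.mul_top]
    simp_rw [this]
    exact ENNReal.tendsto_pow_atTop_nhds_top_iff.2 (by norm_num)
  · lift x to NNReal using hx
    have h1 : HasDerivAt (fun t : ℝ => Real.exp (-(t * x))) (-(x : ℝ)) 0 := by
      have := (((hasDerivAt_id (0 : ℝ)).mul_const (x : ℝ)).neg).exp
      simpa using this
    have h2 := h1.tendsto_slope_zero_right
    have h3 : Tendsto (fun n : ℕ => ((2 : ℝ) ^ n)⁻¹) atTop (𝓝[>] 0) := by
      refine tendsto_nhdsWithin_iff.2 ⟨?_, Eventually.of_forall fun n => by simp⟩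
      exact tendsto_inv_atTop_zero.comp (tendsto_pow_atTop_atTop_of_one_lt (by norm_num))
    have h4 := ((h2.comp h3).neg)
    have h5 := ENNReal.tendsto_ofReal h4
    have h6 : ENNReal.ofReal (- -(x : ℝ)) = x := by simp
    rw [h6] at h5
    refine h5.congr fun n => ?_
    have hpos : (0 : ℝ) < 2 ^ n := by positivity
    have h7 : ((2 : ℝ≥0∞) ^ n)⁻¹ * x = ENNReal.ofReal (((2 : ℝ) ^ n)⁻¹ * x) := by
      rw [ENNReal.ofReal_mul (by positivity), ENNReal.ofReal_inv_of_pos hpos,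
        ENNReal.ofReal_pow (by norm_num)]
      simp
    rw [expQuot, h7, eexp_ofReal (by positivity)]
    have h8 : (2 : ℝ≥0∞) ^ n = ENNReal.ofReal ((2 : ℝ) ^ n) := by
      rw [ENNReal.ofReal_pow (by norm_num)]; simp
    rw [h8, ← ENNReal.ofReal_one, ← ENNReal.ofReal_sub _ (Real.exp_pos _).le,
      ← ENNReal.ofReal_mul hpos.le]
    congr 1
    simp
    ring

lemma expQuot_le (n : ℕ) (x : ℝ≥0∞) : expQuot n x ≤ x :=
  (expQuot_mono_left x).ge_of_tendsto (tendsto_expQuot x) n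

lemma iSup_expQuot (x : ℝ≥0∞) : ⨆ n, expQuot n x = x :=
  tendsto_nhds_unique (tendsto_atTop_iSup (expQuot_mono_left x)) (tendsto_expQuot x)

/-! ### Mecke's formula for exponential functionals -/

section Mecke

variable {Ω E ι : Type*} [MeasurableSpace Ω] [MeasurableSpace E] [Countable ι]
  {P : Measure Ω} {Y : ι → Ω → E} {Λ : Measure E} {off : E}

/-- This is the derivative of the Laplace functional at `ψ` in the direction `g`. The quotients of
step `2^{-n}` increase to it on both sides, so no integrability of `g` is needed. -/
lemma HasPoissonLaplace.lintegral_tsum_mul_eexp (hL : HasPoissonLaplace P Y Λ off)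
    (hY : ∀ b, Measurable (Y b)) {ψ g : E → ℝ≥0∞} (hψ : Measurable ψ) (hψ0 : ψ off = 0)
    (hg : Measurable g) (hg0 : g off = 0) :
    ∫⁻ ω, eexp (∑' b, ψ (Y b ω)) * ∑' b, g (Y b ω) ∂P =
      eexp (∫⁻ y, (1 - eexp (ψ y)) ∂Λ) * ∫⁻ y, eexp (ψ y) * g y ∂Λ := by
  have hmψ : Measurable fun ω => ∑' b, ψ (Y b ω) := by fun_prop
  have hmg : Measurable fun ω => ∑' b, g (Y b ω) := by fun_prop
  have hme : Measurable fun ω => eexp (∑' b, ψ (Y b ω)) := measurable_eexp.comp hmψ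
  set L := eexp (∫⁻ y, (1 - eexp (ψ y)) ∂Λ) with hLdef
  set c : ℕ → ℝ≥0∞ := fun n => ∫⁻ y, eexp (ψ y) * expQuot n (g y) ∂Λ with hc
  set C := ∫⁻ y, eexp (ψ y) * g y ∂Λ with hC
  have hcC : ⨆ n, c n = C := by
    rw [hc, hC, ← lintegral_iSup]
    · congr 1; ext y
      rw [← ENNReal.mul_iSup, iSup_expQuot]
    · exact fun n => (measurable_eexp.comp hψ).mul ((measurable_expQuot n).comp hg)
    · intro n m h y
      exact mul_le_mul_right (expQuot_mono_left _ h) _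
  have hcm : Monotone c := fun n m h =>
    lintegral_mono fun y => mul_le_mul_right (expQuot_mono_left _ h) _
  have step (n : ℕ) : ∫⁻ ω, eexp (∑' b, ψ (Y b ω)) * expQuot n (∑' b, g (Y b ω)) ∂P =
      L * expQuot n (c n) := by
    have h2 : (2 : ℝ≥0∞) ^ n ≠ ⊤ := by simp
    have h20 : (2 : ℝ≥0∞) ^ n ≠ 0 := by simp
    have e1 : ∫⁻ ω, eexp (∑' b, ψ (Y b ω)) * eexp ((2 ^ n)⁻¹ * ∑' b, g (Y b ω)) ∂P =
        L * eexp ((2 ^ n)⁻¹ * c n) := by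
      have := hL (fun y => ψ y + (2 ^ n)⁻¹ * g y) (hψ.add (hg.const_mul _)) (by simp [hψ0, hg0])
      simp_rw [ENNReal.tsum_add, ENNReal.tsum_mul_left, eexp_add] at this
      rw [this, hLdef, hc, ← eexp_add]
      simp only
      rw [← lintegral_const_mul _ (by fun_prop), ← lintegral_add_left (by fun_prop)]
      congr 2; ext y
      -- The exponent is split as `1 - e^{-ψ} e^{-g/2^n} = (1 - e^{-ψ}) + e^{-ψ} (1 - e^{-g/2^n})`.
      have : (2 ^ n)⁻¹ * (eexp (ψ y) * expQuot n (g y)) =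
          eexp (ψ y) * (1 - eexp ((2 ^ n)⁻¹ * g y)) := by
        rw [expQuot, mul_left_comm, ← mul_assoc ((2 : ℝ≥0∞) ^ n)⁻¹, ENNReal.inv_mul_cancel h20 h2,
          one_mul]
      rw [this, ENNReal.mul_sub (fun _ _ => eexp_ne_top _), mul_one]
      rw [tsub_add_tsub_cancel (eexp_le_one _)
        (mul_le_of_le_one_right (zero_le) (eexp_le_one _))]
    have e2 : ∫⁻ ω, eexp (∑' b, ψ (Y b ω)) ∂P = L := hL ψ hψ hψ0
    have : ∀ ω, eexp (∑' b, ψ (Y b ω)) * expQuot n (∑' b, g (Y b ω)) =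
        2 ^ n * (eexp (∑' b, ψ (Y b ω)) -
          eexp (∑' b, ψ (Y b ω)) * eexp ((2 ^ n)⁻¹ * ∑' b, g (Y b ω))) := fun ω => by
      rw [expQuot, mul_left_comm, ENNReal.mul_sub (fun _ _ => eexp_ne_top _), mul_one]
    have hm2 : Measurable fun ω => eexp (∑' b, ψ (Y b ω)) * eexp ((2 ^ n)⁻¹ * ∑' b, g (Y b ω)) :=
      hme.mul (measurable_eexp.comp (hmg.const_mul _))
    simp_rw [this]
    rw [lintegral_const_mul _ (by fun_prop), lintegral_sub hm2, e1, e2, expQuot,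
      mul_left_comm, ENNReal.mul_sub (fun _ _ => eexp_ne_top _), mul_one]
    · rw [e1]; exact ENNReal.mul_ne_top (eexp_ne_top _) (eexp_ne_top _)
    · exact ae_of_all _ fun ω => mul_le_of_le_one_right (zero_le) (eexp_le_one _)
  have hl : ∫⁻ ω, eexp (∑' b, ψ (Y b ω)) * ∑' b, g (Y b ω) ∂P =
      ⨆ n, ∫⁻ ω, eexp (∑' b, ψ (Y b ω)) * expQuot n (∑' b, g (Y b ω)) ∂P := by
    rw [← lintegral_iSup]
    · congr 1; ext ω
      rw [← ENNReal.mul_iSup, iSup_expQuot]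
    · exact fun n => hme.mul ((measurable_expQuot n).comp hmg)
    · intro n m h ω
      exact mul_le_mul_right (expQuot_mono_left _ h) _
  rw [hl]
  simp_rw [step]
  rw [← ENNReal.mul_iSup]
  congr 1
  -- Diagonal limit: `expQuot n (c n)` increases to `C` because the quotient is monotone in its
  -- index and in its argument.
  apply le_antisymm
  · exact iSup_le fun n => (expQuot_le n _).trans (hcC ▸ le_iSup c n)
  · rw [← hcC]
    refine iSup_le fun m => ?_
    rw [← iSup_expQuot (c m)]
    refine iSup_le fun n => le_trans ?_ (le_iSup _ (max n m))
    exact (expQuot_mono_left _ (le_max_left n m)).trans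
      (expQuot_mono_right _ (hcm (le_max_right n m)))

/-- The derivative formula is applied to `g / e^{-ψ}`: in the summand of `b` the division removes
exactly the factor `e^{-ψ (Y b)}` from the exponential of the full sum. This is where `ψ` must be
finite. -/
lemma HasPoissonLaplace.mecke_eexp_of_ne_top [DecidableEq ι] (hL : HasPoissonLaplace P Y Λ off)
    (hY : ∀ b, Measurable (Y b)) {ψ g : E → ℝ≥0∞} (hψ : Measurable ψ) (hψ0 : ψ off = 0)
    (hψt : ∀ y, ψ y ≠ ⊤) (hg : Measurable g) (hg0 : g off = 0) :
    ∫⁻ ω, ∑' b, g (Y b ω) * eexp (∑' j, if j = b then 0 else ψ (Y j ω)) ∂P =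
      (∫⁻ y, g y ∂Λ) * eexp (∫⁻ y, (1 - eexp (ψ y)) ∂Λ) := by
  have hm : Measurable fun y => (eexp (ψ y))⁻¹ := (measurable_eexp.comp hψ).inv
  have := hL.lintegral_tsum_mul_eexp hY hψ hψ0 (hm.mul hg) (by simp [hg0])
  have e (y : E) : eexp (ψ y) * ((eexp (ψ y))⁻¹ * g y) = g y := by
    rw [← mul_assoc, ENNReal.mul_inv_cancel (eexp_ne_zero (hψt y)) (eexp_ne_top _), one_mul]
  simp only [Pi.mul_apply, e] at this
  rw [mul_comm, ← this]
  congr 1; ext ω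
  rw [← ENNReal.tsum_mul_left]
  congr 1; ext b
  rw [ENNReal.tsum_eq_add_tsum_ite (f := fun b => ψ (Y b ω)) b, eexp_add, mul_right_comm, e]
  congr!

/-- Infinite values of `ψ`, needed to encode void events, are reached by truncation at `n`. The sums
are dominated by `∑ g (Y b)`, whose expectation `∫ g` is finite. -/
lemma HasPoissonLaplace.mecke_eexp [DecidableEq ι] (hL : HasPoissonLaplace P Y Λ off)
    (hY : ∀ b, Measurable (Y b)) {ψ g : E → ℝ≥0∞} (hψ : Measurable ψ) (hψ0 : ψ off = 0)
    (hg : Measurable g) (hg0 : g off = 0) (hgfin : ∫⁻ y, g y ∂Λ ≠ ⊤) :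
    ∫⁻ ω, ∑' b, g (Y b ω) * eexp (∑' j, if j = b then 0 else ψ (Y j ω)) ∂P =
      (∫⁻ y, g y ∂Λ) * eexp (∫⁻ y, (1 - eexp (ψ y)) ∂Λ) := by
  have hmin (x : ℝ≥0∞) : Tendsto (fun n : ℕ => min x n) atTop (𝓝 x) := by
    have : Tendsto (fun n : ℕ => min x (n : ℝ≥0∞)) atTop (𝓝 (min x ⊤)) :=
      tendsto_const_nhds.min ENNReal.tendsto_nat_nhds_top
    simpa using this
  have hmono (x : ℝ≥0∞) : Monotone fun n : ℕ => min x (n : ℝ≥0∞) := fun n m h => by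
    simp only; gcongr
  have hmn (n : ℕ) : Measurable fun y => min (ψ y) (n : ℝ≥0∞) := hψ.min measurable_const
  have hn (n : ℕ) := hL.mecke_eexp_of_ne_top hY (ψ := fun y => min (ψ y) n) (g := g)
    (hmn n) (by simp [hψ0])
    (fun y => (min_le_right _ _ |>.trans_lt (ENNReal.natCast_lt_top n)).ne) hg hg0
  have h0 : ∫⁻ ω, ∑' b, g (Y b ω) ∂P = ∫⁻ y, g y ∂Λ := by
    have := hL.mecke_eexp_of_ne_top hY (ψ := fun y => 0) (g := g) measurable_const rfl (by simp)
      hg hg0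
    simpa using this
  have hsum (ω : Ω) (b : ι) : Tendsto (fun n : ℕ => ∑' j, if j = b then 0 else min (ψ (Y j ω)) n)
      atTop (𝓝 (∑' j, if j = b then 0 else ψ (Y j ω))) := by
    let : MeasurableSpace ι := ⊤
    simp_rw [← lintegral_count]
    refine lintegral_tendsto_of_tendsto_of_monotone (fun n => measurable_from_top.aemeasurable)
      (ae_of_all _ fun j n m h => ?_) (ae_of_all _ fun j => ?_)
    · by_cases hj : j = b
      · simp [hj]
      · simpa [hj] using hmono (ψ (Y j ω)) h
    · by_cases hj : j = b
      · simp [hj]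
      · simpa [hj] using hmin (ψ (Y j ω))
  have hl : Tendsto (fun n : ℕ => ∫⁻ ω, ∑' b, g (Y b ω) *
      eexp (∑' j, if j = b then 0 else min (ψ (Y j ω)) n) ∂P) atTop
      (𝓝 (∫⁻ ω, ∑' b, g (Y b ω) * eexp (∑' j, if j = b then 0 else ψ (Y j ω)) ∂P)) := by
    have hgf : ∀ᵐ ω ∂P, ∑' b, g (Y b ω) ≠ ⊤ := by
      have := ae_lt_top (μ := P) (f := fun ω => ∑' b, g (Y b ω)) (by fun_prop) (by rwa [h0])
      filter_upwards [this] with ω hω using hω.ne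
    refine tendsto_lintegral_of_dominated_convergence (fun ω => ∑' b, g (Y b ω)) (fun n => ?_)
      (fun n => ae_of_all _ fun ω => ?_) (by rwa [h0]) ?_
    · refine Measurable.tsum fun b => (hg.comp (hY b)).mul
        (measurable_eexp.comp (Measurable.tsum fun j => ?_))
      split_ifs
      · exact measurable_const
      · exact (hmn n).comp (hY j)
    · exact ENNReal.tsum_le_tsum fun b => mul_le_of_le_one_right (zero_le) (eexp_le_one _)
    · filter_upwards [hgf] with ω hω
      refine tendsto_tsum_of_le (bound := fun b => g (Y b ω)) (fun n b =>
        mul_le_of_le_one_right (zero_le) (eexp_le_one _)) hω fun b => ?_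
      exact ENNReal.Tendsto.const_mul (continuous_eexp.continuousAt.tendsto.comp (hsum ω b))
        (Or.inr (ENNReal.ne_top_of_tsum_ne_top hω b))
  simp_rw [hn] at hl
  have hr : Tendsto (fun n : ℕ => (∫⁻ y, g y ∂Λ) * eexp (∫⁻ y, (1 - eexp (min (ψ y) n)) ∂Λ)) atTop
      (𝓝 ((∫⁻ y, g y ∂Λ) * eexp (∫⁻ y, (1 - eexp (ψ y)) ∂Λ))) := by
    refine ENNReal.Tendsto.const_mul (continuous_eexp.continuousAt.tendsto.comp ?_) (Or.inr hgfin)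
    refine lintegral_tendsto_of_tendsto_of_monotone
      (fun n => (measurable_const.sub (measurable_eexp.comp (hmn n))).aemeasurable)
      (ae_of_all _ fun y n m h => tsub_le_tsub_left (antitone_eexp (hmono _ h)) _)
      (ae_of_all _ fun y => ?_)
    exact ENNReal.Tendsto.sub tendsto_const_nhds
      (continuous_eexp.continuousAt.tendsto.comp (hmin _)) (Or.inl ENNReal.one_ne_top)
  exact tendsto_nhds_unique hl hr

end Mecke

/-! ### Adding a point to a Poisson process -/

/-- An infinite penalty above the threshold turns the exponential into the indicator that no `u j`
exceeds `c`. The supremum and the sum thus fit into one Laplace functional. -/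
lemma eexp_tsum_threshold {ι : Type*} (u v : ι → ℝ≥0∞) (c : ℝ≥0∞) (k : ℕ) :
    eexp (∑' j, ((if u j ≤ c then 0 else ⊤) + k * v j)) =
      if (⨆ j, u j) ≤ c then eexp (∑' j, v j) ^ k else 0 := by
  split_ifs with h
  · have h' : ∀ j, u j ≤ c := iSup_le_iff.1 h
    simp only [h', if_true, zero_add]
    rw [ENNReal.tsum_mul_left, eexp_natCast_mul]
  · rw [iSup_le_iff, not_forall] at h
    obtain ⟨j, hj⟩ := h
    rw [eexp_eq_zero_iff]
    refine ENNReal.tsum_eq_top_of_eq_top ⟨j, ?_⟩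
    simp [hj]

section Mecke

variable {Ω E ι : Type*} [MeasurableSpace Ω] [MeasurableSpace E] [Countable ι]
  {P : Measure Ω} {Y : ι → Ω → E} {Λ : Measure E} {off : E}

/-- Mecke's formula for functionals of a point, of the supremum of `a` and of the sum of `r` over
the other points. -/
theorem HasPoissonLaplace.mecke [DecidableEq ι] [IsProbabilityMeasure P] [SigmaFinite Λ]
    [MeasurableSingletonClass E] (hL : HasPoissonLaplace P Y Λ off) (hY : ∀ b, Measurable (Y b))
    (hoff : Λ {off} = 0) {a r : E → ℝ≥0∞} (ha : Measurable a) (ha0 : a off = 0)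
    (hr : Measurable r) (hr0 : r off = 0) {F : E × ℝ≥0∞ × ℝ≥0∞ → ℝ≥0∞} (hF : Measurable F)
    (hF0 : ∀ x, F (off, x) = 0) :
    ∑' b, ∫⁻ ω, F (Y b ω, ⨆ j, (if j = b then 0 else a (Y j ω)),
        ∑' j, if j = b then 0 else r (Y j ω)) ∂P =
      ∫⁻ y, ∫⁻ ω, F (y, ⨆ j, a (Y j ω), ∑' j, r (Y j ω)) ∂P ∂Λ := by
  set A : ι → Ω → ℝ≥0∞ := fun b ω => ⨆ j, (if j = b then 0 else a (Y j ω)) with hA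
  set I : ι → Ω → ℝ≥0∞ := fun b ω => ∑' j, if j = b then 0 else r (Y j ω) with hI
  have hmA (b : ι) : Measurable (A b) := by
    refine Measurable.iSup fun j => ?_
    split_ifs <;> fun_prop
  have hmI (b : ι) : Measurable (I b) := by
    refine Measurable.tsum fun j => ?_
    split_ifs <;> fun_prop
  have hmA0 : Measurable fun ω => ⨆ j, a (Y j ω) := Measurable.iSup fun j => ha.comp (hY j)
  have hmI0 : Measurable fun ω => ∑' j, r (Y j ω) := Measurable.tsum fun j => hr.comp (hY j)
  have hmoff : MeasurableSet ({off}ᶜ : Set E) := (measurableSet_singleton off).compl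
  set T : ι → Ω → E × ℝ≥0∞ × ℝ≥0∞ := fun b ω => (Y b ω, A b ω, I b ω) with hT
  set V : Ω → ℝ≥0∞ × ℝ≥0∞ := fun ω => (⨆ j, a (Y j ω), ∑' j, r (Y j ω)) with hV
  have hmT (b : ι) : Measurable (T b) := (hY b).prodMk ((hmA b).prodMk (hmI b))
  have hmV : Measurable V := hmA0.prodMk hmI0
  -- Mecke's formula says that these two measures agree: the summed laws of a point with the
  -- supremum and the sum over the others, and the product of `Λ` with the joint law over all
  -- points. The state `off` is removed because infinitely many indices may sit there.
  set M₁ : Measure (E × ℝ≥0∞ × ℝ≥0∞) :=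
    Measure.sum fun b => (P.restrict (Y b ⁻¹' {off}ᶜ)).map (T b) with hM₁
  set M₂ : Measure (E × ℝ≥0∞ × ℝ≥0∞) := Λ.prod (P.map V) with hM₂
  have hoffG (G : Set E) : Λ (G ∩ {off}ᶜ) = Λ G := by
    rw [← sdiff_eq, measure_sdiff_null hoff]
  have hM₁l {f : E × ℝ≥0∞ × ℝ≥0∞ → ℝ≥0∞} (hf : Measurable f) :
      ∫⁻ x, f x ∂M₁ = ∑' b, ∫⁻ ω in Y b ⁻¹' {off}ᶜ, f (T b ω) ∂P := by
    rw [hM₁, lintegral_sum_measure]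
    exact tsum_congr fun b => lintegral_map hf (hmT b)
  have hM₂l {f : E × ℝ≥0∞ × ℝ≥0∞ → ℝ≥0∞} (hf : Measurable f) :
      ∫⁻ x, f x ∂M₂ = ∫⁻ y, ∫⁻ ω, f (y, V ω) ∂P ∂Λ := by
    rw [hM₂, lintegral_prod _ hf.aemeasurable]
    exact lintegral_congr fun y => lintegral_map (hf.comp measurable_prodMk_left) hmV
  -- the two measures have the same Laplace transforms
  have key (G : Set E) (hG : MeasurableSet G) (hGfin : Λ G ≠ ⊤) (c : ℝ≥0∞) (k : ℕ) :
      ∫⁻ x in G ×ˢ (Iic c ×ˢ univ), eexp x.2.2 ^ k ∂M₁ =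
        ∫⁻ x in G ×ˢ (Iic c ×ˢ univ), eexp x.2.2 ^ k ∂M₂ := by
    have hS : MeasurableSet (G ×ˢ (Iic c ×ˢ (univ : Set ℝ≥0∞))) :=
      hG.prod (measurableSet_Iic.prod MeasurableSet.univ)
    have hmf : Measurable ((G ×ˢ (Iic c ×ˢ (univ : Set ℝ≥0∞))).indicator
        fun x : E × ℝ≥0∞ × ℝ≥0∞ => eexp x.2.2 ^ k) := by
      refine Measurable.indicator ?_ hS
      fun_prop
    set ψ : E → ℝ≥0∞ := fun y => (if a y ≤ c then 0 else ⊤) + k * r y with hψ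
    have hmψ : Measurable ψ :=
      (Measurable.ite (measurableSet_le ha measurable_const) measurable_const
        measurable_const).add (hr.const_mul _)
    have hψ0 : ψ off = 0 := by simp [hψ, ha0, hr0]
    set g : E → ℝ≥0∞ := (G ∩ {off}ᶜ).indicator 1 with hg
    have hmg : Measurable g := measurable_one.indicator (hG.inter hmoff)
    have hgint : ∫⁻ y, g y ∂Λ = Λ G := by
      rw [hg, lintegral_indicator_one (hG.inter hmoff), hoffG]
    have h1 := hL.mecke_eexp hY hmψ hψ0 hmg (by simp [hg]) (by rwa [hgint])
    rw [← hL ψ hmψ hψ0, hgint] at h1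
    rw [← lintegral_indicator hS, ← lintegral_indicator hS, hM₁l hmf, hM₂l hmf]
    have e1 : ∑' b, ∫⁻ ω in Y b ⁻¹' {off}ᶜ, (G ×ˢ (Iic c ×ˢ (univ : Set ℝ≥0∞))).indicator
        (fun x : E × ℝ≥0∞ × ℝ≥0∞ => eexp x.2.2 ^ k) (T b ω) ∂P =
        ∫⁻ ω, ∑' b, g (Y b ω) * eexp (∑' j, if j = b then 0 else ψ (Y j ω)) ∂P := by
      rw [lintegral_tsum]
      · refine tsum_congr fun b => ?_
        rw [← lintegral_indicator ((hY b) hmoff)]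
        refine lintegral_congr fun ω => ?_
        have : ∑' j, (if j = b then 0 else ψ (Y j ω)) =
            ∑' j, ((if (if j = b then 0 else a (Y j ω)) ≤ c then 0 else ⊤) +
              k * (if j = b then 0 else r (Y j ω))) := by
          refine tsum_congr fun j => ?_
          by_cases hj : j = b <;> simp [hj, hψ]
        rw [this, eexp_tsum_threshold]
        change _ = g (Y b ω) * if A b ω ≤ c then eexp (I b ω) ^ k else 0
        by_cases h1 : Y b ω ∈ G <;> by_cases h2 : Y b ω = off <;> by_cases h3 : A b ω ≤ c <;>
          simp [hg, indicator, h1, h2, hT, h3]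
      · intro b
        refine ((hmg.comp (hY b)).mul (measurable_eexp.comp
          (Measurable.tsum fun j => ?_))).aemeasurable
        split_ifs
        · exact measurable_const
        · exact hmψ.comp (hY j)
    have e2 : ∫⁻ y, ∫⁻ ω, (G ×ˢ (Iic c ×ˢ (univ : Set ℝ≥0∞))).indicator
        (fun x : E × ℝ≥0∞ × ℝ≥0∞ => eexp x.2.2 ^ k) (y, V ω) ∂P ∂Λ =
        Λ G * ∫⁻ ω, eexp (∑' b, ψ (Y b ω)) ∂P := by
      rw [mul_comm, ← lintegral_indicator_one hG, ← lintegral_const_mul _ (by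
        exact measurable_one.indicator hG)]
      refine lintegral_congr fun y => ?_
      by_cases hy : y ∈ G
      · simp only [indicator_of_mem hy, Pi.one_apply, mul_one]
        refine lintegral_congr fun ω => ?_
        rw [hψ, eexp_tsum_threshold]
        change _ = if (V ω).1 ≤ c then eexp (V ω).2 ^ k else 0
        by_cases h3 : (V ω).1 ≤ c <;> simp [hy, h3, indicator]
      · simp [hy, indicator]
    rw [e1, e2, h1]
  have hfin (G : Set E) (hG : MeasurableSet G) (hGfin : Λ G ≠ ⊤) (c : ℝ≥0∞) :
      M₁ (G ×ˢ (Iic c ×ˢ univ)) = M₂ (G ×ˢ (Iic c ×ˢ univ)) := by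
    simpa using key G hG hGfin c 0
  have hM₂fin (G : Set E) (hGfin : Λ G ≠ ⊤) (s : Set (ℝ≥0∞ × ℝ≥0∞)) : M₂ (G ×ˢ s) ≠ ⊤ := by
    rw [hM₂, Measure.prod_prod]
    have := Measure.isProbabilityMeasure_map (μ := P) hmV.aemeasurable
    exact ENNReal.mul_ne_top hGfin (measure_ne_top _ _)
  have heq : M₁ = M₂ := by
    -- Both measures are finite over each spanning set, so uniqueness theorems for finite measures
    -- apply there.
    have hU : ⋃ n, spanningSets Λ n ×ˢ (univ : Set (ℝ≥0∞ × ℝ≥0∞)) = univ := by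
      rw [← iUnion_prod_const, iUnion_spanningSets, univ_prod_univ]
    rw [← Measure.restrict_univ (μ := M₁), ← Measure.restrict_univ (μ := M₂), ← hU,
      Measure.restrict_iUnion_congr]
    intro n
    have hSm := measurableSet_spanningSets Λ n
    have hSf := (measure_spanningSets_lt_top Λ n).ne
    have hM₁fin : M₁ (spanningSets Λ n ×ˢ univ) ≠ ⊤ := by
      have := hfin _ hSm hSf ⊤
      rw [Iic_top, univ_prod_univ] at this
      rw [this]
      exact hM₂fin _ hSf _
    have : IsFiniteMeasure (M₁.restrict (spanningSets Λ n ×ˢ univ)) :=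
      ⟨by simpa using hM₁fin.lt_top⟩
    have : IsFiniteMeasure (M₂.restrict (spanningSets Λ n ×ˢ univ)) :=
      ⟨by simpa using (hM₂fin _ hSf _).lt_top⟩
    rw [Measure.ext_prod₃_iff]
    intro G t u hG ht hu
    have hM₁fin' (s : Set (E × ℝ≥0∞ × ℝ≥0∞)) (hs : s ⊆ spanningSets Λ n ×ˢ univ) : M₁ s ≠ ⊤ :=
      ((measure_mono hs).trans_lt hM₁fin.lt_top).ne
    have hM₂fin' (s : Set (E × ℝ≥0∞ × ℝ≥0∞)) (hs : s ⊆ spanningSets Λ n ×ˢ univ) : M₂ s ≠ ⊤ :=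
      ((measure_mono hs).trans_lt (hM₂fin _ hSf _).lt_top).ne
    have hmeas : MeasurableSet (G ×ˢ (t ×ˢ u)) := hG.prod (ht.prod hu)
    have hinter : G ×ˢ (t ×ˢ u) ∩ spanningSets Λ n ×ˢ univ =
        (G ∩ spanningSets Λ n) ×ˢ (t ×ˢ u) := by
      rw [prod_inter_prod, inter_univ]
    rw [Measure.restrict_apply hmeas, Measure.restrict_apply hmeas, hinter]
    set G' := G ∩ spanningSets Λ n with hG'
    have hG'm : MeasurableSet G' := hG.inter hSm
    have hG'f : Λ G' ≠ ⊤ := ((measure_mono inter_subset_right).trans_lt hSf.lt_top).ne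
    have hsub (s : Set (ℝ≥0∞ × ℝ≥0∞)) : G' ×ˢ s ⊆ spanningSets Λ n ×ˢ univ :=
      prod_mono inter_subset_right (subset_univ s)
    -- The rectangle is opened one coordinate at a time. With `G'` and `c` fixed, the law of the sum
    -- is determined by its Laplace transforms at `k = 0, 1, …`, which `key` compares.
    have hIic (c : ℝ≥0∞) : M₁ (G' ×ˢ (Iic c ×ˢ u)) = M₂ (G' ×ˢ (Iic c ×ˢ u)) := by
      have hm : Measurable fun x : E × ℝ≥0∞ × ℝ≥0∞ => x.2.2 := by fun_prop
      have : (M₁.restrict (G' ×ˢ (Iic c ×ˢ univ))).map (fun x => x.2.2) =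
          (M₂.restrict (G' ×ˢ (Iic c ×ˢ univ))).map (fun x => x.2.2) := by
        have : IsFiniteMeasure (M₁.restrict (G' ×ˢ (Iic c ×ˢ univ))) :=
          ⟨by simpa using (hM₁fin' _ (hsub _)).lt_top⟩
        have : IsFiniteMeasure (M₂.restrict (G' ×ˢ (Iic c ×ˢ univ))) :=
          ⟨by simpa using (hM₂fin' _ (hsub _)).lt_top⟩
        refine ext_of_lintegral_eexp_pow fun k => ?_
        rw [lintegral_map (by fun_prop) hm, lintegral_map (by fun_prop) hm,
          key G' hG'm hG'f c k]
      have h2 := congrArg (fun μ : Measure ℝ≥0∞ => μ u) this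
      have hpre : (fun x : E × ℝ≥0∞ × ℝ≥0∞ => x.2.2) ⁻¹' u ∩ G' ×ˢ (Iic c ×ˢ univ) =
          G' ×ˢ (Iic c ×ˢ u) := by
        ext x; simp only [mem_inter_iff, mem_preimage, mem_prod, mem_univ]; tauto
      rwa [Measure.map_apply hm hu, Measure.map_apply hm hu, Measure.restrict_apply (hm hu),
        Measure.restrict_apply (hm hu), hpre] at h2
    have hm : Measurable fun x : E × ℝ≥0∞ × ℝ≥0∞ => x.2.1 := by fun_prop
    have hpre (t : Set ℝ≥0∞) : (fun x : E × ℝ≥0∞ × ℝ≥0∞ => x.2.1) ⁻¹' t ∩ G' ×ˢ (univ ×ˢ u) =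
        G' ×ˢ (t ×ˢ u) := by
      ext x; simp only [mem_inter_iff, mem_preimage, mem_prod, mem_univ]; tauto
    -- With `G'` and `u` fixed, the law of the supremum is determined by the half-lines `Iic c`.
    have : (M₁.restrict (G' ×ˢ (univ ×ˢ u))).map (fun x => x.2.1) =
        (M₂.restrict (G' ×ˢ (univ ×ˢ u))).map (fun x => x.2.1) := by
      have : IsFiniteMeasure (M₁.restrict (G' ×ˢ (univ ×ˢ u))) :=
        ⟨by simpa using (hM₁fin' _ (hsub _)).lt_top⟩
      refine Measure.ext_of_Iic _ _ fun c => ?_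
      rw [Measure.map_apply hm measurableSet_Iic, Measure.map_apply hm measurableSet_Iic,
        Measure.restrict_apply (hm measurableSet_Iic),
        Measure.restrict_apply (hm measurableSet_Iic), hpre, hIic]
    have h2 := congrArg (fun μ : Measure ℝ≥0∞ => μ t) this
    rwa [Measure.map_apply hm ht, Measure.map_apply hm ht, Measure.restrict_apply (hm ht),
      Measure.restrict_apply (hm ht), hpre] at h2
  have h1 := hM₁l hF
  have h2 := hM₂l hF
  rw [← heq, h1] at h2
  rw [← h2]
  refine tsum_congr fun b => ?_
  rw [← lintegral_indicator ((hY b) hmoff)]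
  refine lintegral_congr fun ω => ?_
  by_cases h : Y b ω = off
  · simp [h, hF0, hT]
  · simp [h, hT, hA, hI]

/-- A variable that is independent of all Laplace transforms of a sum is independent of the
sum. -/
lemma indepFun_of_laplace {Z : Type*} [MeasurableSpace Z] [IsProbabilityMeasure P] {X : Ω → Z}
    {J : Ω → ℝ≥0∞} (hJ : Measurable J)
    (h : ∀ B, MeasurableSet B → ∀ k : ℕ,
      ∫⁻ ω in X ⁻¹' B, eexp (J ω) ^ k ∂P = P (X ⁻¹' B) * ∫⁻ ω, eexp (J ω) ^ k ∂P) :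
    IndepFun X J P := by
  rw [indepFun_iff_measure_inter_preimage_eq_mul]
  intro B D hB hD
  have : (P.restrict (X ⁻¹' B)).map J = (P (X ⁻¹' B)) • P.map J := by
    have : IsFiniteMeasure ((P (X ⁻¹' B)) • P.map J) := by
      refine ⟨?_⟩
      rw [Measure.smul_apply]
      exact ENNReal.mul_lt_top (measure_lt_top _ _) (measure_lt_top _ _)
    refine ext_of_lintegral_eexp_pow fun k => ?_
    rw [lintegral_map (by fun_prop) hJ, h B hB k, lintegral_smul_measure,
      lintegral_map (by fun_prop) hJ, smul_eq_mul]
  have h2 := congrArg (fun μ : Measure ℝ≥0∞ => μ D) this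
  simp only [Measure.smul_apply, smul_eq_mul] at h2
  rw [Measure.map_apply hJ hD, Measure.map_apply hJ hD, Measure.restrict_apply (hJ hD)] at h2
  rw [inter_comm, h2]

end Mecke

/-! ### Laplace functional of Poisson processes -/

lemma lintegral_eexp_poissonMeasure (r : NNReal) (c : ℝ≥0∞) :
    ∫⁻ n, eexp (c * n) ∂(poissonMeasure r).map (Nat.cast : ℕ → ℝ≥0∞) =
      eexp ((1 - eexp c) * r) := by
  set q := (eexp c).toReal with hq
  have hq0 : 0 ≤ q := ENNReal.toReal_nonneg
  have hqe : eexp c = ENNReal.ofReal q := (ENNReal.ofReal_toReal (eexp_ne_top c)).symm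
  have hq1 : q ≤ 1 := ENNReal.toReal_le_of_le_ofReal zero_le_one (by simpa using eexp_le_one c)
  rw [lintegral_map (by fun_prop) .of_discrete, poissonMeasure, lintegral_sum_measure]
  simp_rw [lintegral_smul_measure, lintegral_dirac, mul_comm c, eexp_natCast_mul, smul_eq_mul, hqe,
    ← ENNReal.ofReal_pow hq0]
  have h1 (n : ℕ) : ENNReal.ofReal (Real.exp (-r) * r ^ n / n.factorial) * ENNReal.ofReal (q ^ n) =
      ENNReal.ofReal (Real.exp (-r) * ((r * q) ^ n / n.factorial)) := by
    rw [← ENNReal.ofReal_mul (by positivity)]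
    congr 1
    rw [mul_pow]; ring
  have hs := (NormedSpace.expSeries_div_hasSum_exp ((r : ℝ) * q)).mul_left (Real.exp (-r))
  rw [← Real.exp_eq_exp_ℝ] at hs
  simp_rw [h1]
  rw [← ENNReal.ofReal_tsum_of_nonneg (fun n => by positivity) hs.summable, hs.tsum_eq,
    ← ENNReal.ofReal_one, ← ENNReal.ofReal_sub _ hq0, ← ENNReal.ofReal_coe_nnreal,
    ← ENNReal.ofReal_mul (by linarith), eexp_ofReal (mul_nonneg (by linarith) r.coe_nonneg),
    ← Real.exp_add]
  congr 2
  ring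

lemma counting_apply {Ω : Type*} (X : Ω → ℕ → Plane) (ω : Ω) {B : Set Plane}
    (hB : MeasurableSet B) : counting X ω B = ∑' i, B.indicator 1 (X ω i) := by
  rw [counting, Measure.sum_apply _ hB]
  exact tsum_congr fun i => Measure.dirac_apply' _ hB

lemma lintegral_counting {Ω : Type*} (X : Ω → ℕ → Plane) (ω : Ω) {f : Plane → ℝ≥0∞}
    (hf : Measurable f) : ∫⁻ x, f x ∂counting X ω = ∑' i, f (X ω i) := by
  rw [counting, lintegral_sum_measure]
  exact tsum_congr fun i => lintegral_dirac' _ hf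

namespace IsPoissonProcess

variable {Ω : Type*} [MeasurableSpace Ω] {P : Measure Ω} {X : Ω → ℕ → Plane} {Λ : Measure Plane}

lemma measurable_counting (hX : IsPoissonProcess P X Λ) {B : Set Plane} (hB : MeasurableSet B) :
    Measurable fun ω => counting X ω B := by
  simp_rw [counting_apply X _ hB]
  exact Measurable.tsum fun i =>
    (measurable_one.indicator hB).comp ((measurable_pi_apply i).comp hX.measurable)

/-- The level sets of a simple function are disjoint, so their counts are independent Poisson
variables and the expectation factors. -/
lemma laplace_simpleFunc (hX : IsPoissonProcess P X Λ) (f : SimpleFunc Plane ℝ≥0∞)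
    (hf : ∀ c, c ≠ 0 → Λ (f ⁻¹' {c}) ≠ ⊤) :
    ∫⁻ ω, eexp (∫⁻ x, f x ∂counting X ω) ∂P = eexp (∫⁻ x, (1 - eexp (f x)) ∂Λ) := by
  classical
  -- The level set of `0` may have infinite intensity. It contributes nothing to either side and is
  -- dropped.
  set s := f.range.filter (· ≠ 0) with hs
  set e := s.equivFin
  set B : Fin s.card → Set Plane := fun i => f ⁻¹' {(e.symm i : ℝ≥0∞)} with hBdef
  have hB (i) : MeasurableSet (B i) := f.measurableSet_fiber _
  have hdisj : Pairwise fun i j => Disjoint (B i) (B j) := by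
    intro i j hij
    refine Disjoint.preimage f (disjoint_singleton.2 fun h => hij ?_)
    exact e.symm.injective (Subtype.ext h)
  have hind := (hX.indep _ B hB hdisj).comp (fun i x => eexp ((e.symm i : ℝ≥0∞) * x))
    (fun i => by fun_prop)
  have hsum (g : ℝ≥0∞ → ℝ≥0∞) (h0 : g 0 = 0) (ν : Measure Plane) :
      ∑ c ∈ f.range, g c * ν (f ⁻¹' {c}) = ∑ i, g (e.symm i) * ν (B i) := by
    rw [← Finset.sum_filter_of_ne (p := (· ≠ 0)) (fun c _ h hc => h (by simp [hc, h0])), ← hs,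
      ← Finset.sum_coe_sort s fun c => g c * ν (f ⁻¹' {c}),
      ← Equiv.sum_comp e.symm]
  have h1 (ω : Ω) : eexp (∫⁻ x, f x ∂counting X ω) =
      ∏ i, eexp ((e.symm i : ℝ≥0∞) * counting X ω (B i)) := by
    rw [SimpleFunc.lintegral_eq_lintegral, SimpleFunc.lintegral, hsum (fun c => c) rfl, eexp_sum]
  have h2 : ∫⁻ x, (1 - eexp (f x)) ∂Λ = ∑ i, (1 - eexp (e.symm i)) * Λ (B i) := by
    have : ∫⁻ x, (1 - eexp (f x)) ∂Λ = ∫⁻ x, (f.map fun c => 1 - eexp c) x ∂Λ := rfl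
    rw [this, SimpleFunc.lintegral_eq_lintegral, SimpleFunc.map_lintegral]
    exact hsum (fun c => 1 - eexp c) (by simp) Λ
  simp_rw [h1]
  rw [h2, eexp_sum]
  refine (lintegral_prod_eq_prod_lintegral_of_indepFun Finset.univ _ hind
    (fun i => (measurable_eexp.comp (measurable_const_mul _)).comp
      (hX.measurable_counting (hB i)))).trans ?_
  refine Finset.prod_congr rfl fun i _ => ?_
  have hne : Λ (B i) ≠ ⊤ := hf _ (Finset.mem_filter.1 (e.symm i).2).2
  have h3 := hX.law (B i) (hB i) hne
  have h4 : ∫⁻ ω, eexp ((e.symm i : ℝ≥0∞) * counting X ω (B i)) ∂P =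
      ∫⁻ n, eexp ((e.symm i : ℝ≥0∞) * n) ∂P.map (fun ω => counting X ω (B i)) := by
    rw [lintegral_map (by fun_prop) (hX.measurable_counting (hB i))]
  change ∫⁻ ω, eexp ((e.symm i : ℝ≥0∞) * counting X ω (B i)) ∂P = _
  rw [h4, h3, lintegral_eexp_poissonMeasure, ENNReal.coe_toNNReal hne]

/-- The Laplace functional of a Poisson process. -/
theorem laplace [IsFiniteMeasure P] [SigmaFinite Λ] (hX : IsPoissonProcess P X Λ)
    {ψ : Plane → ℝ≥0∞} (hψ : Measurable ψ) :
    ∫⁻ ω, eexp (∑' i, ψ (X ω i)) ∂P = eexp (∫⁻ x, (1 - eexp (ψ x)) ∂Λ) := by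
  -- Cutting off outside the spanning sets gives the nonzero level sets finite intensity.
  set f : ℕ → SimpleFunc Plane ℝ≥0∞ := fun n =>
    (SimpleFunc.eapprox ψ n).restrict (spanningSets Λ n) with hf
  have hfx (n x) : f n x = (spanningSets Λ n).indicator (SimpleFunc.eapprox ψ n) x := by
    rw [hf, SimpleFunc.restrict_apply _ (measurableSet_spanningSets Λ n)]
  have hmono : Monotone fun n x => f n x := by
    intro n m h x
    simp only [hfx]
    refine (indicator_le_indicator_of_subset (monotone_spanningSets Λ h)
      (fun _ => zero_le) x).trans (indicator_le_indicator ?_)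
    exact SimpleFunc.monotone_eapprox ψ h x
  have hlim (x : Plane) : Tendsto (fun n => f n x) atTop (𝓝 (ψ x)) := by
    have h1 : Tendsto (fun n => SimpleFunc.eapprox ψ n x) atTop (𝓝 (ψ x)) := by
      have := tendsto_atTop_iSup (f := fun n => SimpleFunc.eapprox ψ n x)
        (fun n m h => SimpleFunc.monotone_eapprox ψ h x)
      rwa [SimpleFunc.iSup_eapprox_apply hψ] at this
    refine h1.congr' ?_
    have hx : x ∈ ⋃ n, spanningSets Λ n := by rw [iUnion_spanningSets]; trivial
    obtain ⟨N, hN⟩ := mem_iUnion.1 hx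
    filter_upwards [eventually_ge_atTop N] with n hn
    rw [hfx, indicator_of_mem (monotone_spanningSets Λ hn hN)]
  have hstep (n : ℕ) := hX.laplace_simpleFunc (f n) fun c hc => by
    refine ((measure_mono ?_).trans_lt (measure_spanningSets_lt_top Λ n)).ne
    intro x hx
    by_contra hxn
    rw [mem_preimage, mem_singleton_iff, hfx, indicator_of_notMem hxn] at hx
    exact hc hx.symm
  have hl : Tendsto (fun n => ∫⁻ ω, eexp (∫⁻ x, f n x ∂counting X ω) ∂P) atTop
      (𝓝 (∫⁻ ω, eexp (∑' i, ψ (X ω i)) ∂P)) := by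
    have hXm (i : ℕ) : Measurable fun ω => X ω i := (measurable_pi_apply i).comp hX.measurable
    refine tendsto_lintegral_of_dominated_convergence (fun _ => 1) (fun n => ?_)
      (fun n => ae_of_all _ fun ω => eexp_le_one _) (by simp) (ae_of_all _ fun ω => ?_)
    · simp_rw [lintegral_counting X _ (f n).measurable]
      exact measurable_eexp.comp (Measurable.tsum fun i => (f n).measurable.comp (hXm i))
    · rw [← lintegral_counting X ω hψ]
      exact continuous_eexp.continuousAt.tendsto.comp
        (lintegral_tendsto_of_tendsto_of_monotone (fun n => (f n).measurable.aemeasurable)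
          (ae_of_all _ fun x n m h => hmono h x) (ae_of_all _ hlim))
  simp_rw [hstep] at hl
  refine tendsto_nhds_unique hl (continuous_eexp.continuousAt.tendsto.comp ?_)
  refine lintegral_tendsto_of_tendsto_of_monotone (fun n => by fun_prop)
    (ae_of_all _ fun x n m h => tsub_le_tsub_left (antitone_eexp (hmono h x)) _)
    (ae_of_all _ fun x => ?_)
  exact ENNReal.Tendsto.sub tendsto_const_nhds
    (continuous_eexp.continuousAt.tendsto.comp (hlim x)) (Or.inl ENNReal.one_ne_top)

end IsPoissonProcess

/-! ### Polar coordinates in the plane -/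

/-- The unit circle carries `toSphere` mass equal to the dimension `2` times the area `π` of the
unit disk. -/
lemma lintegral_norm_plane {f : ℝ → ℝ≥0∞} (hf : Measurable f) :
    ∫⁻ x : Plane, f ‖x‖ = ∫⁻ z in Ioi (0 : ℝ), ENNReal.ofReal (2 * Real.pi * z) * f z := by
  have hdim : Module.finrank ℝ Plane = 2 := by simp
  have hball : (volume : Measure Plane) (Metric.ball 0 1) = ENNReal.ofReal Real.pi := by
    rw [EuclideanSpace.volume_ball_fin_two]
    simp
  calc ∫⁻ x : Plane, f ‖x‖ = ∫⁻ x : ({(0)}ᶜ : Set Plane), f ‖x.1‖ ∂(volume.comap Subtype.val) := by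
        rw [lintegral_subtype_comap (measurableSet_singleton _).compl fun x : Plane ↦ f (‖x‖),
          restrict_compl_singleton]
    _ = ∫⁻ x : Metric.sphere (0 : Plane) 1 × Ioi (0 : ℝ), f x.2.1
          ∂(volume : Measure Plane).toSphere.prod (.volumeIoiPow (Module.finrank ℝ Plane - 1)) := by
        simpa using
          (volume : Measure Plane).measurePreserving_homeomorphUnitSphereProd.lintegral_comp_emb
          (Homeomorph.measurableEmbedding _) (fun x => f x.2.1)
    _ = (volume : Measure Plane).toSphere univ *
          ∫⁻ x : Ioi (0 : ℝ), f x.1 ∂.volumeIoiPow (Module.finrank ℝ Plane - 1) := by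
        rw [lintegral_prod _ (by fun_prop)]
        simp [mul_comm]
    _ = _ := by
        rw [Measure.volumeIoiPow, hdim, (volume : Measure Plane).toSphere_apply_univ, hball, hdim,
          lintegral_withDensity_eq_lintegral_mul _ (by fun_prop) (by fun_prop)]
        have := lintegral_subtype_comap (μ := (volume : Measure ℝ)) (s := Ioi (0 : ℝ))
          measurableSet_Ioi fun a => ENNReal.ofReal (a ^ (2 - 1)) * f a
        simp only [Pi.mul_apply]
        rw [this, ← lintegral_const_mul _ (by fun_prop)]
        refine setLIntegral_congr_fun measurableSet_Ioi fun z (hz : 0 < z) => ?_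
        rw [← mul_assoc, ENNReal.ofReal_mul (by positivity), ENNReal.ofReal_mul (by positivity)]
        simp

/-! ### Marks and the intensity of the transmitters -/

/-- The inverse of `eexp` on `[0, 1]`. -/
def negLog (x : ℝ≥0∞) : ℝ≥0∞ := (-(ENNReal.log x)).toENNReal

lemma eexp_negLog {x : ℝ≥0∞} (hx : x ≤ 1) : eexp (negLog x) = x := by
  have h : 0 ≤ -(ENNReal.log x) := by
    rw [EReal.le_neg, neg_zero]
    have := ENNReal.log_monotone hx
    rwa [ENNReal.log_one] at this
  rw [eexp, negLog, EReal.coe_toENNReal h, neg_neg, ENNReal.exp_log]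

@[fun_prop]
lemma measurable_negLog : Measurable negLog := by
  unfold negLog
  exact measurable_ereal_toENNReal.comp (continuous_neg.measurable.comp ENNReal.measurable_log)

lemma tendsto_prod_eexp (u : ℕ → ℝ≥0∞) :
    Tendsto (fun n => ∏ i ∈ Finset.range n, eexp (u i)) atTop (𝓝 (eexp (∑' i, u i))) := by
  simp_rw [← eexp_sum]
  exact continuous_eexp.continuousAt.tendsto.comp (ENNReal.tendsto_nat_tsum u)

section Marks

variable {Ω R M : Type*} [MeasurableSpace Ω] [MeasurableSpace R] [MeasurableSpace M]
  {P : Measure Ω} [IsProbabilityMeasure P] {X : Ω → R} {m : ℕ → Ω → M}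

/-- Induction from the last mark: it is independent of `X` and of the earlier marks, so its factor
can be averaged given `X`, and the average is absorbed into `H`. -/
lemma lintegral_mul_prod_marks (hX : Measurable X) (hm : ∀ n, Measurable (m n))
    (hind : ∀ n, IndepFun (fun ω => (X ω, fun j : Fin n => m j ω)) (m n) P)
    {f : ℕ → R → M → ℝ≥0∞} (hf : ∀ n, Measurable (Function.uncurry (f n))) (n : ℕ)
    {H : R → ℝ≥0∞} (hH : Measurable H) :
    ∫⁻ ω, H (X ω) * ∏ i ∈ Finset.range n, f i (X ω) (m i ω) ∂P =
      ∫⁻ ω, H (X ω) * ∏ i ∈ Finset.range n, ∫⁻ y, f i (X ω) y ∂P.map (m i) ∂P := by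
  induction n generalizing H with
  | zero => simp
  | succ n ih =>
    have hQ := Measure.isProbabilityMeasure_map (μ := P) (hm n).aemeasurable
    have hκ : Measurable fun x => ∫⁻ y, f n x y ∂P.map (m n) := (hf n).lintegral_prod_right
    set W : Ω → R × (Fin n → M) := fun ω => (X ω, fun j : Fin n => m j ω) with hW
    have hWm : Measurable W := hX.prodMk (measurable_pi_iff.2 fun j => hm j)
    set K : R × (Fin n → M) → ℝ≥0∞ := fun w => H w.1 * ∏ i : Fin n, f i w.1 (w.2 i) with hK
    have hKm : Measurable K := by
      refine (hH.comp measurable_fst).mul (Finset.measurable_fun_prod _ fun i _ => ?_)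
      exact (hf i).comp (measurable_fst.prodMk ((measurable_pi_apply i).comp measurable_snd))
    have hKW (ω : Ω) : K (W ω) = H (X ω) * ∏ i ∈ Finset.range n, f i (X ω) (m i ω) := by
      rw [hK, Finset.prod_range]
    have hmap := (indepFun_iff_map_prod_eq_prod_map_map hWm.aemeasurable (hm n).aemeasurable).1
      (hind n)
    have hfn : Measurable fun x : (R × (Fin n → M)) × M => f n x.1.1 x.2 :=
      (hf n).comp ((measurable_fst.comp measurable_fst).prodMk measurable_snd)
    calc ∫⁻ ω, H (X ω) * ∏ i ∈ Finset.range (n + 1), f i (X ω) (m i ω) ∂P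
        = ∫⁻ ω, (fun x : (R × (Fin n → M)) × M => K x.1 * f n x.1.1 x.2) (W ω, m n ω) ∂P := by
          refine lintegral_congr fun ω => ?_
          simp only [hKW, Finset.prod_range_succ, mul_assoc]
          rfl
      _ = ∫⁻ w, ∫⁻ y, K w * f n w.1 y ∂P.map (m n) ∂P.map W := by
          have hmm : Measurable fun x : (R × (Fin n → M)) × M => K x.1 * f n x.1.1 x.2 :=
            (hKm.comp measurable_fst).mul hfn
          rw [← lintegral_map hmm (hWm.prodMk (hm n)), hmap, lintegral_prod _ hmm.aemeasurable]
      _ = ∫⁻ w, K w * ∫⁻ y, f n w.1 y ∂P.map (m n) ∂P.map W := by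
          refine lintegral_congr fun w => ?_
          rw [lintegral_const_mul]
          exact (hf n).comp measurable_prodMk_left
      _ = ∫⁻ ω, (fun x => H x * ∫⁻ y, f n x y ∂P.map (m n)) (X ω) *
            ∏ i ∈ Finset.range n, f i (X ω) (m i ω) ∂P := by
          refine (lintegral_map (hKm.mul (hκ.comp measurable_fst)) hWm).trans ?_
          refine lintegral_congr fun ω => ?_
          simp only [Pi.mul_apply, Function.comp_apply, hKW]
          simp only [hW]
          ring
      _ = _ := by
          refine (ih (hH.mul hκ)).trans ?_
          refine lintegral_congr fun ω => ?_
          simp only [Finset.prod_range_succ, Pi.mul_apply]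
          ring

/-- Independent marks are integrated out of a Laplace functional one by one. -/
lemma lintegral_mul_eexp_marks (hX : Measurable X) (hm : ∀ n, Measurable (m n))
    (hind : ∀ n, IndepFun (fun ω => (X ω, fun j : Fin n => m j ω)) (m n) P)
    {ψ : ℕ → R → M → ℝ≥0∞} (hψ : ∀ n, Measurable (Function.uncurry (ψ n)))
    {H : R → ℝ≥0∞} (hH : Measurable H) (hH1 : ∀ x, H x ≤ 1) :
    ∫⁻ ω, H (X ω) * eexp (∑' i, ψ i (X ω) (m i ω)) ∂P =
      ∫⁻ ω, H (X ω) *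
        eexp (∑' i, negLog (∫⁻ y, eexp (ψ i (X ω) y) ∂P.map (m i))) ∂P := by
  have hκ1 (i : ℕ) (x : R) : ∫⁻ y, eexp (ψ i x y) ∂P.map (m i) ≤ 1 := by
    have := Measure.isProbabilityMeasure_map (μ := P) (hm i).aemeasurable
    exact (lintegral_mono fun y => eexp_le_one _).trans (by simp)
  have hψx (i : ℕ) : Measurable fun ω => ψ i (X ω) (m i ω) := (hψ i).comp (hX.prodMk (hm i))
  have hκm (i : ℕ) : Measurable fun x => ∫⁻ y, eexp (ψ i x y) ∂P.map (m i) := by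
    have : Measurable (Function.uncurry fun x y => eexp (ψ i x y)) := measurable_eexp.comp (hψ i)
    exact this.lintegral_prod_right
  have step := lintegral_mul_prod_marks hX hm hind (f := fun i x y => eexp (ψ i x y))
    (fun i => measurable_eexp.comp (hψ i)) (H := H) (hH := hH)
  have hprod (s : Finset ℕ) (g : ℕ → ℝ≥0∞) (hg : ∀ i, g i ≤ 1) (x : R) :
      H x * ∏ i ∈ s, g i ≤ 1 :=
    mul_le_one' (hH1 x) (Finset.prod_le_one' fun i _ => hg i)
  have hl : Tendsto (fun n => ∫⁻ ω, H (X ω) * ∏ i ∈ Finset.range n, eexp (ψ i (X ω) (m i ω)) ∂P)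
      atTop (𝓝 (∫⁻ ω, H (X ω) * eexp (∑' i, ψ i (X ω) (m i ω)) ∂P)) := by
    refine tendsto_lintegral_of_dominated_convergence (fun _ => 1) (fun n => ?_)
      (fun n => ae_of_all _ fun ω => hprod _ _ (fun i => eexp_le_one _) _) (by simp)
      (ae_of_all _ fun ω => ?_)
    · exact (hH.comp hX).mul (Finset.measurable_fun_prod _ fun i _ => measurable_eexp.comp (hψx i))
    · exact ENNReal.Tendsto.const_mul (tendsto_prod_eexp _)
        (Or.inr ((hH1 _).trans_lt ENNReal.one_lt_top).ne)
  have hr : Tendsto (fun n => ∫⁻ ω, H (X ω) *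
      ∏ i ∈ Finset.range n, ∫⁻ y, eexp (ψ i (X ω) y) ∂P.map (m i) ∂P)
      atTop (𝓝 (∫⁻ ω, H (X ω) *
        eexp (∑' i, negLog (∫⁻ y, eexp (ψ i (X ω) y) ∂P.map (m i))) ∂P)) := by
    refine tendsto_lintegral_of_dominated_convergence (fun _ => 1) (fun n => ?_)
      (fun n => ae_of_all _ fun ω => hprod _ _ (fun i => hκ1 i _) _) (by simp)
      (ae_of_all _ fun ω => ?_)
    · exact (hH.comp hX).mul (Finset.measurable_fun_prod _ fun i _ => (hκm i).comp hX)
    · have := tendsto_prod_eexp fun i => negLog (∫⁻ y, eexp (ψ i (X ω) y) ∂P.map (m i))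
      simp_rw [eexp_negLog (hκ1 _ _)] at this
      exact ENNReal.Tendsto.const_mul this (Or.inr ((hH1 _).trans_lt ENNReal.one_lt_top).ne)
  simp_rw [step] at hl
  exact tendsto_nhds_unique hl hr

end Marks

/-! ### The transmitters as seen from the user -/

/-- The kind of link that a transmitter has to the user. -/
inductive Link where
  | off
  | los
  | nlos
  | tbs

instance : MeasurableSpace Link := ⊤

instance : DiscreteMeasurableSpace Link := ⟨fun _ => trivial⟩

/-- Kind of link, horizontal distance and fading gain of a transmitter. -/
abbrev State := Link × ℝ × ℝ

/-- The state of a UAV that is not available. -/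
def offState : State := (Link.off, 0, 0)

namespace NetParams

variable (p : NetParams)

@[fun_prop]
lemma measurable_pLoS : Measurable p.pLoS := by
  have : Measurable p.elevation := by
    unfold elevation
    exact Measurable.ite measurableSet_Iic measurable_const (by fun_prop)
  unfold pLoS
  fun_prop

@[fun_prop]
lemma measurable_pNLoS : Measurable p.pNLoS := by
  unfold pNLoS
  fun_prop

lemma pLoS_pos (r : ℝ) : 0 < p.pLoS r := by
  have := p.c1_pos
  unfold pLoS
  positivity

lemma pLoS_lt_one (r : ℝ) : p.pLoS r < 1 := by
  have := p.c1_pos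
  unfold pLoS
  rw [div_lt_one (by positivity)]
  have : 0 < p.c1 * Real.exp (-p.c2 * (p.elevation r - p.c1)) := by positivity
  linarith

lemma pNLoS_pos (r : ℝ) : 0 < p.pNLoS r := sub_pos.2 (p.pLoS_lt_one r)

lemma pNLoS_lt_one (r : ℝ) : p.pNLoS r < 1 := by
  have := p.pLoS_pos r
  unfold pNLoS
  linarith

lemma lamA_nonneg : 0 ≤ p.lamA := mul_nonneg p.Pa_nonneg p.lamU_pos.le

/-- Distance to a transmitter at horizontal distance `z`. -/
def slant : Link → ℝ → ℝ
  | .tbs, z => z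
  | _, z => √(z ^ 2 + p.h ^ 2)

/-- Density of the horizontal distances of the transmitters of each kind. -/
def weight : Link → ℝ → ℝ
  | .off, _ => 0
  | .los, z => 2 * Real.pi * p.lamA * (z * p.pLoS (√(z ^ 2 + p.h ^ 2)))
  | .nlos, z => 2 * Real.pi * p.lamA * (z * p.pNLoS (√(z ^ 2 + p.h ^ 2)))
  | .tbs, z => 2 * Real.pi * p.lamT * z

/-- Nakagami shape parameter of each kind of link. -/
def shape : Link → ℕ
  | .los => p.mL
  | .nlos => p.mN
  | _ => 1

/-- Law of the fading gain. -/
def gain (q : Link) : Measure ℝ := gammaMeasure (p.shape q) (p.shape q)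

lemma shape_pos (q : Link) : 0 < p.shape q := by
  cases q
  exacts [one_pos, p.mL_pos, p.mN_pos, one_pos]

instance (q : Link) : IsProbabilityMeasure (p.gain q) :=
  isProbabilityMeasure_gammaMeasure (by exact_mod_cast p.shape_pos q)
    (by exact_mod_cast p.shape_pos q)

@[fun_prop]
lemma measurable_weight (q : Link) : Measurable (p.weight q) := by
  cases q <;> unfold weight <;> fun_prop

@[fun_prop]
lemma measurable_slant (q : Link) : Measurable (p.slant q) := by
  cases q <;> unfold slant <;> fun_prop

lemma weight_nonneg (q : Link) {z : ℝ} (hz : 0 ≤ z) : 0 ≤ p.weight q z := by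
  have h1 := p.lamA_nonneg
  have h2 := p.lamT_pos
  have h3 := p.pLoS_pos (√(z ^ 2 + p.h ^ 2))
  have h4 := p.pNLoS_pos (√(z ^ 2 + p.h ^ 2))
  have h5 := Real.pi_pos
  cases q <;> unfold weight <;> positivity

/-- Intensity of the transmitters with a given kind of link. -/
def intensityOf (q : Link) : Measure State :=
  (((volume.restrict (Ioi 0)).withDensity fun z => ENNReal.ofReal (p.weight q z)).prod
    (p.gain q)).map (Prod.mk q)

/-- Intensity of the transmitters as seen from the user. -/
def intensity : Measure State :=
  p.intensityOf .los + p.intensityOf .nlos + p.intensityOf .tbs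

lemma lintegral_intensityOf (q : Link) {f : State → ℝ≥0∞} (hf : Measurable f) :
    ∫⁻ y, f y ∂p.intensityOf q =
      ∫⁻ z in Ioi (0 : ℝ), ENNReal.ofReal (p.weight q z) * ∫⁻ g, f (q, z, g) ∂p.gain q := by
  have hfq : Measurable fun x : ℝ × ℝ => f (q, x) := hf.comp measurable_prodMk_left
  have hfi : Measurable fun z => ∫⁻ g, f (q, z, g) ∂p.gain q := by
    have : Measurable (Function.uncurry fun z g => f (q, z, g)) := hfq
    exact this.lintegral_prod_right
  rw [intensityOf, lintegral_map hf measurable_prodMk_left, lintegral_prod _ hfq.aemeasurable,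
    lintegral_withDensity_eq_lintegral_mul _ (by fun_prop) hfi]
  rfl

lemma lintegral_intensity {f : State → ℝ≥0∞} : ∫⁻ y, f y ∂p.intensity =
    ∫⁻ y, f y ∂p.intensityOf .los + ∫⁻ y, f y ∂p.intensityOf .nlos +
      ∫⁻ y, f y ∂p.intensityOf .tbs := by
  rw [intensity, lintegral_add_measure, lintegral_add_measure]

lemma intensity_offState : p.intensity {offState} = 0 := by
  have h (q : Link) (hq : q ≠ .off) : p.intensityOf q {offState} = 0 := by
    rw [intensityOf, Measure.map_apply measurable_prodMk_left (measurableSet_singleton _)]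
    have : Prod.mk q ⁻¹' {offState} = (∅ : Set (ℝ × ℝ)) := by
      ext x
      simp [offState, hq]
    rw [this, measure_empty]
  simp [intensity, h]

lemma exists_weight_le (q : Link) : ∃ C : ℝ, ∀ z : ℝ, 0 < z → p.weight q z ≤ C * z := by
  have h1 := p.lamA_nonneg
  have h5 := Real.pi_pos
  cases q
  · exact ⟨0, fun z hz => by simp [weight]⟩
  · refine ⟨2 * Real.pi * p.lamA, fun z hz => ?_⟩
    simp only [weight]
    gcongr
    exact mul_le_of_le_one_right hz.le (p.pLoS_lt_one _).le
  · refine ⟨2 * Real.pi * p.lamA, fun z hz => ?_⟩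
    simp only [weight]
    gcongr
    exact mul_le_of_le_one_right hz.le (p.pNLoS_lt_one _).le
  · exact ⟨2 * Real.pi * p.lamT, fun z hz => le_rfl⟩

/-- The density of the horizontal distance grows at most linearly, so bounded distances have finite
intensity. -/
instance : SigmaFinite p.intensity := by
  have hfin (q : Link) (n : ℕ) : p.intensityOf q {y | y.2.1 ≤ n} < ⊤ := by
    obtain ⟨C, hC⟩ := p.exists_weight_le q
    have hm : MeasurableSet {y : State | y.2.1 ≤ n} :=
      measurableSet_le (by fun_prop) measurable_const
    rw [← lintegral_indicator_one hm, lintegral_intensityOf _ _ (measurable_one.indicator hm)]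
    have hb : ∀ z ∈ Ioi (0 : ℝ), ENNReal.ofReal (p.weight q z) *
        ∫⁻ g, {y : State | y.2.1 ≤ n}.indicator 1 (q, z, g) ∂p.gain q ≤
        (Iic (n : ℝ)).indicator (fun _ => ENNReal.ofReal (|C| * n)) z := by
      intro z (hz : 0 < z)
      by_cases hzn : z ≤ n
      · have h2 : p.weight q z ≤ |C| * n := (hC z hz).trans (by
          gcongr
          exact le_abs_self C)
        simp only [indicator, mem_ofPred_eq, hzn, if_true, mem_Iic, Pi.one_apply, lintegral_const,
          measure_univ, mul_one]
        exact ENNReal.ofReal_le_ofReal h2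
      · simp [indicator, hzn]
    refine (setLIntegral_mono' measurableSet_Ioi hb).trans_lt ?_
    rw [lintegral_indicator_const measurableSet_Iic, Measure.restrict_apply measurableSet_Iic]
    refine ENNReal.mul_lt_top ENNReal.ofReal_lt_top ?_
    rw [inter_comm, Ioi_inter_Iic]
    simp
  refine ⟨⟨⟨fun n => {y | y.2.1 ≤ n}, fun _ => trivial, fun n => ?_, ?_⟩⟩⟩
  · simp only [intensity, Measure.add_apply]
    exact ENNReal.add_lt_top.2 ⟨ENNReal.add_lt_top.2 ⟨hfin _ n, hfin _ n⟩, hfin _ n⟩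
  · refine eq_univ_of_forall fun y => mem_iUnion.2 ?_
    exact exists_nat_ge y.2.1

open Classical in
/-- State of a UAV at horizontal distance `z`, as a function of its availability, its LoS mark and
its two gains. -/
def uavState (z : ℝ) (m : Bool × ℝ × ℝ × ℝ) : State :=
  if m.1 = true then
    if m.2.1 ≤ p.pLoS (√(z ^ 2 + p.h ^ 2)) then (.los, z, m.2.2.1) else (.nlos, z, m.2.2.2)
  else offState

@[fun_prop]
lemma measurable_uavState : Measurable (Function.uncurry p.uavState) := by
  unfold uavState Function.uncurry
  refine Measurable.ite ?_ (Measurable.ite ?_ ?_ ?_) measurable_const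
  · exact (measurable_fst.comp measurable_snd) (measurableSet_singleton true)
  · exact measurableSet_le (by fun_prop) (by fun_prop)
  · exact measurable_const.prodMk (by fun_prop)
  · exact measurable_const.prodMk (by fun_prop)

end NetParams

/-! ### The transmitters as seen from the user -/

/-- Laplace functional of the positions of a homogeneous process, for a function of the distance to
a fixed point. -/
lemma IsPoissonProcess.laplace_dist {Ω : Type*} [MeasurableSpace Ω] {P : Measure Ω}
    [IsFiniteMeasure P] {X : Ω → ℕ → Plane} {lam : ℝ}
    (hX : IsPoissonProcess P X (ENNReal.ofReal lam • volume)) (u : Plane) {ψ : ℝ → ℝ≥0∞}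
    (hψ : Measurable ψ) :
    ∫⁻ ω, eexp (∑' i, ψ (dist (X ω i) u)) ∂P =
      eexp (ENNReal.ofReal lam *
        ∫⁻ z in Ioi (0 : ℝ), ENNReal.ofReal (2 * Real.pi * z) * (1 - eexp (ψ z))) := by
  have hσ : SigmaFinite (ENNReal.ofReal lam • (volume : Measure Plane)) := by
    change SigmaFinite (lam.toNNReal • (volume : Measure Plane))
    infer_instance
  rw [hX.laplace (ψ := fun x => ψ (dist x u)) (by fun_prop), lintegral_smul_measure, smul_eq_mul]
  simp_rw [dist_eq_norm]
  -- Translation invariance removes the position `u`. This is why the user can later be conditioned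
  -- on without changing the law of the transmitters.
  rw [lintegral_sub_right_eq_self (fun x : Plane => 1 - eexp (ψ ‖x‖)) u,
    lintegral_norm_plane (f := fun z => 1 - eexp (ψ z)) (by fun_prop)]

namespace Inputs

variable {Ω : Type*} (S : Inputs Ω) (p : NetParams)

/-- The sigma-algebra generated by several sources of randomness. -/
abbrev sigmaOf (A : Set Source) : MeasurableSpace Ω := ⨆ s ∈ A, S.sourceSigma s

variable {S} in
lemma sourceSigma_le_sigmaOf {A : Set Source} {s : Source} (hs : s ∈ A) :
    S.sourceSigma s ≤ S.sigmaOf A := le_iSup₂ (f := fun s (_ : s ∈ A) => S.sourceSigma s) s hs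

section SigmaOf

variable {S} {A : Set Source}

lemma measurable_user_sigmaOf (h : .user ∈ A) : Measurable[S.sigmaOf A] S.user :=
  Measurable.of_comap_le (sourceSigma_le_sigmaOf h)

lemma measurable_uavPos_sigmaOf (h : .uavPos ∈ A) : Measurable[S.sigmaOf A] S.uavPos :=
  Measurable.of_comap_le (sourceSigma_le_sigmaOf h)

lemma measurable_tbsPos_sigmaOf (h : .tbsPos ∈ A) : Measurable[S.sigmaOf A] S.tbsPos :=
  Measurable.of_comap_le (sourceSigma_le_sigmaOf h)

lemma measurable_avail_sigmaOf {i : Option ℕ} (h : .avail i ∈ A) :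
    Measurable[S.sigmaOf A] (S.avail i) :=
  Measurable.of_comap_le (sourceSigma_le_sigmaOf h)

lemma measurable_losMark_sigmaOf {i : Option ℕ} (h : .losMark i ∈ A) :
    Measurable[S.sigmaOf A] (S.losMark i) :=
  Measurable.of_comap_le (sourceSigma_le_sigmaOf h)

lemma measurable_gL_sigmaOf {i : Option ℕ} (h : .gL i ∈ A) :
    Measurable[S.sigmaOf A] (S.gL i) :=
  Measurable.of_comap_le (sourceSigma_le_sigmaOf h)

lemma measurable_gN_sigmaOf {i : Option ℕ} (h : .gN i ∈ A) :
    Measurable[S.sigmaOf A] (S.gN i) :=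
  Measurable.of_comap_le (sourceSigma_le_sigmaOf h)

lemma measurable_gT_sigmaOf {k : ℕ} (h : .gT k ∈ A) :
    Measurable[S.sigmaOf A] (S.gT k) :=
  Measurable.of_comap_le (sourceSigma_le_sigmaOf h)

end SigmaOf

/-- Availability, LoS mark and gains of a UAV. -/
def mark (i : Option ℕ) (ω : Ω) : Bool × ℝ × ℝ × ℝ :=
  (S.avail i ω, S.losMark i ω, S.gL i ω, S.gN i ω)

/-- User position and marks of the cluster UAV. -/
def center (ω : Ω) : Plane × Bool × ℝ × ℝ × ℝ := (S.user ω, S.mark none ω)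

/-- The transmitters other than the cluster UAV, as seen from the user. -/
def state : ℕ ⊕ ℕ → Ω → State
  | .inl i, ω => p.uavState (dist (S.uavPos ω i) (S.user ω)) (S.mark (some i) ω)
  | .inr k, ω => (.tbs, S.distTbs k ω, S.gT k ω)

variable {S} in
lemma measurable_mark_sigmaOf {A : Set Source} {i : Option ℕ} (h₁ : .avail i ∈ A)
    (h₂ : .losMark i ∈ A) (h₃ : .gL i ∈ A) (h₄ : .gN i ∈ A) :
    Measurable[S.sigmaOf A] (S.mark i) :=
  (measurable_avail_sigmaOf h₁).prodMk ((measurable_losMark_sigmaOf h₂).prodMk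
    ((measurable_gL_sigmaOf h₃).prodMk (measurable_gN_sigmaOf h₄)))

/-! ### Independence of the sources and the law of the marks -/

namespace IsModel

variable {S p} [MeasurableSpace Ω] {P : Measure Ω} (hS : S.IsModel p P)

include hS

lemma sourceSigma_le (s : Source) : S.sourceSigma s ≤ ‹MeasurableSpace Ω› := by
  cases s
  · exact hS.measurable_user.comap_le
  · exact hS.uav_law.measurable.comap_le
  · exact hS.tbs_law.measurable.comap_le
  · exact (hS.measurable_avail _).comap_le
  · exact (hS.measurable_losMark _).comap_le
  · exact (hS.measurable_gL _).comap_le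
  · exact (hS.measurable_gN _).comap_le
  · exact (hS.measurable_gT _).comap_le

/-- Disjoint sets of labels of independent sources generate independent sigma-algebras. `B` lists
the sources on which `g` depends; `f` may depend on all others. -/
lemma indepFun_of_sigmaOf {α β : Type*} [MeasurableSpace α] [MeasurableSpace β]
    {f : Ω → α} {g : Ω → β} (B : Set Source)
    (hf : Measurable[S.sigmaOf Bᶜ] f) (hg : Measurable[S.sigmaOf B] g) : IndepFun f g P := by
  have := indep_iSup_of_disjoint hS.sourceSigma_le hS.indep (disjoint_compl_left (a := B))
  exact indep_of_indep_of_le_left (indep_of_indep_of_le_right this hg.comap_le) hf.comap_le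

lemma measurable_mark (i : Option ℕ) : Measurable (S.mark i) :=
  (hS.measurable_avail i).prodMk ((hS.measurable_losMark i).prodMk
    ((hS.measurable_gL i).prodMk (hS.measurable_gN i)))

lemma measurable_center : Measurable S.center :=
  hS.measurable_user.prodMk (hS.measurable_mark none)

lemma measurable_state (b : ℕ ⊕ ℕ) : Measurable (S.state p b) := by
  have hu := hS.measurable_user
  cases b with
  | inl i =>
    have hx : Measurable fun ω => S.uavPos ω i :=
      (measurable_pi_apply i).comp hS.uav_law.measurable
    exact p.measurable_uavState.comp ((hx.dist hu).prodMk (hS.measurable_mark _))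
  | inr k =>
    have hx : Measurable fun ω => S.tbsPos ω k :=
      (measurable_pi_apply k).comp hS.tbs_law.measurable
    exact measurable_const.prodMk ((hx.dist hu).prodMk (hS.measurable_gT k))

lemma map_mark [IsProbabilityMeasure P] (i : Option ℕ) :
    P.map (S.mark i) = (P.map (S.avail i)).prod ((P.map (S.losMark i)).prod
      ((p.gain .los).prod (p.gain .nlos))) := by
  have h₁ : IndepFun (S.gL i) (S.gN i) P :=
    hS.indepFun_of_sigmaOf {.gN i} (measurable_gL_sigmaOf (by simp))
      (measurable_gN_sigmaOf (by simp))
  have h₂ : IndepFun (S.losMark i) (fun ω => (S.gL i ω, S.gN i ω)) P :=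
    hS.indepFun_of_sigmaOf {.gL i, .gN i} (measurable_losMark_sigmaOf (by simp))
      ((measurable_gL_sigmaOf (by simp)).prodMk (measurable_gN_sigmaOf (by simp)))
  have h₃ : IndepFun (S.avail i) (fun ω => (S.losMark i ω, S.gL i ω, S.gN i ω)) P :=
    hS.indepFun_of_sigmaOf {.losMark i, .gL i, .gN i} (measurable_avail_sigmaOf (by simp))
      ((measurable_losMark_sigmaOf (by simp)).prodMk
        ((measurable_gL_sigmaOf (by simp)).prodMk (measurable_gN_sigmaOf (by simp))))
  have m₁ := hS.measurable_avail i
  have m₂ := hS.measurable_losMark i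
  have m₃ := hS.measurable_gL i
  have m₄ := hS.measurable_gN i
  have e₁ := (indepFun_iff_map_prod_eq_prod_map_map m₃.aemeasurable m₄.aemeasurable).1 h₁
  have e₂ := (indepFun_iff_map_prod_eq_prod_map_map m₂.aemeasurable
    (m₃.prodMk m₄).aemeasurable).1 h₂
  have e₃ := (indepFun_iff_map_prod_eq_prod_map_map m₁.aemeasurable
    (m₂.prodMk (m₃.prodMk m₄)).aemeasurable).1 h₃
  change P.map (fun ω => (S.avail i ω, S.losMark i ω, S.gL i ω, S.gN i ω)) = _
  rw [e₃, e₂, e₁, hS.gL_law, hS.gN_law]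
  rfl

lemma map_losMark_Iic (i : Option ℕ) {t : ℝ} (h1 : t ≤ 1) :
    P.map (S.losMark i) (Iic t) = ENNReal.ofReal t := by
  have := hS.losMark_law i
  rw [pdf.IsUniform] at this
  rw [this, cond_apply measurableSet_Icc]
  have : Icc (0 : ℝ) 1 ∩ Iic t = Icc 0 t := by
    ext x; simp only [mem_inter_iff, mem_Icc, mem_Iic]
    exact ⟨fun h => ⟨h.1.1, h.2⟩, fun h => ⟨⟨h.1, h.2.trans h1⟩, h.2⟩⟩
  rw [this]
  simp

lemma map_losMark_Ioi [IsProbabilityMeasure P] (i : Option ℕ) {t : ℝ} (h0 : 0 ≤ t) (h1 : t ≤ 1) :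
    P.map (S.losMark i) (Ioi t) = ENNReal.ofReal (1 - t) := by
  have := Measure.isProbabilityMeasure_map (μ := P) (hS.measurable_losMark i).aemeasurable
  rw [← compl_Iic, prob_compl_eq_one_sub measurableSet_Iic, hS.map_losMark_Iic i h1,
    ENNReal.ofReal_sub _ h0, ENNReal.ofReal_one]

/-- Average over the LoS mark and the gains of a UAV. -/
lemma lintegral_losMark_gain [IsProbabilityMeasure P] (i : Option ℕ) {d : ℝ}
    {f₁ f₂ : ℝ → ℝ≥0∞} (hf₁ : Measurable f₁) (hf₂ : Measurable f₂) :
    ∫⁻ m, (if m.1 ≤ p.pLoS d then f₁ m.2.1 else f₂ m.2.2)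
        ∂(P.map (S.losMark i)).prod ((p.gain .los).prod (p.gain .nlos)) =
      ENNReal.ofReal (p.pLoS d) * ∫⁻ g, f₁ g ∂p.gain .los +
        ENNReal.ofReal (p.pNLoS d) * ∫⁻ g, f₂ g ∂p.gain .nlos := by
  have hQ := Measure.isProbabilityMeasure_map (μ := P) (hS.measurable_losMark i).aemeasurable
  have hm : Measurable fun m : ℝ × ℝ × ℝ => if m.1 ≤ p.pLoS d then f₁ m.2.1 else f₂ m.2.2 :=
    Measurable.ite (measurableSet_le measurable_fst measurable_const) (by fun_prop) (by fun_prop)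
  have hI (l : ℝ) : ∫⁻ m, (if l ≤ p.pLoS d then f₁ m.1 else f₂ m.2)
      ∂(p.gain .los).prod (p.gain .nlos) =
      (Iic (p.pLoS d)).indicator (fun _ => ∫⁻ g, f₁ g ∂p.gain .los) l +
        (Ioi (p.pLoS d)).indicator (fun _ => ∫⁻ g, f₂ g ∂p.gain .nlos) l := by
    by_cases hl : l ≤ p.pLoS d
    · simp only [hl, if_true]
      rw [lintegral_prod _ (by fun_prop)]
      simp [indicator, hl, not_lt.2 hl]
    · simp only [hl, if_false]
      rw [lintegral_prod _ (by fun_prop)]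
      simp [indicator, hl, not_le.1 hl]
  rw [lintegral_prod _ hm.aemeasurable]
  simp only [hI]
  rw [lintegral_add_left (measurable_const.indicator measurableSet_Iic),
    lintegral_indicator_const measurableSet_Iic, lintegral_indicator_const measurableSet_Ioi,
    hS.map_losMark_Iic i (p.pLoS_lt_one d).le,
    hS.map_losMark_Ioi i (p.pLoS_pos d).le (p.pLoS_lt_one d).le, mul_comm, NetParams.pNLoS]
  congr 1
  rw [mul_comm]

/-- Thinning: an unavailable UAV is at `offState`, where `f` vanishes, which produces the factor
`Pa`. The LoS mark then splits the rest into two kinds. -/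
lemma lintegral_uavState [IsProbabilityMeasure P] (i : Option ℕ) (z : ℝ) {f : State → ℝ≥0∞}
    (hf : Measurable f) (hf0 : f offState = 0) :
    ∫⁻ m, f (p.uavState z m) ∂P.map (S.mark i) =
      ENNReal.ofReal p.Pa *
        (ENNReal.ofReal (p.pLoS (√(z ^ 2 + p.h ^ 2))) * ∫⁻ g, f (.los, z, g) ∂p.gain .los +
          ENNReal.ofReal (p.pNLoS (√(z ^ 2 + p.h ^ 2))) * ∫⁻ g, f (.nlos, z, g) ∂p.gain .nlos) := by
  have hQ := Measure.isProbabilityMeasure_map (μ := P) (hS.measurable_losMark i).aemeasurable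
  have hQ' := Measure.isProbabilityMeasure_map (μ := P) (hS.measurable_avail i).aemeasurable
  have hf₁ : Measurable fun g => f (.los, z, g) := by fun_prop
  have hf₂ : Measurable fun g => f (.nlos, z, g) := by fun_prop
  rw [← hS.lintegral_losMark_gain i hf₁ hf₂, hS.map_mark, lintegral_prod]
  · have hI (a : Bool) : ∫⁻ m, f (p.uavState z (a, m)) ∂(P.map (S.losMark i)).prod
        ((p.gain .los).prod (p.gain .nlos)) = ({true} : Set Bool).indicator (fun _ =>
          ∫⁻ m, (if m.1 ≤ p.pLoS (√(z ^ 2 + p.h ^ 2)) then f (.los, z, m.2.1)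
            else f (.nlos, z, m.2.2)) ∂(P.map (S.losMark i)).prod
              ((p.gain .los).prod (p.gain .nlos))) a := by
      cases a
      · simp [NetParams.uavState, hf0]
      · simp only [NetParams.uavState, if_true, mem_singleton_iff, indicator_of_mem]
        refine lintegral_congr fun m => ?_
        split_ifs <;> rfl
    simp only [hI]
    rw [lintegral_indicator_const (measurableSet_singleton true),
      Measure.map_apply (hS.measurable_avail i) (measurableSet_singleton true), mul_comm]
    congr 1
    exact hS.avail_law i
  · have : Measurable (p.uavState z) := p.measurable_uavState.comp measurable_prodMk_left
    exact (hf.comp this).aemeasurable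

end IsModel

end Inputs

/-! ### Joint Laplace functional of the transmitters -/

namespace Inputs.IsModel

variable {Ω : Type*} {S : Inputs Ω} {p : NetParams} [MeasurableSpace Ω] {P : Measure Ω}
  [IsProbabilityMeasure P]

lemma _root_.UavNet.measurable_pi_of {α ι β : Type*} {m : MeasurableSpace α} [MeasurableSpace β]
    {f : α → ι → β} (h : ∀ i, Measurable[m] fun a => f a i) : Measurable[m] f :=
  measurable_pi_lambda _ h

lemma lintegral_eexp_eq_one_sub {E : Type*} [MeasurableSpace E] {Q : Measure E}
    [IsProbabilityMeasure Q] {f : E → ℝ≥0∞} (hf : Measurable f) :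
    ∫⁻ x, eexp (f x) ∂Q = 1 - ∫⁻ x, (1 - eexp (f x)) ∂Q := by
  have h : ∫⁻ x, eexp (f x) ∂Q + ∫⁻ x, (1 - eexp (f x)) ∂Q = 1 := by
    rw [← lintegral_add_left (by fun_prop)]
    simp [add_tsub_cancel_of_le (eexp_le_one _)]
  refine ENNReal.eq_sub_of_add_eq ?_ h
  exact (lt_of_le_of_lt (le_add_self.trans h.le) ENNReal.one_lt_top).ne

/-- Joint law of the user position with the marks of the cluster UAV, of the UAV positions and of
the TBS positions. -/
lemma map_center_positions (hS : S.IsModel p P) :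
    P.map (fun ω => (S.center ω, S.uavPos ω, S.tbsPos ω)) =
      (P.map S.center).prod ((P.map S.uavPos).prod (P.map S.tbsPos)) := by
  have mX := hS.uav_law.measurable
  have mT := hS.tbs_law.measurable
  have mc := hS.measurable_center
  have h₁ : IndepFun S.uavPos S.tbsPos P :=
    hS.indepFun_of_sigmaOf {.tbsPos} (measurable_uavPos_sigmaOf (by simp))
      (measurable_tbsPos_sigmaOf (by simp))
  have h₂ : IndepFun S.center (fun ω => (S.uavPos ω, S.tbsPos ω)) P :=
    hS.indepFun_of_sigmaOf {.uavPos, .tbsPos}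
      ((measurable_user_sigmaOf (by simp)).prodMk (measurable_mark_sigmaOf (by simp) (by simp)
        (by simp) (by simp)))
      ((measurable_uavPos_sigmaOf (by simp)).prodMk (measurable_tbsPos_sigmaOf (by simp)))
  have e₁ := (indepFun_iff_map_prod_eq_prod_map_map mX.aemeasurable mT.aemeasurable).1 h₁
  have e₂ := (indepFun_iff_map_prod_eq_prod_map_map mc.aemeasurable
    (mX.prodMk mT).aemeasurable).1 h₂
  rw [e₂, e₁]

/-- Joint Laplace functional of the transmitters, as seen from the user. -/
theorem setLIntegral_laplace (hS : S.IsModel p P) {B : Set (Plane × Bool × ℝ × ℝ × ℝ)}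
    (hB : MeasurableSet B) {ψ : State → ℝ≥0∞} (hψ : Measurable ψ) (hψ0 : ψ offState = 0) :
    ∫⁻ ω in S.center ⁻¹' B, eexp (∑' b, ψ (S.state p b ω)) ∂P =
      P (S.center ⁻¹' B) * eexp (∫⁻ y, (1 - eexp (ψ y)) ∂p.intensity) := by
  have mu := hS.measurable_user
  have mX := hS.uav_law.measurable
  have mT := hS.tbs_law.measurable
  have mc := hS.measurable_center
  set f : State → ℝ≥0∞ := fun y => 1 - eexp (ψ y) with hf
  have hfm : Measurable f := by fun_prop
  have hf0 : f offState = 0 := by simp [hf, hψ0]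
  have hfg (q : Link) : Measurable fun z => ∫⁻ g, f (q, z, g) ∂p.gain q := by
    have : Measurable (Function.uncurry fun z g => f (q, z, g)) :=
      hfm.comp (measurable_const.prodMk measurable_id)
    exact this.lintegral_prod_right
  -- Laplace exponents with the marks integrated out
  set κU : ℝ → ℝ≥0∞ := fun z => ENNReal.ofReal p.Pa *
        (ENNReal.ofReal (p.pLoS (√(z ^ 2 + p.h ^ 2))) * ∫⁻ g, f (.los, z, g) ∂p.gain .los +
          ENNReal.ofReal (p.pNLoS (√(z ^ 2 + p.h ^ 2))) * ∫⁻ g, f (.nlos, z, g) ∂p.gain .nlos)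
    with hκU
  set κT : ℝ → ℝ≥0∞ := fun z => ∫⁻ g, f (.tbs, z, g) ∂p.gain .tbs with hκT
  have hκUm : Measurable κU := by
    have h1 := hfg .los
    have h2 := hfg .nlos
    fun_prop
  have hκTm : Measurable κT := hfg .tbs
  -- The averaged factor of one UAV is `1 - κU`. Writing it as `e^{-ψU}` gives a Laplace functional
  -- of the distances alone, to which the Poisson formula applies; there `1 - e^{-ψU}` is `κU`
  -- again.
  set ψU : ℝ → ℝ≥0∞ := fun z => negLog (1 - κU z) with hψU
  set ψT : ℝ → ℝ≥0∞ := fun z => negLog (1 - κT z) with hψT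
  have hψUm : Measurable ψU := by fun_prop
  have hψTm : Measurable ψT := by fun_prop
  have hκU1 (i : ℕ) (z : ℝ) : ∫⁻ m, (1 - eexp (ψ (p.uavState z m))) ∂P.map (S.mark (some i)) =
      κU z := hS.lintegral_uavState (some i) z hfm hf0
  have hU (i : ℕ) (z : ℝ) : ∫⁻ m, eexp (ψ (p.uavState z m)) ∂P.map (S.mark (some i)) =
      1 - κU z := by
    have := Measure.isProbabilityMeasure_map (μ := P) (hS.measurable_mark (some i)).aemeasurable
    have hm : Measurable (p.uavState z) := p.measurable_uavState.comp measurable_prodMk_left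
    rw [lintegral_eexp_eq_one_sub (f := fun m => ψ (p.uavState z m)) (hψ.comp hm), hκU1]
  have hT (z : ℝ) (k : ℕ) : ∫⁻ g, eexp (ψ (.tbs, z, g)) ∂P.map (S.gT k) = 1 - κT z := by
    have : P.map (S.gT k) = p.gain .tbs := by
      have h1 : p.shape .tbs = 1 := rfl
      rw [hS.gT_law, NetParams.gain, h1, expMeasure, Nat.cast_one]
    rw [this, lintegral_eexp_eq_one_sub (f := fun g => ψ (.tbs, z, g)) (by fun_prop)]
  -- integrate out the gains of the TBSs
  have step1 : ∫⁻ ω in S.center ⁻¹' B, eexp (∑' b, ψ (S.state p b ω)) ∂P =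
      ∫⁻ ω, (B.indicator 1 (S.center ω) *
        eexp (∑' i, ψ (p.uavState (dist (S.uavPos ω i) (S.user ω)) (S.mark (some i) ω)))) *
          eexp (∑' k, ψT (dist (S.tbsPos ω k) (S.user ω))) ∂P := by
    set X : Ω → (Plane × Bool × ℝ × ℝ × ℝ) × (ℕ → Plane) × (ℕ → Plane) ×
        (ℕ → Bool × ℝ × ℝ × ℝ) := fun ω =>
      (S.center ω, S.uavPos ω, S.tbsPos ω, fun i => S.mark (some i) ω) with hX
    have hXm : Measurable X := mc.prodMk (mX.prodMk (mT.prodMk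
      (measurable_pi_iff.2 fun i => hS.measurable_mark _)))
    have hind (n : ℕ) : IndepFun (fun ω => (X ω, fun j : Fin n => S.gT j ω)) (S.gT n) P := by
      refine hS.indepFun_of_sigmaOf {.gT n} (Measurable.prodMk ?_ ?_)
        (measurable_gT_sigmaOf (by simp))
      · refine Measurable.prodMk ?_ (Measurable.prodMk (measurable_uavPos_sigmaOf (by simp))
          (Measurable.prodMk (measurable_tbsPos_sigmaOf (by simp)) (measurable_pi_of fun i =>
            measurable_mark_sigmaOf (by simp) (by simp) (by simp) (by simp))))
        exact Measurable.prodMk (measurable_user_sigmaOf (by simp))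
            (measurable_mark_sigmaOf (by simp) (by simp) (by simp) (by simp))
      · exact measurable_pi_of fun j => measurable_gT_sigmaOf (by simp [j.2.ne])
    set H : (Plane × Bool × ℝ × ℝ × ℝ) × (ℕ → Plane) × (ℕ → Plane) ×
        (ℕ → Bool × ℝ × ℝ × ℝ) → ℝ≥0∞ := fun x => B.indicator 1 x.1 *
          eexp (∑' i, ψ (p.uavState (dist (x.2.1 i) x.1.1) (x.2.2.2 i))) with hH
    have hHm : Measurable H := by
      refine ((measurable_one.indicator hB).comp measurable_fst).mul
        (measurable_eexp.comp (Measurable.tsum fun i => hψ.comp ?_))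
      exact p.measurable_uavState.comp (Measurable.prodMk (by fun_prop) (by fun_prop))
    have hH1 (x) : H x ≤ 1 :=
      mul_le_one' (by by_cases h : x.1 ∈ B <;> simp [h]) (eexp_le_one _)
    have := lintegral_mul_eexp_marks (P := P) hXm (m := S.gT) hS.measurable_gT hind
      (ψ := fun k x g => ψ (.tbs, dist (x.2.2.1 k) x.1.1, g)) (fun k => by
        unfold Function.uncurry
        refine hψ.comp (measurable_const.prodMk (Measurable.prodMk ?_ (by fun_prop)))
        fun_prop) hHm hH1
    simp only [hT] at this
    refine Eq.trans ?_ this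
    rw [← lintegral_indicator (mc hB)]
    refine lintegral_congr fun ω => ?_
    have hsplit : ∑' b, ψ (S.state p b ω) =
        ∑' i, ψ (S.state p (.inl i) ω) + ∑' k, ψ (S.state p (.inr k) ω) :=
      ENNReal.summable.tsum_sum ENNReal.summable
    by_cases hω : S.center ω ∈ B
    · rw [indicator_of_mem (show ω ∈ S.center ⁻¹' B from hω), hsplit, eexp_add]
      simp only [hH, hX, indicator_of_mem hω, Pi.one_apply, one_mul]
      rfl
    · simp [hω, hH, hX]
  -- integrate out the marks of the UAVs
  have step2 : ∫⁻ ω, (B.indicator 1 (S.center ω) *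
        eexp (∑' i, ψ (p.uavState (dist (S.uavPos ω i) (S.user ω)) (S.mark (some i) ω)))) *
          eexp (∑' k, ψT (dist (S.tbsPos ω k) (S.user ω))) ∂P =
      ∫⁻ ω, (B.indicator 1 (S.center ω) * eexp (∑' k, ψT (dist (S.tbsPos ω k) (S.user ω)))) *
          eexp (∑' i, ψU (dist (S.uavPos ω i) (S.user ω))) ∂P := by
    set X : Ω → (Plane × Bool × ℝ × ℝ × ℝ) × (ℕ → Plane) × (ℕ → Plane) := fun ω =>
      (S.center ω, S.uavPos ω, S.tbsPos ω) with hX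
    have hXm : Measurable X := mc.prodMk (mX.prodMk mT)
    have hind (n : ℕ) : IndepFun (fun ω => (X ω, fun j : Fin n => S.mark (some j) ω))
        (S.mark (some n)) P := by
      refine hS.indepFun_of_sigmaOf
        {.avail (some n), .losMark (some n), .gL (some n), .gN (some n)} (Measurable.prodMk ?_ ?_)
        (measurable_mark_sigmaOf (by simp) (by simp) (by simp) (by simp))
      · refine Measurable.prodMk ?_ (Measurable.prodMk (measurable_uavPos_sigmaOf (by simp))
          (measurable_tbsPos_sigmaOf (by simp)))
        exact Measurable.prodMk (measurable_user_sigmaOf (by simp))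
            (measurable_mark_sigmaOf (by simp) (by simp) (by simp) (by simp))
      · refine measurable_pi_of fun j => ?_
        have := j.2.ne
        exact measurable_mark_sigmaOf (by simp [this]) (by simp [this]) (by simp [this])
          (by simp [this])
    set H : (Plane × Bool × ℝ × ℝ × ℝ) × (ℕ → Plane) × (ℕ → Plane) → ℝ≥0∞ := fun x =>
      B.indicator 1 x.1 * eexp (∑' k, ψT (dist (x.2.2 k) x.1.1)) with hH
    have hHm : Measurable H := by
      refine ((measurable_one.indicator hB).comp measurable_fst).mul
        (measurable_eexp.comp (Measurable.tsum fun i => hψTm.comp ?_))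
      fun_prop
    have hH1 (x) : H x ≤ 1 :=
      mul_le_one' (by by_cases h : x.1 ∈ B <;> simp [h]) (eexp_le_one _)
    have := lintegral_mul_eexp_marks (P := P) hXm (m := fun i => S.mark (some i))
      (fun i => hS.measurable_mark _) hind
      (ψ := fun i x m => ψ (p.uavState (dist (x.2.1 i) x.1.1) m)) (fun k => by
        unfold Function.uncurry
        refine hψ.comp (p.measurable_uavState.comp (Measurable.prodMk ?_ (by fun_prop)))
        fun_prop) hHm hH1
    simp only [hU] at this
    refine Eq.trans ?_ this
    refine lintegral_congr fun ω => ?_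
    simp only [hH, hX, center]
    ring
  -- average over the positions
  have mapX := Measure.isProbabilityMeasure_map (μ := P) mX.aemeasurable
  have mapT := Measure.isProbabilityMeasure_map (μ := P) mT.aemeasurable
  have step3 : ∫⁻ ω, (B.indicator 1 (S.center ω) *
        eexp (∑' k, ψT (dist (S.tbsPos ω k) (S.user ω)))) *
          eexp (∑' i, ψU (dist (S.uavPos ω i) (S.user ω))) ∂P =
      P (S.center ⁻¹' B) * (eexp (ENNReal.ofReal p.lamU *
          ∫⁻ z in Ioi (0 : ℝ), ENNReal.ofReal (2 * Real.pi * z) * (1 - eexp (ψU z))) *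
        eexp (ENNReal.ofReal p.lamT *
          ∫⁻ z in Ioi (0 : ℝ), ENNReal.ofReal (2 * Real.pi * z) * (1 - eexp (ψT z)))) := by
    set K : (Plane × Bool × ℝ × ℝ × ℝ) × (ℕ → Plane) × (ℕ → Plane) → ℝ≥0∞ := fun x =>
      B.indicator 1 x.1 * (eexp (∑' i, ψU (dist (x.2.1 i) x.1.1)) *
        eexp (∑' k, ψT (dist (x.2.2 k) x.1.1))) with hK
    have hKm : Measurable K := by
      refine ((measurable_one.indicator hB).comp measurable_fst).mul (Measurable.mul ?_ ?_)
      · refine measurable_eexp.comp (Measurable.tsum fun i => hψUm.comp ?_)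
        fun_prop
      · refine measurable_eexp.comp (Measurable.tsum fun i => hψTm.comp ?_)
        fun_prop
    have e1 : ∫⁻ ω, (B.indicator 1 (S.center ω) *
        eexp (∑' k, ψT (dist (S.tbsPos ω k) (S.user ω)))) *
          eexp (∑' i, ψU (dist (S.uavPos ω i) (S.user ω))) ∂P =
        ∫⁻ ω, K (S.center ω, S.uavPos ω, S.tbsPos ω) ∂P := by
      refine lintegral_congr fun ω => ?_
      simp only [hK, center]
      ring
    rw [e1, ← lintegral_map hKm (mc.prodMk (mX.prodMk mT)), hS.map_center_positions,
      lintegral_prod _ hKm.aemeasurable]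
    have e2 (c : Plane × Bool × ℝ × ℝ × ℝ) :
        ∫⁻ x, K (c, x) ∂(P.map S.uavPos).prod (P.map S.tbsPos) = B.indicator (fun _ =>
          (eexp (ENNReal.ofReal p.lamU *
          ∫⁻ z in Ioi (0 : ℝ), ENNReal.ofReal (2 * Real.pi * z) * (1 - eexp (ψU z))) *
        eexp (ENNReal.ofReal p.lamT *
          ∫⁻ z in Ioi (0 : ℝ), ENNReal.ofReal (2 * Real.pi * z) * (1 - eexp (ψT z))))) c := by
      by_cases hc : c ∈ B
      · simp only [hK, indicator_of_mem hc, Pi.one_apply, one_mul]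
        rw [lintegral_prod_mul (f := fun x : ℕ → Plane => eexp (∑' i, ψU (dist (x i) c.1)))
          (g := fun x : ℕ → Plane => eexp (∑' i, ψT (dist (x i) c.1)))]
        · rw [lintegral_map _ mX, lintegral_map _ mT, hS.uav_law.laplace_dist c.1 hψUm,
            hS.tbs_law.laplace_dist c.1 hψTm]
          · exact measurable_eexp.comp (Measurable.tsum fun i => hψTm.comp (by fun_prop))
          · exact measurable_eexp.comp (Measurable.tsum fun i => hψUm.comp (by fun_prop))
        · exact (measurable_eexp.comp
            (Measurable.tsum fun i => hψUm.comp (by fun_prop))).aemeasurable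
        · exact (measurable_eexp.comp
            (Measurable.tsum fun i => hψTm.comp (by fun_prop))).aemeasurable
      · simp [hK, hc]
    simp only [e2]
    rw [lintegral_indicator_const hB, Measure.map_apply mc hB, mul_comm]
  -- compare the exponents
  have hκTle (z : ℝ) : κT z ≤ 1 :=
    (lintegral_mono fun g => (tsub_le_self : f (.tbs, z, g) ≤ 1)).trans (by simp)
  have hκUle (z : ℝ) : κU z ≤ 1 := by
    rw [← hκU1 0 z]
    have := Measure.isProbabilityMeasure_map (μ := P) (hS.measurable_mark (some 0)).aemeasurable
    exact (lintegral_mono fun m => tsub_le_self).trans (by simp)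
  have hψU1 (z : ℝ) : 1 - eexp (ψU z) = κU z := by
    rw [hψU, eexp_negLog tsub_le_self, ENNReal.sub_sub_cancel ENNReal.one_ne_top (hκUle z)]
  have hψT1 (z : ℝ) : 1 - eexp (ψT z) = κT z := by
    rw [hψT, eexp_negLog tsub_le_self, ENNReal.sub_sub_cancel ENNReal.one_ne_top (hκTle z)]
  rw [step1, step2, step3, ← eexp_add]
  congr 2
  have hπ := Real.pi_pos
  rw [NetParams.lintegral_intensity, p.lintegral_intensityOf _ hfm, p.lintegral_intensityOf _ hfm,
    p.lintegral_intensityOf _ hfm]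
  congr 1
  · have m1 := hfg .los
    have m2 := hfg .nlos
    rw [← lintegral_add_left (by fun_prop), ← lintegral_const_mul _ (by fun_prop)]
    refine setLIntegral_congr_fun measurableSet_Ioi fun z (hz : 0 < z) => ?_
    have hl := p.pLoS_pos (√(z ^ 2 + p.h ^ 2))
    have hn := p.pNLoS_pos (√(z ^ 2 + p.h ^ 2))
    have hPa := p.Pa_nonneg
    have hla := p.lamU_pos
    simp only [hψU1, hκU, NetParams.weight, NetParams.lamA]
    have e1 : ENNReal.ofReal (2 * Real.pi * (p.Pa * p.lamU) * (z * p.pLoS (√(z ^ 2 + p.h ^ 2)))) =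
        ENNReal.ofReal p.lamU * ENNReal.ofReal (2 * Real.pi * z) * ENNReal.ofReal p.Pa *
          ENNReal.ofReal (p.pLoS (√(z ^ 2 + p.h ^ 2))) := by
      rw [← ENNReal.ofReal_mul (by positivity), ← ENNReal.ofReal_mul (by positivity),
        ← ENNReal.ofReal_mul (by positivity)]
      congr 1
      ring
    have e2 : ENNReal.ofReal (2 * Real.pi * (p.Pa * p.lamU) * (z * p.pNLoS (√(z ^ 2 + p.h ^ 2)))) =
        ENNReal.ofReal p.lamU * ENNReal.ofReal (2 * Real.pi * z) * ENNReal.ofReal p.Pa *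
          ENNReal.ofReal (p.pNLoS (√(z ^ 2 + p.h ^ 2))) := by
      rw [← ENNReal.ofReal_mul (by positivity), ← ENNReal.ofReal_mul (by positivity),
        ← ENNReal.ofReal_mul (by positivity)]
      congr 1
      ring
    rw [e1, e2]
    ring
  · rw [← lintegral_const_mul _ (by fun_prop)]
    refine setLIntegral_congr_fun measurableSet_Ioi fun z (hz : 0 < z) => ?_
    have hla := p.lamT_pos
    simp only [hψT1, hκT, NetParams.weight]
    rw [← mul_assoc, ← ENNReal.ofReal_mul hla.le]
    congr 2
    ring

end Inputs.IsModel

/-! ### The gamma distribution with an integer shape -/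

/-- The derivatives of consecutive terms telescope, and only the last one survives. -/
lemma hasDerivAt_erlang_tail (r : ℝ) (n : ℕ) (x : ℝ) :
    HasDerivAt (fun x => ∑ k ∈ Finset.range (n + 1), (r * x) ^ k / (k.factorial : ℝ) *
      Real.exp (-(r * x))) (-(r * ((r * x) ^ n / (n.factorial : ℝ) * Real.exp (-(r * x))))) x := by
  have hlin : HasDerivAt (fun x => r * x) r x := by
    simpa using (hasDerivAt_id x).const_mul r
  have hexp : HasDerivAt (fun x => Real.exp (-(r * x))) (Real.exp (-(r * x)) * -r) x := hlin.neg.exp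
  induction n with
  | zero =>
    simp only [zero_add, Finset.sum_range_one, pow_zero, Nat.factorial_zero, Nat.cast_one, div_one,
      one_mul]
    exact hexp.congr_deriv (by ring)
  | succ n ih =>
    simp_rw [Finset.sum_range_succ _ (n + 1)]
    have h1 : HasDerivAt (fun x => (r * x) ^ (n + 1) / ((n + 1).factorial : ℝ))
        (r * ((r * x) ^ n / (n.factorial : ℝ))) x := by
      refine ((hlin.fun_pow (n + 1)).div_const ((n + 1).factorial : ℝ)).congr_deriv ?_
      rw [Nat.factorial_succ]
      push_cast
      have : ((n : ℝ) + 1) ≠ 0 := by positivity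
      have : (n.factorial : ℝ) ≠ 0 := by positivity
      field_simp
    exact (ih.fun_add (h1.fun_mul hexp)).congr_deriv (by ring)

lemma tendsto_erlang_tail {r : ℝ} (hr : 0 < r) (n : ℕ) :
    Tendsto (fun x => ∑ k ∈ Finset.range n, (r * x) ^ k / (k.factorial : ℝ) *
      Real.exp (-(r * x))) atTop (𝓝 0) := by
  rw [← Finset.sum_const_zero (s := Finset.range n)]
  refine tendsto_finsetSum _ fun k _ => ?_
  have h := (Real.tendsto_pow_mul_exp_neg_atTop_nhds_zero k).comp
    (tendsto_id.const_mul_atTop hr)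
  have h2 := h.const_mul ((k.factorial : ℝ)⁻¹)
  rw [mul_zero] at h2
  refine h2.congr fun x => ?_
  simp only [Function.comp_apply, id]
  ring

/-- Up to sign, the finite sum is an antiderivative of the gamma density that tends to `0` at
infinity. This is where the integer shape enters. -/
lemma gammaMeasure_Ici {m : ℕ} (hm : 0 < m) {r : ℝ} (hr : 0 < r) {t : ℝ} (ht : 0 ≤ t) :
    gammaMeasure m r (Ici t) = ENNReal.ofReal
      (∑ k ∈ Finset.range m, (r * t) ^ k / (k.factorial : ℝ) * Real.exp (-(r * t))) := by
  obtain ⟨n, rfl⟩ : ∃ n, m = n + 1 := ⟨m - 1, by omega⟩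
  set G : ℝ → ℝ := fun x => -∑ k ∈ Finset.range (n + 1), (r * x) ^ k / (k.factorial : ℝ) *
    Real.exp (-(r * x)) with hG
  set G' : ℝ → ℝ := fun x => r * ((r * x) ^ n / (n.factorial : ℝ) * Real.exp (-(r * x))) with hG'
  have hd : ∀ x ∈ Ici t, HasDerivAt G (G' x) x := fun x _ => by
    exact (hasDerivAt_erlang_tail r n x).fun_neg.congr_deriv (by simp only [hG', neg_neg])
  have hpos : ∀ x ∈ Ioi t, 0 ≤ G' x := fun x hx => by
    have : 0 < x := lt_of_le_of_lt ht hx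
    simp only [hG']
    positivity
  have hlim : Tendsto G atTop (𝓝 0) := by
    simpa using (tendsto_erlang_tail hr (n + 1)).neg
  have hint := integrableOn_Ioi_deriv_of_nonneg' hd hpos hlim
  have hval := integral_Ioi_of_hasDerivAt_of_nonneg' hd hpos hlim
  have hpdf : ∀ x ∈ Ioi t, gammaPDF ((n + 1 : ℕ) : ℝ) r x = ENNReal.ofReal (G' x) := by
    intro x hx
    have hx0 : 0 < x := lt_of_le_of_lt ht hx
    rw [gammaPDF_of_nonneg hx0.le]
    congr 1
    have h1 : ((n + 1 : ℕ) : ℝ) - 1 = n := by push_cast; ring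
    rw [h1, Real.rpow_natCast, Real.rpow_natCast]
    have h2 : Real.Gamma ((n + 1 : ℕ) : ℝ) = n.factorial := by
      push_cast; exact Real.Gamma_nat_eq_factorial n
    rw [h2, hG']
    simp only
    rw [mul_pow]
    ring
  rw [gammaMeasure, withDensity_apply _ measurableSet_Ici, setLIntegral_congr Ioi_ae_eq_Ici.symm,
    setLIntegral_congr_fun measurableSet_Ioi hpdf,
    ← ofReal_integral_eq_lintegral_ofReal hint
      ((ae_restrict_iff' measurableSet_Ioi).2 (ae_of_all _ hpos)), hval]
  simp [hG]

/-- Exponential tilting turns the gamma density of rate `m` into a multiple of the one of rate `m +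
t`, which has total mass one. -/
lemma lintegral_eexp_gammaMeasure {m : ℕ} (hm : 0 < m) {t : ℝ} (ht : 0 ≤ t) :
    ∫⁻ g, eexp (ENNReal.ofReal (t * g)) ∂gammaMeasure m m =
      ENNReal.ofReal ((m / (m + t)) ^ m) := by
  have hm' : (0 : ℝ) < m := by exact_mod_cast hm
  have hmt : (0 : ℝ) < m + t := by linarith
  have key (g : ℝ) : gammaPDF m m g * eexp (ENNReal.ofReal (t * g)) =
      ENNReal.ofReal ((m / (m + t)) ^ m) * gammaPDF m (m + t) g := by
    by_cases hg : g < 0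
    · simp [gammaPDF_of_neg hg]
    · rw [not_lt] at hg
      have hΓ := Real.Gamma_pos_of_pos hm'
      rw [gammaPDF_of_nonneg hg, gammaPDF_of_nonneg hg, eexp_ofReal (by positivity),
        ← ENNReal.ofReal_mul (by positivity), ← ENNReal.ofReal_mul (by positivity)]
      congr 1
      rw [Real.rpow_natCast, Real.rpow_natCast, mul_assoc, ← Real.exp_add, div_pow]
      have : -(m * g) + -(t * g) = -((m + t) * g) := by ring
      rw [this]
      field_simp
  have hpm (r : ℝ) : Measurable (gammaPDF m r) :=
    (measurable_gammaPDFReal m r).ennreal_ofReal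
  rw [gammaMeasure, lintegral_withDensity_eq_lintegral_mul _ (hpm _) (by fun_prop)]
  simp only [Pi.mul_apply, key]
  rw [lintegral_const_mul _ (hpm _), lintegral_gammaPDF_eq_one hm' hmt, mul_one]

/-- Tail of the sum of `m` independent standard exponential variables. -/
def erlangTail (m : ℕ) (x : ℝ≥0∞) : ℝ≥0∞ :=
  if x = ⊤ then 0
  else ENNReal.ofReal (∑ k ∈ Finset.range m, x.toReal ^ k / (k.factorial : ℝ) *
    Real.exp (-x.toReal))

@[fun_prop]
lemma measurable_erlangTail (m : ℕ) : Measurable (erlangTail m) := by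
  unfold erlangTail
  exact Measurable.ite (measurableSet_singleton _) measurable_const (by fun_prop)

lemma gammaMeasure_setOf_le {m : ℕ} (hm : 0 < m) {a c : ℝ} (ha : 0 < a) (hc : 0 < c) (J : ℝ≥0∞) :
    gammaMeasure m m {g | ENNReal.ofReal a * J ≤ ENNReal.ofReal (c * g)} =
      erlangTail m (ENNReal.ofReal (m * (a / c)) * J) := by
  have hm' : (0 : ℝ) < m := by exact_mod_cast hm
  by_cases hJ : J = ⊤
  · have h1 : ENNReal.ofReal a * J = ⊤ := by
      rw [hJ, ENNReal.mul_top (by simpa using ha)]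
    have h2 : ENNReal.ofReal (m * (a / c)) * J = ⊤ := by
      rw [hJ, ENNReal.mul_top (ENNReal.ofReal_pos.2 (by positivity)).ne']
    rw [h1, h2, erlangTail, if_pos rfl]
    simp
  · lift J to NNReal using hJ
    have h2 : ENNReal.ofReal (m * (a / c)) * J = ENNReal.ofReal (m * (a / c) * J) := by
      rw [ENNReal.ofReal_mul (p := m * (a / c)) (by positivity), ENNReal.ofReal_coe_nnreal]
    rw [h2, erlangTail, if_neg ENNReal.ofReal_ne_top, ENNReal.toReal_ofReal (by positivity)]
    have h3 : m * (a / c) * J = m * (a * J / c) := by ring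
    rw [h3, ← gammaMeasure_Ici hm hm' (by positivity)]
    -- `ENNReal.ofReal` truncates negative numbers, so for `J = 0` the two sets differ on the
    -- negative axis, which is null.
    have h4 : ∀ᵐ g ∂gammaMeasure m m, 0 ≤ g := by
      rw [ae_iff, gammaMeasure, withDensity_apply _ (by measurability)]
      have : {a : ℝ | ¬0 ≤ a} = Iio 0 := by ext; simp
      rw [this]
      exact lintegral_gammaPDF_of_nonpos le_rfl
    refine measure_congr ?_
    filter_upwards [h4] with g hg
    have h5 : ENNReal.ofReal a * J = ENNReal.ofReal (a * J) := by
      rw [ENNReal.ofReal_mul ha.le, ENNReal.ofReal_coe_nnreal]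
    refine propext ?_
    change ENNReal.ofReal a * J ≤ ENNReal.ofReal (c * g) ↔ a * J / c ≤ g
    rw [h5, ENNReal.ofReal_le_ofReal_iff (by positivity), div_le_iff₀ hc, mul_comm c]

/-! ### Derivatives of a Laplace transform -/

section Deriv

variable {Ω : Type*} [MeasurableSpace Ω] {μ : Measure Ω} {J : Ω → ℝ≥0∞}
  {Φ : ℝ → ℝ}

lemma eexp_ofReal_mul {s : ℝ} (hs : 0 < s) (x : ℝ≥0∞) :
    eexp (ENNReal.ofReal s * x) =
      ({⊤}ᶜ : Set ℝ≥0∞).indicator (fun x => ENNReal.ofReal (Real.exp (s * -x.toReal))) x := by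
  by_cases hx : x = ⊤
  · simp [hx, ENNReal.mul_top, hs]
  · rw [indicator_of_mem (by simpa using hx), eexp_of_ne_top (ENNReal.mul_ne_top (by simp) hx),
      ENNReal.toReal_mul, ENNReal.toReal_ofReal hs.le, mul_neg]

lemma mem_interior_integrableExpSet (hJ : Measurable J) (ν : Measure Ω) [IsFiniteMeasure ν]
    {s : ℝ} (hs : 0 < s) : s ∈ interior (integrableExpSet (fun ω => -(J ω).toReal) ν) := by
  rw [mem_interior]
  refine ⟨Ioi 0, fun t (ht : 0 < t) => ?_, isOpen_Ioi, hs⟩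
  refine Integrable.mono' (integrable_const (1 : ℝ))
    (Measurable.aestronglyMeasurable (by fun_prop)) (ae_of_all _ fun ω => ?_)
  rw [Real.norm_of_nonneg (Real.exp_pos _).le, Real.exp_le_one_iff, mul_neg, neg_nonpos]
  positivity

/-- Where `J = ⊤` the left exponential is `0`, while `toReal` would give `1`. Restricting the
measure to finite `J` removes this discrepancy; it requires `s > 0`. -/
lemma laplace_eq_mgf (hJ : Measurable J)
    (hΦ : ∀ s, 0 < s → ENNReal.ofReal (Φ s) = ∫⁻ ω, eexp (ENNReal.ofReal s * J ω) ∂μ)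
    (hΦ0 : ∀ s, 0 < s → 0 ≤ Φ s) {s : ℝ} (hs : 0 < s) :
    Φ s = mgf (fun ω => -(J ω).toReal) (μ.restrict (J ⁻¹' {⊤}ᶜ)) s := by
  have hm : MeasurableSet (J ⁻¹' {⊤}ᶜ) := hJ (measurableSet_singleton _).compl
  rw [← ENNReal.toReal_ofReal (hΦ0 s hs), hΦ s hs, mgf, integral_eq_lintegral_of_nonneg_ae
    (ae_of_all _ fun ω => (Real.exp_pos _).le) (Measurable.aestronglyMeasurable (by fun_prop)),
    ← lintegral_indicator hm]
  congr 1
  refine lintegral_congr fun ω => ?_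
  rw [eexp_ofReal_mul hs]
  rfl

lemma contDiffOn_of_laplace [IsFiniteMeasure μ] (hJ : Measurable J)
    (hΦ : ∀ s, 0 < s → ENNReal.ofReal (Φ s) = ∫⁻ ω, eexp (ENNReal.ofReal s * J ω) ∂μ)
    (hΦ0 : ∀ s, 0 < s → 0 ≤ Φ s) {n : WithTop ℕ∞} : ContDiffOn ℝ n Φ (Ioi 0) := by
  have h : AnalyticOn ℝ (mgf (fun ω => -(J ω).toReal) (μ.restrict (J ⁻¹' {⊤}ᶜ))) (Ioi 0) :=
    analyticOn_mgf.mono fun s hs => mem_interior_integrableExpSet hJ _ hs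
  exact (h.contDiffOn (uniqueDiffOn_Ioi 0)).congr fun s hs => laplace_eq_mgf hJ hΦ hΦ0 hs

/-- Differentiating under the integral, the `k`-th derivative of `Φ` at `s` is the integral of
`(-J)^k e^{-sJ}` over finite `J`; the factor `(-s)^k` cancels the sign. The measure need not be a
probability, so that `μ` may be a restriction to a void event. -/
lemma lintegral_erlangTail [IsFiniteMeasure μ] (hJ : Measurable J)
    (hΦ : ∀ s, 0 < s → ENNReal.ofReal (Φ s) = ∫⁻ ω, eexp (ENNReal.ofReal s * J ω) ∂μ)
    (hΦ0 : ∀ s, 0 < s → 0 ≤ Φ s) (m : ℕ) {s : ℝ} (hs : 0 < s) :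
    0 ≤ ∑ k ∈ Finset.range m, (-s) ^ k / (k.factorial : ℝ) * iteratedDeriv k Φ s ∧
    ∫⁻ ω, erlangTail m (ENNReal.ofReal s * J ω) ∂μ = ENNReal.ofReal
      (∑ k ∈ Finset.range m, (-s) ^ k / (k.factorial : ℝ) * iteratedDeriv k Φ s) := by
  set X : Ω → ℝ := fun ω => -(J ω).toReal with hX
  set ν := μ.restrict (J ⁻¹' {⊤}ᶜ) with hν
  have hm : MeasurableSet (J ⁻¹' {⊤}ᶜ) := hJ (measurableSet_singleton _).compl
  have hs' := mem_interior_integrableExpSet hJ ν hs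
  have hd (k : ℕ) : iteratedDeriv k Φ s = ∫ ω, X ω ^ k * Real.exp (s * X ω) ∂ν := by
    have : Φ =ᶠ[𝓝 s] mgf X ν := by
      filter_upwards [Ioi_mem_nhds hs] with t ht using laplace_eq_mgf hJ hΦ hΦ0 ht
    rw [this.iteratedDeriv_eq, iteratedDeriv_mgf hs']
  have hint (k : ℕ) : Integrable (fun ω => X ω ^ k * Real.exp (s * X ω)) ν :=
    integrable_pow_mul_exp_of_mem_interior_integrableExpSet hs' k
  have hnn (ω : Ω) : 0 ≤ ∑ k ∈ Finset.range m, (s * (J ω).toReal) ^ k / (k.factorial : ℝ) *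
      Real.exp (-(s * (J ω).toReal)) := Finset.sum_nonneg fun k _ => by positivity
  have hsum : ∑ k ∈ Finset.range m, (-s) ^ k / (k.factorial : ℝ) * iteratedDeriv k Φ s =
      ∫ ω, ∑ k ∈ Finset.range m, (s * (J ω).toReal) ^ k / (k.factorial : ℝ) *
        Real.exp (-(s * (J ω).toReal)) ∂ν := by
    have hterm (k : ℕ) (ω : Ω) : (s * (J ω).toReal) ^ k / (k.factorial : ℝ) *
        Real.exp (-(s * (J ω).toReal)) =
        (-s) ^ k / (k.factorial : ℝ) * (X ω ^ k * Real.exp (s * X ω)) := by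
      have : s * (J ω).toReal = (-s) * X ω := by simp [hX]
      rw [this, mul_pow]
      have : -(-s * X ω) = s * X ω := by ring
      rw [this]
      ring
    simp_rw [hterm]
    rw [integral_finsetSum _ fun k _ => (hint k).const_mul _]
    refine Finset.sum_congr rfl fun k _ => ?_
    rw [integral_const_mul, hd]
  rw [hsum]
  refine ⟨integral_nonneg hnn, ?_⟩
  rw [integral_eq_lintegral_of_nonneg_ae (ae_of_all _ hnn)
    (Measurable.aestronglyMeasurable (by fun_prop))]
  have hl : ∫⁻ ω, erlangTail m (ENNReal.ofReal s * J ω) ∂μ =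
      ∫⁻ ω, ENNReal.ofReal (∑ k ∈ Finset.range m, (s * (J ω).toReal) ^ k / (k.factorial : ℝ) *
        Real.exp (-(s * (J ω).toReal))) ∂ν := by
    rw [hν, ← lintegral_indicator hm]
    refine lintegral_congr fun ω => ?_
    by_cases hω : J ω = ⊤
    · simp [hω, ENNReal.mul_top, hs, erlangTail]
    · rw [indicator_of_mem (by simpa using hω), erlangTail,
        if_neg (ENNReal.mul_ne_top (by simp) hω), ENNReal.toReal_mul, ENNReal.toReal_ofReal hs.le]
  rw [hl, ENNReal.ofReal_toReal]
  have hi : Integrable (fun ω => ∑ k ∈ Finset.range m, (s * (J ω).toReal) ^ k / (k.factorial : ℝ) *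
        Real.exp (-(s * (J ω).toReal))) ν := by
    refine integrable_finsetSum _ fun k _ => ?_
    refine ((hint k).const_mul ((-s) ^ k / (k.factorial : ℝ))).congr (ae_of_all _ fun ω => ?_)
    have h1 : X ω = -(J ω).toReal := rfl
    simp only [h1, mul_neg]
    rw [mul_pow, neg_pow s, neg_pow (J ω).toReal]
    have h2 : ((-1 : ℝ) ^ k) * (-1) ^ k = 1 := by rw [← mul_pow]; norm_num
    linear_combination (s ^ k / (k.factorial : ℝ) * (J ω).toReal ^ k *
      Real.exp (-(s * (J ω).toReal))) * h2
  exact hi.lintegral_lt_top.ne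

end Deriv

/-! ### Laplace transform of the interference -/

namespace NetParams

variable (p : NetParams)

/-- Transmission power times mean additional loss. -/
def coef : Link → ℝ
  | .off => 0
  | .los => p.etaL * p.rhoU
  | .nlos => p.etaN * p.rhoU
  | .tbs => p.rhoT

/-- Path-loss exponent. -/
def expo : Link → ℝ
  | .off => 1
  | .los => p.alphaL
  | .nlos => p.alphaN
  | .tbs => p.alphaT

lemma coef_nonneg (q : Link) : 0 ≤ p.coef q := by
  have := p.etaL_pos
  have := p.etaN_pos
  have := p.rhoU_pos
  have := p.rhoT_pos
  cases q <;> unfold coef <;> positivity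

lemma coef_pos {q : Link} (hq : q ≠ .off) : 0 < p.coef q := by
  have := p.etaL_pos
  have := p.etaN_pos
  have := p.rhoU_pos
  have := p.rhoT_pos
  cases q
  · exact absurd rfl hq
  all_goals unfold coef; positivity

lemma expo_pos (q : Link) : 0 < p.expo q := by
  cases q
  exacts [one_pos, p.alphaL_pos, p.alphaN_pos, p.alphaT_pos]

lemma slant_pos (q : Link) {z : ℝ} (hz : 0 < z) : 0 < p.slant q z := by
  cases q <;> unfold slant <;> positivity

lemma slant_nonneg (q : Link) {z : ℝ} (hz : 0 ≤ z) : 0 ≤ p.slant q z := by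
  cases q <;> unfold slant <;> positivity

/-- Average power received at horizontal distance `z`. -/
def meanPower (q : Link) (z : ℝ) : ℝ := p.coef q * p.slant q z ^ (-p.expo q)

lemma meanPower_nonneg (q : Link) {z : ℝ} (hz : 0 ≤ z) : 0 ≤ p.meanPower q z :=
  mul_nonneg (p.coef_nonneg q) (Real.rpow_nonneg (p.slant_nonneg q hz) _)

lemma meanPower_pos {q : Link} (hq : q ≠ .off) {z : ℝ} (hz : 0 < z) : 0 < p.meanPower q z :=
  mul_pos (p.coef_pos hq) (Real.rpow_pos_of_pos (p.slant_pos q hz) _)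

@[fun_prop]
lemma measurable_meanPower (q : Link) : Measurable (p.meanPower q) := by
  unfold meanPower
  fun_prop

/-- Average power received from a transmitter. -/
def avg (y : State) : ℝ≥0∞ := ENNReal.ofReal (p.meanPower y.1 y.2.1)

/-- Power received from a transmitter, fading included. -/
def rx (y : State) : ℝ≥0∞ := ENNReal.ofReal (p.meanPower y.1 y.2.1 * y.2.2)

lemma measurable_state_of {β : Type*} [MeasurableSpace β] {f : State → β}
    (h : ∀ q, Measurable fun x : ℝ × ℝ => f (q, x)) : Measurable f := by
  have hc : Countable Link := by
    refine Function.Injective.countable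
      (f := fun q : Link => match q with | .off => (0 : ℕ) | .los => 1 | .nlos => 2 | .tbs => 3) ?_
    intro a b hab
    cases a <;> cases b <;> simp_all
  exact measurable_from_prod_countable_right h

@[fun_prop]
lemma measurable_avg : Measurable p.avg := measurable_state_of fun q => by
  exact ((p.measurable_meanPower q).comp measurable_fst).ennreal_ofReal

@[fun_prop]
lemma measurable_rx : Measurable p.rx := measurable_state_of fun q => by
  exact (((p.measurable_meanPower q).comp measurable_fst).mul measurable_snd).ennreal_ofReal

@[simp] lemma avg_offState : p.avg offState = 0 := by simp [avg, offState, meanPower, coef]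

@[simp] lemma rx_offState : p.rx offState = 0 := by simp [rx, offState, meanPower, coef]

/-- Lower limits of the horizontal distances of the interfering transmitters. -/
def lower (t : Serving) (r : ℝ) : Link → ℝ
  | .off => 0
  | .los => p.lowerL t r
  | .nlos => p.lowerN t r
  | .tbs => p.lowerT t r

lemma lower_nonneg (t : Serving) {r : ℝ} (hr : 0 ≤ r) (q : Link) : 0 ≤ p.lower t r q := by
  have h1 := p.rhoT_pos
  have h2 := p.rhoU_pos
  have h3 := p.etaL_pos
  have h4 := p.etaN_pos
  cases q
  · exact le_rfl
  · cases t <;> simp only [lower, lowerL] <;> positivity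
  · cases t <;> simp only [lower, lowerN] <;> positivity
  · cases t <;> simp only [lower, lowerT, dLT, dNT] <;> positivity

/-- Probability that there is no transmitter below the lower limits. -/
def voidAll (L : Link → ℝ) : ℝ :=
  Real.exp (-∫ z in (0 : ℝ)..L .nlos, p.weight .nlos z) *
    Real.exp (-∫ z in (0 : ℝ)..L .los, p.weight .los z) *
      Real.exp (-∫ z in (0 : ℝ)..L .tbs, p.weight .tbs z)

lemma voidAll_pos (L : Link → ℝ) : 0 < p.voidAll L := by
  unfold voidAll
  positivity

/-- One minus the Laplace transform of the power received at horizontal distance `z`. -/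
def loss (q : Link) (s z : ℝ) : ℝ :=
  1 - (p.shape q / (p.shape q + s * p.meanPower q z)) ^ p.shape q

lemma loss_nonneg (q : Link) {s z : ℝ} (hs : 0 ≤ s) (hz : 0 ≤ z) : 0 ≤ p.loss q s z := by
  have h1 := p.shape_pos q
  have h2 := p.meanPower_nonneg q hz
  have h3 : (0 : ℝ) < p.shape q := by exact_mod_cast h1
  unfold loss
  rw [sub_nonneg]
  refine pow_le_one₀ (by positivity) ?_
  rw [div_le_one (by positivity)]
  have : 0 ≤ s * p.meanPower q z := by positivity
  linarith

lemma lintegral_weight (q : Link) {L : ℝ} (hL : 0 ≤ L) :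
    ∫⁻ z in Ioc 0 L, ENNReal.ofReal (p.weight q z) =
      ENNReal.ofReal (∫ z in (0 : ℝ)..L, p.weight q z) := by
  obtain ⟨C, hC⟩ := p.exists_weight_le q
  rw [intervalIntegral.integral_of_le hL, ofReal_integral_eq_lintegral_ofReal]
  · refine Measure.integrableOn_of_bounded (M := |C| * L) (by simp)
      (p.measurable_weight q).aestronglyMeasurable ?_
    refine (ae_restrict_iff' measurableSet_Ioc).2 (ae_of_all _ fun z hz => ?_)
    rw [Real.norm_of_nonneg (p.weight_nonneg q hz.1.le)]
    refine (hC z hz.1).trans ?_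
    have h1 := hz.1
    have h2 := hz.2
    calc C * z ≤ |C| * z := by gcongr; exact le_abs_self C
      _ ≤ |C| * L := by gcongr
  · exact (ae_restrict_iff' measurableSet_Ioc).2 (ae_of_all _ fun z hz => p.weight_nonneg q hz.1.le)

/-- Laplace exponent of the transmitters of one kind that stay beyond the lower limit. -/
lemma lintegral_intensityOf_laplace {q : Link} {L : ℝ} (hL : 0 ≤ L) {u : State → ℝ≥0∞}
    (hu : Measurable u) {c : ℝ≥0∞}
    (huL : ∀ z, 0 < z → z ≠ L → ∀ g, (u (q, z, g) ≤ c ↔ L < z)) {s : ℝ} (hs : 0 ≤ s) :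
    ∫⁻ y, (1 - eexp ((if u y ≤ c then 0 else ⊤) + ENNReal.ofReal s * p.rx y)) ∂p.intensityOf q =
      ENNReal.ofReal (∫ z in (0 : ℝ)..L, p.weight q z) +
        ∫⁻ z in Ioi L, ENNReal.ofReal (p.weight q z) * ENNReal.ofReal (p.loss q s z) := by
  have hm : Measurable fun y => (if u y ≤ c then 0 else ⊤ : ℝ≥0∞) + ENNReal.ofReal s * p.rx y :=
    (Measurable.ite (measurableSet_le hu measurable_const) measurable_const
        measurable_const).add (by fun_prop)
  rw [p.lintegral_intensityOf q (by fun_prop), ← Ioc_union_Ioi_eq_Ioi hL,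
    lintegral_union measurableSet_Ioi (Ioc_disjoint_Ioi le_rfl), ← p.lintegral_weight q hL]
  -- The boundary distance is null, so it does not matter whether the void condition is strict.
  -- Below `L` the penalty is infinite and a point contributes its full weight; beyond `L` it
  -- contributes the weight times `loss`.
  have hae : ∀ᵐ z : ℝ, z ≠ L := by simp [ae_iff]
  congr 1
  · refine setLIntegral_congr_fun_ae measurableSet_Ioc ?_
    filter_upwards [hae] with z hzL hz
    have : ∀ g, ¬ u (q, z, g) ≤ c := fun g h => by
      exact absurd ((huL z hz.1 hzL g).1 h) (not_lt.2 hz.2)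
    simp [this]
  · refine setLIntegral_congr_fun_ae measurableSet_Ioi ?_
    filter_upwards [hae] with z hzL hz
    have hz0 : 0 < z := lt_of_le_of_lt hL hz
    have : ∀ g, u (q, z, g) ≤ c := fun g => (huL z hz0 hzL g).2 hz
    have hmp := p.meanPower_nonneg q hz0.le
    simp only [this, if_true, zero_add]
    congr 1
    have h1 : ∫⁻ g, eexp (ENNReal.ofReal s * p.rx (q, z, g)) ∂p.gain q =
        ENNReal.ofReal ((p.shape q / (p.shape q + s * p.meanPower q z)) ^ p.shape q) := by
      rw [← lintegral_eexp_gammaMeasure (p.shape_pos q) (by positivity)]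
      refine lintegral_congr fun g => ?_
      rw [rx, ← ENNReal.ofReal_mul hs, mul_assoc]
    have h2 : ∫⁻ g, (1 - eexp (ENNReal.ofReal s * p.rx (q, z, g))) ∂p.gain q =
        1 - ∫⁻ g, eexp (ENNReal.ofReal s * p.rx (q, z, g)) ∂p.gain q := by
      rw [lintegral_sub (by fun_prop)]
      · simp
      · exact ((lintegral_mono fun g => eexp_le_one _).trans_lt (by simp)).ne
      · exact ae_of_all _ fun g => eexp_le_one _
    rw [h2, h1, loss, ENNReal.ofReal_sub _ (by positivity), ENNReal.ofReal_one]

lemma sqrt_rpow_neg {x : ℝ} (hx : 0 ≤ x) (a : ℝ) : √x ^ (-a) = x ^ (-a / 2) := by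
  rw [Real.sqrt_eq_rpow, ← Real.rpow_mul hx]
  congr 1
  ring

lemma laplaceI_eq (t : Serving) {s r : ℝ} (hs : 0 ≤ s) (hr : 0 ≤ r) :
    ENNReal.ofReal (p.laplaceI t s r) =
      eexp (∫⁻ z in Ioi (p.lower t r .nlos),
          ENNReal.ofReal (p.weight .nlos z) * ENNReal.ofReal (p.loss .nlos s z)) *
      eexp (∫⁻ z in Ioi (p.lower t r .los),
          ENNReal.ofReal (p.weight .los z) * ENNReal.ofReal (p.loss .los s z)) *
      eexp (∫⁻ z in Ioi (p.lower t r .tbs),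
          ENNReal.ofReal (p.weight .tbs z) * ENNReal.ofReal (p.loss .tbs s z)) := by
  have hlam := p.lamA_nonneg
  have hlamT := p.lamT_pos
  have hπ := Real.pi_pos
  have hpos (q : Link) {z : ℝ} (hz : z ∈ Ioi (p.lower t r q)) : 0 ≤ z :=
    ((p.lower_nonneg t hr q).trans_lt hz).le
  rw [laplaceI, ENNReal.ofReal_mul (mul_nonneg (expNeg_nonneg _) (expNeg_nonneg _)),
    ENNReal.ofReal_mul (expNeg_nonneg _)]
  simp only [ofReal_expNeg]
  rw [← lintegral_const_mul' _ _ ENNReal.ofReal_ne_top,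
    ← lintegral_const_mul' _ _ ENNReal.ofReal_ne_top,
    ← lintegral_const_mul' _ _ ENNReal.ofReal_ne_top]
  congr 1
  · congr 1
    · refine congrArg eexp (setLIntegral_congr_fun measurableSet_Ioi fun z hz => ?_)
      have hz0 := hpos .nlos hz
      have hl := p.loss_nonneg .nlos hs hz0
      have hw := p.weight_nonneg .nlos hz0
      have e : (1 - (p.mN / (p.mN + s * p.etaN * p.rhoU *
          (z ^ 2 + p.h ^ 2) ^ (-p.alphaN / 2))) ^ p.mN) = p.loss .nlos s z := by
        rw [loss, meanPower, slant, expo, coef, shape, sqrt_rpow_neg (by positivity)]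
        · congr 4; ring
        · exact fun h => nomatch h
      rw [e, ← ENNReal.ofReal_mul (by positivity), ← ENNReal.ofReal_mul hw]
      congr 1
      simp only [weight]
      ring
    · refine congrArg eexp (setLIntegral_congr_fun measurableSet_Ioi fun z hz => ?_)
      have hz0 := hpos .los hz
      have hl := p.loss_nonneg .los hs hz0
      have hw := p.weight_nonneg .los hz0
      have e : (1 - (p.mL / (p.mL + s * p.etaL * p.rhoU *
          (z ^ 2 + p.h ^ 2) ^ (-p.alphaL / 2))) ^ p.mL) = p.loss .los s z := by
        rw [loss, meanPower, slant, expo, coef, shape, sqrt_rpow_neg (by positivity)]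
        · congr 4; ring
        · exact fun h => nomatch h
      rw [e, ← ENNReal.ofReal_mul (by positivity), ← ENNReal.ofReal_mul hw]
      congr 1
      simp only [weight]
      ring
  · refine congrArg eexp (setLIntegral_congr_fun measurableSet_Ioi fun z hz => ?_)
    have hz0 := hpos .tbs hz
    have hl := p.loss_nonneg .tbs hs hz0
    have hw := p.weight_nonneg .tbs hz0
    have e : 1 - 1 / (1 + s * p.rhoT * z ^ (-p.alphaT)) = p.loss .tbs s z := by
      have h1 : p.shape .tbs = 1 := rfl
      rw [loss, h1, meanPower, slant, expo, coef, Nat.cast_one, pow_one, mul_assoc]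
    rw [e, ← ENNReal.ofReal_mul (by positivity), ← ENNReal.ofReal_mul hw]
    congr 1
    simp only [weight]
    ring

lemma laplaceI_nonneg (t : Serving) (s r : ℝ) : 0 ≤ p.laplaceI t s r :=
  mul_nonneg (mul_nonneg (expNeg_nonneg _) (expNeg_nonneg _)) (expNeg_nonneg _)

lemma laplace_nonneg (t : Serving) (s r : ℝ) : 0 ≤ p.laplace t s r :=
  mul_nonneg (Real.exp_pos _).le (p.laplaceI_nonneg t s r)

end NetParams

/-! ### Laplace transform of interference and noise on void events -/

section Laplace

variable {Ω ι : Type*} [MeasurableSpace Ω] [Countable ι] {P : Measure Ω} {Y : ι → Ω → State}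
  {p : NetParams}

/-- Interference and noise. -/
def interferenceNoise (p : NetParams) (Y : ι → Ω → State) (ω : Ω) : ℝ≥0∞ :=
  ∑' b, p.rx (Y b ω) + ENNReal.ofReal p.noise

lemma measurable_interferenceNoise (hY : ∀ b, Measurable (Y b)) :
    Measurable (interferenceNoise p Y) :=
  (Measurable.tsum fun b => p.measurable_rx.comp (hY b)).add measurable_const

/-- Laplace transform of interference and noise on the event that there is no transmitter below
the lower limits. -/
theorem setLIntegral_eexp_interferenceNoise (hL : HasPoissonLaplace P Y p.intensity offState)
    (hY : ∀ b, Measurable (Y b)) {t : Serving} {r : ℝ} (hr : 0 ≤ r) {u : State → ℝ≥0∞}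
    (hu : Measurable u) (hu0 : u offState = 0) {c : ℝ≥0∞}
    (huL : ∀ q, q ≠ .off → ∀ z, 0 < z → z ≠ p.lower t r q → ∀ g,
      (u (q, z, g) ≤ c ↔ p.lower t r q < z)) {s : ℝ} (hs : 0 < s) :
    ∫⁻ ω in {ω | ⨆ b, u (Y b ω) ≤ c}, eexp (ENNReal.ofReal s * interferenceNoise p Y ω) ∂P =
      ENNReal.ofReal (p.voidAll (p.lower t r) * p.laplace t s r) := by
  have hmS : MeasurableSet {ω | ⨆ b, u (Y b ω) ≤ c} :=
    measurableSet_le (Measurable.iSup fun b => hu.comp (hY b)) measurable_const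
  set ψ : State → ℝ≥0∞ := fun y => (if u y ≤ c then 0 else ⊤) + ENNReal.ofReal s * p.rx y with hψ
  have hmψ : Measurable ψ :=
    (Measurable.ite (measurableSet_le hu measurable_const) measurable_const
        measurable_const).add (by fun_prop)
  have h1 := hL ψ hmψ (by simp [hψ, hu0])
  have hlow := p.lower_nonneg t hr
  rw [NetParams.lintegral_intensity,
    p.lintegral_intensityOf_laplace (hlow .los) hu (huL .los (fun h => nomatch h)) hs.le,
    p.lintegral_intensityOf_laplace (hlow .nlos) hu (huL .nlos (fun h => nomatch h)) hs.le,
    p.lintegral_intensityOf_laplace (hlow .tbs) hu (huL .tbs (fun h => nomatch h)) hs.le] at h1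
  have hvn (q : Link) : 0 ≤ ∫ z in (0 : ℝ)..p.lower t r q, p.weight q z :=
    intervalIntegral.integral_nonneg (hlow q) fun z hz => p.weight_nonneg q hz.1
  have h2 (ω : Ω) : ({ω | ⨆ b, u (Y b ω) ≤ c}).indicator
      (fun ω => eexp (ENNReal.ofReal s * interferenceNoise p Y ω)) ω =
      eexp (ENNReal.ofReal (s * p.noise)) * eexp (∑' b, ψ (Y b ω)) := by
    have h3 := eexp_tsum_threshold (fun b => u (Y b ω))
      (fun b => ENNReal.ofReal s * p.rx (Y b ω)) c 1
    simp only [Nat.cast_one, one_mul, pow_one] at h3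
    rw [h3]
    by_cases hω : ⨆ b, u (Y b ω) ≤ c
    · rw [indicator_of_mem (by exact hω), if_pos hω, interferenceNoise, mul_add, eexp_add,
        ENNReal.tsum_mul_left, ENNReal.ofReal_mul hs.le, mul_comm]
    · rw [indicator_of_notMem (by exact hω), if_neg hω, mul_zero]
  rw [← lintegral_indicator hmS]
  simp_rw [h2]
  have hme : Measurable fun ω => eexp (∑' b, ψ (Y b ω)) :=
    measurable_eexp.comp (Measurable.tsum fun b => hmψ.comp (hY b))
  rw [lintegral_const_mul _ hme, h1,
    NetParams.laplace, ENNReal.ofReal_mul (p.voidAll_pos _).le,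
    ENNReal.ofReal_mul (Real.exp_pos _).le, p.laplaceI_eq t hs.le hr, NetParams.voidAll,
    ENNReal.ofReal_mul (mul_nonneg (Real.exp_pos _).le (Real.exp_pos _).le),
    ENNReal.ofReal_mul (Real.exp_pos _).le,
    ← eexp_ofReal (hvn _), ← eexp_ofReal (hvn _), ← eexp_ofReal (hvn _),
    ← eexp_ofReal (mul_nonneg hs.le p.noise_nonneg), eexp_add, eexp_add, eexp_add, eexp_add,
    eexp_add]
  ring

/-- The Laplace transforms are smooth. -/
theorem contDiffOn_laplace [IsProbabilityMeasure P]
    (hL : HasPoissonLaplace P Y p.intensity offState)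
    (hY : ∀ b, Measurable (Y b)) (t : Serving) {r : ℝ} (hr : 0 ≤ r) {n : WithTop ℕ∞} :
    ContDiffOn ℝ n (fun s => p.laplace t s r) (Ioi 0) := by
  classical
  -- Any function that flags the states below the lower limits would do. This one works for every
  -- serving case and every `r ≥ 0`, without reference to a serving power; the positive void factor
  -- is divided out at the end.
  set u : State → ℝ≥0∞ := fun y =>
    if y.1 ≠ .off ∧ y.2.1 < p.lower t r y.1 then 1 else 0 with hu
  have hum : Measurable u := NetParams.measurable_state_of fun q => by
    by_cases hq : q = .off
    · simp [hu, hq]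
    · simp only [hu, ne_eq, hq, not_false_eq_true, true_and]
      exact Measurable.ite (measurableSet_lt measurable_fst measurable_const) measurable_const
        measurable_const
  have key := fun s (hs : 0 < s) => setLIntegral_eexp_interferenceNoise hL hY hr hum
    (by simp [hu, offState]) (t := t) (c := 0) (fun q hq z hz hzL g => by
      simp only [hu, ne_eq, hq, not_false_eq_true, true_and]
      by_cases h : z < p.lower t r q
      · simp [h, h.le]
      · simp [h, lt_of_le_of_ne (not_lt.1 h) hzL.symm]) (s := s) hs
  have hv := p.voidAll_pos (p.lower t r)
  have h := contDiffOn_of_laplace (measurable_interferenceNoise (p := p) hY)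
    (Φ := fun s => p.voidAll (p.lower t r) * p.laplace t s r) (fun s hs => (key s hs).symm)
    (fun s _ => mul_nonneg hv.le (p.laplace_nonneg t s r)) (n := n)
  refine (contDiffOn_const.mul h : ContDiffOn ℝ n (fun s => (p.voidAll (p.lower t r))⁻¹ *
    (p.voidAll (p.lower t r) * p.laplace t s r)) (Ioi 0)).congr fun s _ => ?_
  rw [inv_mul_cancel_left₀ hv.ne']

/-- Probability that there is no transmitter below the lower limits and that a unit of fading
carries over interference and noise. -/
theorem setLIntegral_erlangTail [IsProbabilityMeasure P]
    (hL : HasPoissonLaplace P Y p.intensity offState)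
    (hY : ∀ b, Measurable (Y b)) {t : Serving} {r : ℝ} (hr : 0 ≤ r) {u : State → ℝ≥0∞}
    (hu : Measurable u) (hu0 : u offState = 0) {c : ℝ≥0∞}
    (huL : ∀ q, q ≠ .off → ∀ z, 0 < z → z ≠ p.lower t r q → ∀ g,
      (u (q, z, g) ≤ c ↔ p.lower t r q < z)) {m : ℕ} (hm : 0 < m) {g : ℝ} (hg : 0 < g) :
    0 ≤ p.derivSum t m g r ∧
    ∫⁻ ω in {ω | ⨆ b, u (Y b ω) ≤ c},
        erlangTail m (ENNReal.ofReal (m * g) * interferenceNoise p Y ω) ∂P =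
      ENNReal.ofReal (p.voidAll (p.lower t r) * p.derivSum t m g r) := by
  have hv := p.voidAll_pos (p.lower t r)
  have hmg : 0 < m * g := mul_pos (by exact_mod_cast hm) hg
  have h := lintegral_erlangTail (measurable_interferenceNoise (p := p) hY)
    (Φ := fun s => p.voidAll (p.lower t r) * p.laplace t s r)
    (fun s hs => (setLIntegral_eexp_interferenceNoise hL hY hr hu hu0 huL hs).symm)
    (fun s _ => mul_nonneg hv.le (p.laplace_nonneg t s r)) m hmg
  have hd (k : ℕ) : iteratedDeriv k (fun s => p.voidAll (p.lower t r) * p.laplace t s r) (m * g) =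
      p.voidAll (p.lower t r) * iteratedDeriv k (fun s => p.laplace t s r) (m * g) := by
    rw [iteratedDeriv_const_mul]
    exact (contDiffOn_laplace hL hY t hr).contDiffAt (Ioi_mem_nhds hmg)
  have hs : ∑ k ∈ Finset.range m, (-(m * g)) ^ k / (k.factorial : ℝ) *
      iteratedDeriv k (fun s => p.voidAll (p.lower t r) * p.laplace t s r) (m * g) =
      p.voidAll (p.lower t r) * p.derivSum t m g r := by
    rw [NetParams.derivSum, Finset.mul_sum]
    refine Finset.sum_congr rfl fun k _ => ?_
    rw [hd]
    ring
  rw [hs] at h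
  exact ⟨nonneg_of_mul_nonneg_right h.1 hv, h.2⟩

end Laplace

/-! ### Service and coverage of a Poisson process of transmitters -/

namespace NetParams

variable (p : NetParams)

/-- Solving the comparison of two average powers for the distance `x` produces the constants and
exponents in `dN`, `dL`, `dLT`, `dNT`, `dTL` and `dTN`. -/
lemma mul_rpow_neg_le_iff {a b α β x y : ℝ} (ha : 0 < a) (hb : 0 < b) (hα : 0 < α)
    (hx : 0 < x) (hy : 0 < y) :
    a * x ^ (-α) ≤ b * y ^ (-β) ↔ (a / b) ^ (1 / α) * y ^ (β / α) ≤ x := by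
  have hK : 0 ≤ (a / b) ^ (1 / α) * y ^ (β / α) := by positivity
  have hKα : ((a / b) ^ (1 / α) * y ^ (β / α)) ^ α = a / b * y ^ β := by
    rw [Real.mul_rpow (by positivity) (by positivity), ← Real.rpow_mul (by positivity),
      ← Real.rpow_mul hy.le, div_mul_cancel₀ _ hα.ne', div_mul_cancel₀ _ hα.ne', Real.rpow_one]
  have hxα := Real.rpow_pos_of_pos hx α
  have hyβ := Real.rpow_pos_of_pos hy β
  rw [← Real.rpow_le_rpow_iff hK hx.le hα, hKα, Real.rpow_neg hx.le, Real.rpow_neg hy.le,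
    ← div_eq_mul_inv, ← div_eq_mul_inv, div_le_div_iff₀ hxα hyβ, div_mul_eq_mul_div,
    div_le_iff₀ hb, mul_comm b]

/-- A UAV is never nearer than `h`, so a bound `K` on its distance may be replaced by `max h K`.
This is the origin of the maxima in the auxiliary functions, and it keeps the radicand nonnegative.
-/
lemma le_sqrt_add_iff {h K z : ℝ} (hh : 0 < h) (hz : 0 < z) :
    K ≤ √(z ^ 2 + h ^ 2) ↔ √(max h K ^ 2 - h ^ 2) ≤ z := by
  have h1 : h ≤ √(z ^ 2 + h ^ 2) := Real.le_sqrt_of_sq_le (by nlinarith)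
  have h2 : 0 ≤ max h K := hh.le.trans (le_max_left _ _)
  rw [Real.sqrt_le_left hz.le, sub_le_iff_le_add, ← Real.le_sqrt h2 (by positivity), max_le_iff]
  exact ⟨fun h => ⟨h1, h⟩, fun h => h.2⟩

/-- The serving case that belongs to a kind of link. -/
def servingOf : Link → Serving
  | .off => .cluster
  | .los => .los
  | .nlos => .nlos
  | .tbs => .tbs

lemma le_slant {z : ℝ} : p.h ≤ √(z ^ 2 + p.h ^ 2) := Real.le_sqrt_of_sq_le (by nlinarith)

/-- The average received power falls below that of the serving transmitter exactly beyond the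
lower limit. -/
lemma meanPower_le_iff {q q' : Link} (hq : q ≠ .off) (hq' : q' ≠ .off) {z z' : ℝ} (hz : 0 < z)
    (hz' : 0 < z') (hne : z' ≠ p.lower (servingOf q) (p.slant q z) q') :
    p.meanPower q' z' ≤ p.meanPower q z ↔ p.lower (servingOf q) (p.slant q z) q' < z' := by
  have hh := p.h_pos
  have hL := p.alphaL_pos.ne'
  have hN := p.alphaN_pos.ne'
  have hT := p.alphaT_pos.ne'
  have hU := p.rhoU_pos.ne'
  have h1 := p.etaL_pos
  have h2 := p.etaN_pos
  have h3 := p.rhoU_pos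
  have h4 := p.rhoT_pos
  rw [meanPower, meanPower, mul_rpow_neg_le_iff (p.coef_pos hq') (p.coef_pos hq) (p.expo_pos q')
    (p.slant_pos q' hz') (p.slant_pos q hz), ← (hne.symm).le_iff_lt]
  have hs : max p.h (√(z ^ 2 + p.h ^ 2)) = √(z ^ 2 + p.h ^ 2) := max_eq_right p.le_slant
  cases q <;> cases q' <;> first | exact absurd rfl hq | exact absurd rfl hq' | skip
  all_goals
    simp only [slant, lower, lowerL, lowerN, lowerT, servingOf, coef, expo]
  · rw [le_sqrt_add_iff hh hz', div_self (by positivity), div_self hL, Real.one_rpow,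
      Real.rpow_one, one_mul, hs]
  · rw [le_sqrt_add_iff hh hz', mul_div_mul_right _ _ hU, dN, max_comm]
  · rw [dLT, mul_comm p.etaL]
  · rw [le_sqrt_add_iff hh hz', mul_div_mul_right _ _ hU, dL]
  · rw [le_sqrt_add_iff hh hz', div_self (by positivity), div_self hN, Real.one_rpow,
      Real.rpow_one, one_mul, hs]
  · rw [dNT, mul_comm p.etaN]
  · rw [le_sqrt_add_iff hh hz', dTL, mul_comm p.etaL]
  · rw [le_sqrt_add_iff hh hz', dTN, mul_comm p.etaN]
  · rw [div_self (by positivity), div_self hT, Real.one_rpow, Real.rpow_one, one_mul]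

lemma meanPower_injOn {q : Link} (hq : q ≠ .off) : InjOn (p.meanPower q) (Ioi 0) := by
  intro z hz z' hz' h
  have hc := p.coef_pos hq
  have key {x y : ℝ} (hx : 0 < x) (hy : 0 < y) (hxy : p.meanPower q x ≤ p.meanPower q y) :
      p.slant q y ≤ p.slant q x := by
    have := (mul_rpow_neg_le_iff hc hc (p.expo_pos q) (p.slant_pos q hx) (p.slant_pos q hy)).1 hxy
    rwa [div_self hc.ne', div_self (p.expo_pos q).ne', Real.one_rpow, Real.rpow_one,
      one_mul] at this
  have hs := le_antisymm (key hz' hz h.ge) (key hz hz' h.le)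
  have hsq (hs : √(z ^ 2 + p.h ^ 2) = √(z' ^ 2 + p.h ^ 2)) : z = z' := by
    rw [Real.sqrt_inj (by positivity) (by positivity)] at hs
    exact (pow_left_inj₀ (le_of_lt hz) (le_of_lt hz') two_ne_zero).1 (by linarith)
  cases q
  · exact absurd rfl hq
  · exact hsq hs
  · exact hsq hs
  · exact hs

lemma gain_Iic_zero (q : Link) : p.gain q (Iic 0) = 0 := by
  have hm : (0 : ℝ) < p.shape q := by exact_mod_cast p.shape_pos q
  have h1 : p.gain q (Ici 0) = 1 := by
    rw [gain, gammaMeasure_Ici (p.shape_pos q) hm le_rfl]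
    obtain ⟨n, hn⟩ := Nat.exists_eq_succ_of_ne_zero (p.shape_pos q).ne'
    rw [hn, Finset.sum_range_succ']
    simp
  have h2 : p.gain q (Iio 0) = 0 := by
    rw [← compl_Ici]
    exact (prob_compl_eq_zero_iff measurableSet_Ici).2 h1
  have h3 : p.gain q {0} = 0 := by
    rw [gain, gammaMeasure]
    exact withDensity_absolutelyContinuous _ _ (by simp)
  have : Iic (0 : ℝ) = Iio 0 ∪ {0} := by simp
  rw [this]
  exact measure_union_null h2 h3

lemma ae_gain_pos (q : Link) : ∀ᵐ g ∂p.gain q, 0 < g := by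
  rw [ae_iff]
  convert p.gain_Iic_zero q using 2
  ext
  simp

/-- Sets of states that are null for each horizontal distance and kind. -/
lemma intensity_eq_zero {A : Set State} (hA : MeasurableSet A)
    (h : ∀ q, q ≠ .off → ∀ᵐ z ∂volume.restrict (Ioi 0), ∀ᵐ g ∂p.gain q, (q, z, g) ∉ A) :
    p.intensity A = 0 := by
  have key (q) (hq : q ≠ .off) : p.intensityOf q A = 0 := by
    rw [← lintegral_indicator_one hA, p.lintegral_intensityOf q (measurable_one.indicator hA)]
    refine (lintegral_congr_ae ?_).trans lintegral_zero
    filter_upwards [h q hq] with z hz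
    have : ∫⁻ g, A.indicator (1 : State → ℝ≥0∞) (q, z, g) ∂p.gain q = 0 := by
      refine (lintegral_congr_ae ?_).trans lintegral_zero
      filter_upwards [hz] with g hg
      simp [hg]
    rw [this, mul_zero]
  simp only [intensity, Measure.add_apply]
  rw [key .los (fun h => nomatch h), key .nlos (fun h => nomatch h), key .tbs (fun h => nomatch h)]
  simp

lemma avg_off (x : ℝ × ℝ) : p.avg (.off, x) = 0 := by simp [avg, meanPower, coef]

end NetParams

/-! ### Absence of ties and Mecke's formula for the serving transmitter -/

section Serve

variable {Ω ι : Type*} [MeasurableSpace Ω] [Countable ι] [DecidableEq ι] {P : Measure Ω}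
  [IsProbabilityMeasure P] {Y : ι → Ω → State} {p : NetParams}

/-- Almost surely, all transmitters that are on the air are received with positive power. -/
lemma ae_rx_pos (hL : HasPoissonLaplace P Y p.intensity offState) (hY : ∀ b, Measurable (Y b)) :
    ∀ᵐ ω ∂P, ∀ b, (Y b ω).1 ≠ .off → p.rx (Y b ω) ≠ 0 ∧ p.avg (Y b ω) ≠ 0 := by
  set A : Set State := {y | y.1 ≠ .off ∧ (p.rx y = 0 ∨ p.avg y = 0)} with hA
  have mA : MeasurableSet A :=
    (measurable_fst (measurableSet_singleton Link.off).compl).inter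
      ((p.measurable_rx (measurableSet_singleton 0)).union
        (p.measurable_avg (measurableSet_singleton 0)))
  -- With trivial supremum and sum, Mecke's formula says that the expected number of exceptional
  -- transmitters is the intensity of the exceptional set.
  have hF := hL.mecke hY p.intensity_offState measurable_const rfl measurable_const rfl
    (a := fun _ => 0) (r := fun _ => 0) (F := fun x => A.indicator 1 x.1)
    ((measurable_one.indicator mA).comp measurable_fst) (by simp [hA, offState])
  have h0 : p.intensity A = 0 := by
    refine p.intensity_eq_zero mA fun q hq => ?_
    refine (ae_restrict_iff' measurableSet_Ioi).2 (ae_of_all _ fun z hz => ?_)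
    have hmp := p.meanPower_pos hq hz
    filter_upwards [p.ae_gain_pos q] with g hg
    simp only [hA, mem_ofPred_eq, NetParams.rx, NetParams.avg, ENNReal.ofReal_eq_zero]
    rintro ⟨-, h | h⟩
    · exact absurd h (not_le.2 (mul_pos hmp hg))
    · exact absurd h (not_le.2 hmp)
  simp only [lintegral_const, measure_univ, mul_one] at hF
  rw [lintegral_indicator_one mA, h0, ENNReal.tsum_eq_zero] at hF
  refine ae_all_iff.2 fun b => ?_
  have hb := (lintegral_eq_zero_iff ((measurable_one.indicator mA).comp (hY b))).1 (hF b)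
  filter_upwards [hb] with ω hω hoff
  by_contra hcon
  have : Y b ω ∈ A := ⟨hoff, by tauto⟩
  simp [this] at hω

/-- Almost surely, no two transmitters have the same average received power. -/
lemma ae_avg_ne (hL : HasPoissonLaplace P Y p.intensity offState) (hY : ∀ b, Measurable (Y b)) :
    ∀ᵐ ω ∂P, ∀ b, p.avg (Y b ω) ≠ 0 →
      (⨆ j, if j = b then 0 else p.avg (Y j ω)) ≠ p.avg (Y b ω) := by
  set A : Set (State × ℝ≥0∞ × ℝ≥0∞) := {x | p.avg x.1 ≠ 0 ∧ x.2.1 = p.avg x.1} with hA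
  have ma : Measurable fun x : State × ℝ≥0∞ × ℝ≥0∞ => p.avg x.1 :=
    p.measurable_avg.comp measurable_fst
  have mA : MeasurableSet A :=
    (ma (measurableSet_singleton 0).compl).inter (measurableSet_eq_fun (by fun_prop) ma)
  have hF := hL.mecke hY p.intensity_offState p.measurable_avg (by simp) measurable_const rfl
    (r := fun _ => 0) (F := A.indicator 1) (measurable_one.indicator mA) (by simp [hA])
  have h0 : ∫⁻ y, ∫⁻ ω, A.indicator (1 : State × ℝ≥0∞ × ℝ≥0∞ → ℝ≥0∞)
      (y, ⨆ j, p.avg (Y j ω), ∑' j : ι, 0) ∂P ∂p.intensity = 0 := by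
    have mV : Measurable fun ω => ⨆ j, p.avg (Y j ω) :=
      Measurable.iSup fun j => p.measurable_avg.comp (hY j)
    -- After Mecke's formula the new point is independent of the maximum of the others. For fixed
    -- `ω` and each kind, at most one distance attains this maximum, a null set for the intensity.
    rw [lintegral_lintegral_swap]
    · refine (lintegral_congr fun ω => ?_).trans lintegral_zero
      have mB : Measurable fun y : State => (y, ⨆ j, p.avg (Y j ω), ∑' j : ι, (0 : ℝ≥0∞)) := by
        fun_prop
      have : ∫⁻ y, A.indicator (1 : State × ℝ≥0∞ × ℝ≥0∞ → ℝ≥0∞)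
          (y, ⨆ j, p.avg (Y j ω), ∑' j : ι, 0) ∂p.intensity =
          p.intensity ((fun y : State => (y, ⨆ j, p.avg (Y j ω), ∑' j : ι, (0 : ℝ≥0∞))) ⁻¹' A) := by
        rw [← lintegral_indicator_one (mB mA)]
        rfl
      rw [this]
      refine p.intensity_eq_zero (mB mA) fun q hq => ?_
      have hsub : {z : ℝ | 0 < z ∧ p.avg (q, z, 0) = ⨆ j, p.avg (Y j ω)}.Subsingleton := by
        intro z hz z' hz'
        refine p.meanPower_injOn hq hz.1 hz'.1 ?_
        have := hz.2.trans hz'.2.symm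
        simp only [NetParams.avg] at this
        rwa [ENNReal.ofReal_eq_ofReal_iff (p.meanPower_nonneg q hz.1.le)
          (p.meanPower_nonneg q hz'.1.le)] at this
      have hnull : ∀ᵐ z : ℝ, z ∉ {z : ℝ | 0 < z ∧ p.avg (q, z, 0) = ⨆ j, p.avg (Y j ω)} :=
        measure_eq_zero_iff_ae_notMem.1 (hsub.measure_zero _)
      refine (ae_restrict_iff' measurableSet_Ioi).2 ?_
      filter_upwards [hnull] with z hz hz0
      refine ae_of_all _ fun g hg => hz ⟨hz0, ?_⟩
      exact hg.2.symm
    · exact ((measurable_one.indicator mA).comp (measurable_fst.prodMk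
        ((mV.comp measurable_snd).prodMk measurable_const))).aemeasurable
  rw [h0, ENNReal.tsum_eq_zero] at hF
  refine ae_all_iff.2 fun b => ?_
  have mb : Measurable fun ω => (Y b ω, (⨆ j, if j = b then 0 else p.avg (Y j ω)),
      ∑' j, if j = b then (0 : ℝ≥0∞) else 0) := by
    refine (hY b).prodMk (Measurable.prodMk (Measurable.iSup fun j => ?_) measurable_const)
    split_ifs
    · exact measurable_const
    · exact p.measurable_avg.comp (hY j)
  have hb := (lintegral_eq_zero_iff ((measurable_one.indicator mA).comp mb)).1 (hF b)
  filter_upwards [hb] with ω hω hav heq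
  have : (Y b ω, (⨆ j, if j = b then 0 else p.avg (Y j ω)),
      ∑' j, if j = b then (0 : ℝ≥0∞) else 0) ∈ A := ⟨hav, heq⟩
  simp only [Function.comp_apply, indicator_of_mem this] at hω
  simp at hω

/-- Transmitter `b` has the largest average received power, its link is of kind `q`, and it
covers the user. -/
def Wins (p : NetParams) (Y : ι → Ω → State) (q : Link) (b : ι) (ω : Ω) : Prop :=
  (Y b ω).1 = q ∧ (∀ j, j ≠ b → (Y j ω).1 ≠ .off → p.avg (Y j ω) < p.avg (Y b ω)) ∧
    ENNReal.ofReal p.gam ≤ p.rx (Y b ω) /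
      (∑' j, (if j = b then 0 else p.rx (Y j ω)) + ENNReal.ofReal p.noise)

/-- The same event up to null sets, in terms of the largest average power and the total power of
the other transmitters. -/
def winSet (p : NetParams) (q : Link) : Set (State × ℝ≥0∞ × ℝ≥0∞) :=
  {x | x.1.1 = q ∧ x.2.1 ≤ p.avg x.1 ∧
    ENNReal.ofReal p.gam * (x.2.2 + ENNReal.ofReal p.noise) ≤ p.rx x.1}

lemma measurableSet_winSet (q : Link) : MeasurableSet (winSet p q) := by
  have ma : Measurable fun x : State × ℝ≥0∞ × ℝ≥0∞ => p.avg x.1 :=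
    p.measurable_avg.comp measurable_fst
  have mr : Measurable fun x : State × ℝ≥0∞ × ℝ≥0∞ => p.rx x.1 :=
    p.measurable_rx.comp measurable_fst
  have mq : Measurable fun x : State × ℝ≥0∞ × ℝ≥0∞ => x.1.1 := by fun_prop
  exact (mq (measurableSet_singleton q)).inter
    ((measurableSet_le (by fun_prop) ma).inter (measurableSet_le (by fun_prop) mr))

/-- Absence of ties makes strict and weak maximality agree, and transmitters that are off do not
affect the supremum. Positive received power allows the quotient to be cleared even when the
denominator vanishes. -/
lemma ae_wins_iff (hL : HasPoissonLaplace P Y p.intensity offState) (hY : ∀ b, Measurable (Y b))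
    {q : Link} (hq : q ≠ .off) : ∀ᵐ ω ∂P, ∀ b, Wins p Y q b ω ↔
      (Y b ω, (⨆ j, if j = b then 0 else p.avg (Y j ω)),
        ∑' j, if j = b then 0 else p.rx (Y j ω)) ∈ winSet p q := by
  filter_upwards [ae_rx_pos hL hY, ae_avg_ne hL hY] with ω h1 h2 b
  simp only [Wins, winSet, mem_ofPred_eq]
  refine and_congr_right fun hb => ?_
  have hoff : (Y b ω).1 ≠ .off := hb ▸ hq
  obtain ⟨hr, ha⟩ := h1 b hoff
  rw [ENNReal.le_div_iff_mul_le (Or.inr hr) (Or.inr ENNReal.ofReal_ne_top)]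
  refine and_congr_left fun _ => ⟨fun h => iSup_le fun j => ?_, fun h j hj _ => ?_⟩
  · by_cases hj : j = b
    · simp [hj]
    · by_cases hjo : (Y j ω).1 = .off
      · have : p.avg (Y j ω) = 0 := by
          rw [← p.avg_off (Y j ω).2, ← hjo]
        simp [this]
      · simpa [hj] using (h j hj hjo).le
  · refine lt_of_le_of_lt ?_ (lt_of_le_of_ne h (h2 b ha))
    refine le_trans ?_ (le_iSup _ j)
    simp [hj]

omit [MeasurableSpace Ω] [Countable ι] in
-- Two winners would each be strictly stronger than the other. Hence the winning events are disjoint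
-- and their probabilities add up to that of the union.
lemma Wins.eq {q : Link} (hq : q ≠ .off) {b c : ι} {ω : Ω} (hb : Wins p Y q b ω)
    (hc : Wins p Y q c ω) : b = c := by
  by_contra h
  exact lt_asymm (hb.2.1 c (Ne.symm h) (hc.1 ▸ hq)) (hc.2.1 b h (hb.1 ▸ hq))

/-- Probability that the user is served and covered by a transmitter of kind `q`. -/
theorem measure_wins (hL : HasPoissonLaplace P Y p.intensity offState)
    (hY : ∀ b, Measurable (Y b)) {q : Link} (hq : q ≠ .off) :
    P {ω | ∃ b, Wins p Y q b ω} = ∫⁻ z in Ioi (0 : ℝ), ENNReal.ofReal (p.weight q z) *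
      ∫⁻ ω in {ω | ⨆ b, p.avg (Y b ω) ≤ ENNReal.ofReal (p.meanPower q z)},
        erlangTail (p.shape q) (ENNReal.ofReal (p.shape q * (p.gam / p.meanPower q z)) *
          interferenceNoise p Y ω) ∂P := by
  set T : ι → Ω → State × ℝ≥0∞ × ℝ≥0∞ := fun b ω => (Y b ω,
    (⨆ j, if j = b then 0 else p.avg (Y j ω)), ∑' j, if j = b then 0 else p.rx (Y j ω)) with hT
  have mT (b : ι) : Measurable (T b) := by
    refine (hY b).prodMk (Measurable.prodMk (Measurable.iSup fun j => ?_)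
      (Measurable.tsum fun j => ?_))
    · split_ifs
      exacts [measurable_const, p.measurable_avg.comp (hY j)]
    · split_ifs
      exacts [measurable_const, p.measurable_rx.comp (hY j)]
  have mW := measurableSet_winSet (p := p) q
  have hae := ae_wins_iff hL hY hq
  have e1 : P {ω | ∃ b, Wins p Y q b ω} = P (⋃ b, T b ⁻¹' winSet p q) := by
    refine measure_congr ?_
    filter_upwards [hae] with ω hω
    have : ω ∈ {ω | ∃ b, Wins p Y q b ω} ↔ ω ∈ ⋃ b, T b ⁻¹' winSet p q := by
      rw [mem_iUnion]
      exact exists_congr hω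
    exact propext this
  have e2 : P (⋃ b, T b ⁻¹' winSet p q) = ∑' b, P (T b ⁻¹' winSet p q) := by
    refine measure_iUnion₀ (fun b c hbc => ?_) fun b => (mT b mW).nullMeasurableSet
    refine measure_mono_null (fun ω hω => ?_) (ae_iff.1 hae)
    intro hcon
    exact hbc (Wins.eq hq ((hcon b).2 hω.1) ((hcon c).2 hω.2))
  have e3 := hL.mecke hY p.intensity_offState p.measurable_avg (by simp) p.measurable_rx (by simp)
    (F := (winSet p q).indicator 1) (measurable_one.indicator mW)
    (fun x => by simp [winSet, offState, hq.symm])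
  have e4 (b : ι) : ∫⁻ ω, (winSet p q).indicator (1 : State × ℝ≥0∞ × ℝ≥0∞ → ℝ≥0∞) (T b ω) ∂P =
      P (T b ⁻¹' winSet p q) := by
    rw [← lintegral_indicator_one (mT b mW)]
    rfl
  have mV : Measurable fun ω => ⨆ j, p.avg (Y j ω) :=
    Measurable.iSup fun j => p.measurable_avg.comp (hY j)
  have mI : Measurable fun ω => ∑' j, p.rx (Y j ω) :=
    Measurable.tsum fun j => p.measurable_rx.comp (hY j)
  have mH : Measurable (Function.uncurry fun (y : State) (ω : Ω) =>
      (winSet p q).indicator (1 : State × ℝ≥0∞ × ℝ≥0∞ → ℝ≥0∞)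
        (y, ⨆ j, p.avg (Y j ω), ∑' j, p.rx (Y j ω))) :=
    (measurable_one.indicator mW).comp (measurable_fst.prodMk
      ((mV.comp measurable_snd).prodMk (mI.comp measurable_snd)))
  have mHi := mH.lintegral_prod_right (ν := P)
  have hzero (q') (hqq : q' ≠ q) : ∫⁻ y, ∫⁻ ω, (winSet p q).indicator
      (1 : State × ℝ≥0∞ × ℝ≥0∞ → ℝ≥0∞) (y, ⨆ j, p.avg (Y j ω), ∑' j, p.rx (Y j ω)) ∂P
        ∂p.intensityOf q' = 0 := by
    rw [p.lintegral_intensityOf q' mHi]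
    simp [winSet, hqq]
  have hsum : ∫⁻ y, ∫⁻ ω, (winSet p q).indicator
      (1 : State × ℝ≥0∞ × ℝ≥0∞ → ℝ≥0∞) (y, ⨆ j, p.avg (Y j ω), ∑' j, p.rx (Y j ω)) ∂P
        ∂p.intensity = ∫⁻ y, ∫⁻ ω, (winSet p q).indicator
      (1 : State × ℝ≥0∞ × ℝ≥0∞ → ℝ≥0∞) (y, ⨆ j, p.avg (Y j ω), ∑' j, p.rx (Y j ω)) ∂P
        ∂p.intensityOf q := by
    rw [NetParams.lintegral_intensity]
    cases q
    · exact absurd rfl hq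
    · rw [hzero .nlos (fun h => nomatch h), hzero .tbs (fun h => nomatch h), add_zero, add_zero]
    · rw [hzero .los (fun h => nomatch h), hzero .tbs (fun h => nomatch h), add_zero, zero_add]
    · rw [hzero .los (fun h => nomatch h), hzero .nlos (fun h => nomatch h), zero_add, zero_add]
  rw [e1, e2]
  simp_rw [← e4]
  rw [e3, hsum, p.lintegral_intensityOf q mHi]
  refine setLIntegral_congr_fun measurableSet_Ioi fun z (hz : 0 < z) => ?_
  have hmp := p.meanPower_pos hq hz
  congr 1
  -- The gain of the new point is integrated first, with the other transmitters fixed; its gamma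
  -- tail is `erlangTail` of a multiple of interference plus noise.
  rw [lintegral_lintegral_swap]
  · rw [← lintegral_indicator (measurableSet_le mV measurable_const)]
    refine lintegral_congr fun ω => ?_
    have hg := gammaMeasure_setOf_le (p.shape_pos q) p.gam_pos hmp (interferenceNoise p Y ω)
    set G : Set ℝ := {g | ENNReal.ofReal p.gam * interferenceNoise p Y ω ≤
      ENNReal.ofReal (p.meanPower q z * g)} with hG
    have mG : MeasurableSet G := measurableSet_le measurable_const (by fun_prop)
    by_cases hω : ⨆ b, p.avg (Y b ω) ≤ ENNReal.ofReal (p.meanPower q z)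
    · rw [indicator_of_mem (by exact hω), ← hg]
      change _ = p.gain q G
      rw [← lintegral_indicator_one mG]
      refine lintegral_congr fun g => ?_
      have hiff : ((q, z, g), (⨆ j, p.avg (Y j ω)), ∑' j, p.rx (Y j ω)) ∈ winSet p q ↔ g ∈ G :=
        ⟨fun h => h.2.2, fun h => ⟨rfl, hω, h⟩⟩
      by_cases h : g ∈ G
      · rw [indicator_of_mem h, indicator_of_mem (hiff.2 h)]
        rfl
      · rw [indicator_of_notMem h, indicator_of_notMem fun h' => h (hiff.1 h')]
    · rw [indicator_of_notMem (by exact hω)]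
      refine (lintegral_congr fun g => ?_).trans lintegral_zero
      refine indicator_of_notMem (fun h => hω h.2.1) _
  · exact (mH.comp ((measurable_const.prodMk (measurable_const.prodMk measurable_fst)).prodMk
      measurable_snd)).aemeasurable

end Serve

/-! ### Integrals over the distance -/

/-- A real integral out of a finite lower integral. -/
lemma integrableOn_and_integral_eq {X : Type*} [MeasurableSpace X] {μ : Measure X} {s : Set X}
    (hs : MeasurableSet s) {F : X → ℝ} (h0 : ∀ x ∈ s, 0 ≤ F x)
    (hm : AEMeasurable (fun x => ENNReal.ofReal (F x)) (μ.restrict s)) {c : ℝ≥0∞} (hc : c ≠ ⊤)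
    (h : ∫⁻ x in s, ENNReal.ofReal (F x) ∂μ = c) :
    IntegrableOn F s μ ∧ c.toReal = ∫ x in s, F x ∂μ := by
  have hae : 0 ≤ᵐ[μ.restrict s] F := (ae_restrict_iff' hs).2 (ae_of_all _ h0)
  have hF : AEMeasurable F (μ.restrict s) := by
    refine hm.ennreal_toReal.congr ?_
    filter_upwards [hae] with x hx
    exact ENNReal.toReal_ofReal hx
  refine ⟨⟨hF.aestronglyMeasurable, ?_⟩, ?_⟩
  · rw [hasFiniteIntegral_iff_ofReal hae, h]
    exact hc.lt_top
  · rw [integral_eq_lintegral_of_nonneg_ae hae hF.aestronglyMeasurable, h]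

/-- Passing from horizontal to Euclidean distances. -/
lemma integral_slant {h : ℝ} (hh : 0 < h) {s t : Set ℝ} (hs : MeasurableSet s) (hs0 : s ⊆ Ioi 0)
    (hst : (fun z => √(z ^ 2 + h ^ 2)) '' s = t) (G : ℝ → ℝ) {F : ℝ → ℝ}
    (hF : ∀ z ∈ s, F z = z / √(z ^ 2 + h ^ 2) * G (√(z ^ 2 + h ^ 2))) :
    (IntegrableOn G t ↔ IntegrableOn F s) ∧ ∫ r in t, G r = ∫ z in s, F z := by
  have hd (z : ℝ) (_ : z ∈ s) :
      HasDerivWithinAt (fun z => √(z ^ 2 + h ^ 2)) (z / √(z ^ 2 + h ^ 2)) s z := by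
    have h1 : HasDerivAt (fun z : ℝ => z ^ 2 + h ^ 2) (2 * z) z := by
      simpa using (hasDerivAt_pow 2 z).add_const (h ^ 2)
    have h2 := h1.sqrt (by positivity)
    refine h2.hasDerivWithinAt.congr_deriv ?_
    rw [mul_div_mul_left _ _ two_ne_zero]
  have hinj : InjOn (fun z => √(z ^ 2 + h ^ 2)) s := by
    intro x hx y hy hxy
    simp only at hxy
    rw [Real.sqrt_inj (by positivity) (by positivity)] at hxy
    exact (pow_left_inj₀ (le_of_lt (hs0 hx)) (le_of_lt (hs0 hy)) two_ne_zero).1 (by linarith)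
  have hFG : EqOn F (fun z => |z / √(z ^ 2 + h ^ 2)| • G (√(z ^ 2 + h ^ 2))) s := fun z hz => by
    have hz0 : 0 < z := hs0 hz
    simp only [smul_eq_mul]
    rw [hF z hz, abs_of_nonneg (by positivity)]
  rw [← hst, integral_image_eq_integral_abs_deriv_smul hs hd hinj,
    integrableOn_image_iff_integrableOn_abs_deriv_smul hs hd hinj]
  exact ⟨(integrableOn_congr_fun hFG hs).symm, (setIntegral_congr_fun hs hFG).symm⟩

lemma image_slant_Ioi {h : ℝ} (hh : 0 < h) : (fun z => √(z ^ 2 + h ^ 2)) '' Ioi 0 = Ioi h := by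
  ext r
  simp only [mem_image, mem_Ioi]
  constructor
  · rintro ⟨z, hz, rfl⟩
    exact Real.lt_sqrt_of_sq_lt (by nlinarith)
  · intro hr
    have h1 : 0 < r ^ 2 - h ^ 2 := by nlinarith
    refine ⟨√(r ^ 2 - h ^ 2), Real.sqrt_pos.2 h1, ?_⟩
    rw [Real.sq_sqrt h1.le, sub_add_cancel, Real.sqrt_sq (hh.trans hr).le]

lemma image_slant_Ioc {h c : ℝ} (hh : 0 < h) (hc : 0 < c) :
    (fun z => √(z ^ 2 + h ^ 2)) '' Ioc 0 c = Ioc h (√(h ^ 2 + c ^ 2)) := by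
  ext r
  simp only [mem_image, mem_Ioc]
  constructor
  · rintro ⟨z, hz, rfl⟩
    refine ⟨Real.lt_sqrt_of_sq_lt (by nlinarith [hz.1]), Real.sqrt_le_sqrt ?_⟩
    nlinarith [hz.1, hz.2]
  · rintro ⟨hr, hrc⟩
    have h1 : 0 < r ^ 2 - h ^ 2 := by nlinarith
    rw [Real.le_sqrt (hh.trans hr).le (by positivity)] at hrc
    refine ⟨√(r ^ 2 - h ^ 2), ⟨Real.sqrt_pos.2 h1, ?_⟩, ?_⟩
    · rw [Real.sqrt_le_left hc.le]
      linarith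
    · rw [Real.sq_sqrt h1.le, sub_add_cancel, Real.sqrt_sq (hh.trans hr).le]

/-! ### Densities in the horizontal distance and the stated integrands -/

namespace NetParams

variable (p : NetParams)

lemma exp_weight_los (d : ℝ) :
    Real.exp (-∫ z in (0 : ℝ)..√(d ^ 2 - p.h ^ 2), p.weight .los z) = p.voidL d := by
  simp only [weight, voidL, intervalIntegral.integral_const_mul]

lemma exp_weight_nlos (d : ℝ) :
    Real.exp (-∫ z in (0 : ℝ)..√(d ^ 2 - p.h ^ 2), p.weight .nlos z) = p.voidN d := by
  simp only [weight, voidN, intervalIntegral.integral_const_mul]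

lemma exp_weight_tbs (d : ℝ) :
    Real.exp (-∫ z in (0 : ℝ)..d, p.weight .tbs z) = p.voidT d := by
  simp only [weight, voidT]
  rw [intervalIntegral.integral_const_mul, integral_id]
  congr 1
  ring

lemma gl_eq (z : ℝ) : p.gl (p.slant .los z) = p.gam / p.meanPower .los z := by
  have : 0 ≤ p.slant .los z := by unfold slant; positivity
  rw [gl, meanPower, coef, expo, Real.rpow_neg this]
  field_simp

lemma gn_eq (z : ℝ) : p.gn (p.slant .nlos z) = p.gam / p.meanPower .nlos z := by
  have : 0 ≤ p.slant .nlos z := by unfold slant; positivity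
  rw [gn, meanPower, coef, expo, Real.rpow_neg this]
  field_simp

/-- Density of the horizontal distance of a covering transmitter of kind `q`. -/
def winDensity (q : Link) (z : ℝ) : ℝ :=
  p.weight q z * (p.voidAll (p.lower (servingOf q) (p.slant q z)) *
    p.derivSum (servingOf q) (p.shape q) (p.gam / p.meanPower q z) (p.slant q z))

/-- The intensity carries a factor `z` where `densL` carries `r`; the quotient `z / r` is the
Jacobian of `z ↦ √(z² + h²)`. Of the three void factors, the one of the same kind belongs to `densL`
and the other two form `assocL`. -/
lemma winDensity_los {z : ℝ} (hz : 0 < z) : p.winDensity .los z =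
    z / √(z ^ 2 + p.h ^ 2) * p.integrandOtherL (√(z ^ 2 + p.h ^ 2)) := by
  have hr : 0 < √(z ^ 2 + p.h ^ 2) := by positivity
  rw [winDensity, ← gl_eq, integrandOtherL]
  simp only [servingOf, slant, shape, voidAll, lower, lowerL, lowerN, lowerT]
  rw [exp_weight_los, exp_weight_nlos, exp_weight_tbs, assocL, densL, weight]
  field_simp

lemma winDensity_nlos {z : ℝ} (hz : 0 < z) : p.winDensity .nlos z =
    z / √(z ^ 2 + p.h ^ 2) * p.integrandOtherN (√(z ^ 2 + p.h ^ 2)) := by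
  have hr : 0 < √(z ^ 2 + p.h ^ 2) := by positivity
  rw [winDensity, ← gn_eq, integrandOtherN]
  simp only [servingOf, slant, shape, voidAll, lower, lowerL, lowerN, lowerT]
  rw [exp_weight_los, exp_weight_nlos, exp_weight_tbs, assocN, densN, weight]
  field_simp

lemma winDensity_tbs {z : ℝ} (hz : 0 < z) : p.winDensity .tbs z = p.integrandTbs z := by
  have h1 : p.gam / p.meanPower .tbs z = p.gam * p.rhoT⁻¹ * z ^ p.alphaT := by
    rw [meanPower, coef, expo, slant, Real.rpow_neg hz.le]
    field_simp
  have h2 : p.derivSum .tbs 1 (p.gam * p.rhoT⁻¹ * z ^ p.alphaT) z =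
      p.laplace .tbs (p.gam * p.rhoT⁻¹ * z ^ p.alphaT) z := by
    simp [derivSum]
  rw [winDensity, h1, integrandTbs]
  simp only [servingOf, slant, shape, voidAll, lower, lowerL, lowerN, lowerT]
  rw [exp_weight_los, exp_weight_nlos, exp_weight_tbs, assocT, densT, weight, h2, voidT]
  ring

end NetParams

section Serve

variable {Ω ι : Type*} [MeasurableSpace Ω] [Countable ι] [DecidableEq ι] {P : Measure Ω}
  [IsProbabilityMeasure P] {Y : ι → Ω → State} {p : NetParams}

/-- The probability that the user is served and covered by a transmitter of kind `q`, as an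
integral over the horizontal distance. -/
theorem measureReal_wins (hL : HasPoissonLaplace P Y p.intensity offState)
    (hY : ∀ b, Measurable (Y b)) {q : Link} (hq : q ≠ .off) :
    IntegrableOn (p.winDensity q) (Ioi 0) ∧
      P.real {ω | ∃ b, Wins p Y q b ω} = ∫ z in Ioi 0, p.winDensity q z := by
  have mV : Measurable fun ω => ⨆ j, p.avg (Y j ω) :=
    Measurable.iSup fun j => p.measurable_avg.comp (hY j)
  -- The void event is that no average power exceeds that of the server at `z`; `meanPower_le_iff`
  -- translates it into the lower limits of the serving case.
  have hz0 (z : ℝ) (hz : 0 < z) := setLIntegral_erlangTail hL hY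
    (t := NetParams.servingOf q) (r := p.slant q z) (p.slant_nonneg q hz.le) p.measurable_avg
    (by simp) (c := ENNReal.ofReal (p.meanPower q z)) (fun q' hq' z' hz' hne g => by
      rw [← p.meanPower_le_iff hq hq' hz hz' hne, NetParams.avg,
        ENNReal.ofReal_le_ofReal_iff (p.meanPower_nonneg q hz.le)])
    (p.shape_pos q) (div_pos p.gam_pos (p.meanPower_pos hq hz))
  -- Measurability of `winDensity` in `z` is not sought through its derivatives: it is inherited
  -- from this expectation, with which it agrees for `z > 0`.
  have hmeas : Measurable fun z : ℝ => ENNReal.ofReal (p.weight q z) *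
      ∫⁻ ω in {ω | ⨆ b, p.avg (Y b ω) ≤ ENNReal.ofReal (p.meanPower q z)},
        erlangTail (p.shape q) (ENNReal.ofReal (p.shape q * (p.gam / p.meanPower q z)) *
          interferenceNoise p Y ω) ∂P := by
    refine (p.measurable_weight q).ennreal_ofReal.mul ?_
    have hm := p.measurable_meanPower q
    have hJ := measurable_interferenceNoise (p := p) hY
    have e (z : ℝ) : ∫⁻ ω in {ω | ⨆ b, p.avg (Y b ω) ≤ ENNReal.ofReal (p.meanPower q z)},
        erlangTail (p.shape q) (ENNReal.ofReal (p.shape q * (p.gam / p.meanPower q z)) *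
          interferenceNoise p Y ω) ∂P =
        ∫⁻ ω, (if ⨆ b, p.avg (Y b ω) ≤ ENNReal.ofReal (p.meanPower q z) then
          erlangTail (p.shape q) (ENNReal.ofReal (p.shape q * (p.gam / p.meanPower q z)) *
            interferenceNoise p Y ω) else 0) ∂P := by
      rw [← lintegral_indicator (measurableSet_le mV measurable_const)]
      refine lintegral_congr fun ω => ?_
      simp only [indicator, mem_ofPred_eq]
    simp_rw [e]
    refine Measurable.lintegral_prod_right' (f := fun x : ℝ × Ω =>
      if ⨆ b, p.avg (Y b x.2) ≤ ENNReal.ofReal (p.meanPower q x.1) then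
          erlangTail (p.shape q) (ENNReal.ofReal (p.shape q * (p.gam / p.meanPower q x.1)) *
            interferenceNoise p Y x.2) else 0) ?_
    exact Measurable.ite (measurableSet_le (mV.comp measurable_snd) (by fun_prop)) (by fun_prop)
      measurable_const
  have hval (z : ℝ) (hz : 0 < z) : ENNReal.ofReal (p.weight q z) *
      ∫⁻ ω in {ω | ⨆ b, p.avg (Y b ω) ≤ ENNReal.ofReal (p.meanPower q z)},
        erlangTail (p.shape q) (ENNReal.ofReal (p.shape q * (p.gam / p.meanPower q z)) *
          interferenceNoise p Y ω) ∂P = ENNReal.ofReal (p.winDensity q z) := by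
    rw [(hz0 z hz).2, ← ENNReal.ofReal_mul (p.weight_nonneg q hz.le)]
    rfl
  refine integrableOn_and_integral_eq measurableSet_Ioi (fun z hz => ?_) ?_ (measure_ne_top P _) ?_
  · exact mul_nonneg (p.weight_nonneg q (le_of_lt hz))
      (mul_nonneg (p.voidAll_pos _).le (hz0 z hz).1)
  · refine hmeas.aemeasurable.congr ((ae_restrict_iff' measurableSet_Ioi).2 (ae_of_all _ hval))
  · rw [measure_wins hL hY hq]
    exact (setLIntegral_congr_fun measurableSet_Ioi hval).symm

end Serve

/-! ### Coverage when the cluster UAV is unavailable -/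

namespace Inputs

variable {Ω : Type*} {S : Inputs Ω} {p : NetParams}

/-- The transmitters other than the cluster UAV. -/
def toBS : ℕ ⊕ ℕ → BS
  | .inl i => .inl (some i)
  | .inr k => .inr k

lemma toBS_injective : Function.Injective toBS := by
  rintro (i | i) (j | j) h <;> simp_all [toBS]

lemma toBS_ne (b : ℕ ⊕ ℕ) : toBS b ≠ .inl none := by
  cases b <;> simp [toBS]

lemma exists_toBS {c : BS} (hc : c ≠ .inl none) : ∃ b, toBS b = c := by
  rcases c with (_ | i) | k
  · exact absurd rfl hc
  · exact ⟨.inl i, rfl⟩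
  · exact ⟨.inr k, rfl⟩

lemma tsum_bs (f : BS → ℝ≥0∞) : ∑' c, f c = f (.inl none) + ∑' b, f (toBS b) := by
  have h (g : BS → ℝ≥0∞) (hg : g (.inl none) = 0) : ∑' c, g c = ∑' b, g (toBS b) :=
    (toBS_injective.tsum_eq fun c hc => exists_toBS fun h => hc (h ▸ hg)).symm
  rw [ENNReal.tsum_eq_add_tsum_ite (f := f) (.inl none), h _ (if_pos rfl)]
  congr 1
  exact tsum_congr fun b => if_neg (toBS_ne b)

lemma state_off {i : ℕ} {ω : Ω} (h : ¬ S.avail (some i) ω = true) :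
    S.state p (.inl i) ω = offState := by
  simp [state, NetParams.uavState, mark, h]

lemma state_los {i : ℕ} {ω : Ω} (h : S.avail (some i) ω = true) (hl : S.IsLoS p (some i) ω) :
    S.state p (.inl i) ω = (.los, dist (S.uavPos ω i) (S.user ω), S.gL (some i) ω) := by
  exact (if_pos h).trans (if_pos hl)

lemma state_nlos {i : ℕ} {ω : Ω} (h : S.avail (some i) ω = true) (hl : ¬ S.IsLoS p (some i) ω) :
    S.state p (.inl i) ω = (.nlos, dist (S.uavPos ω i) (S.user ω), S.gN (some i) ω) := by
  exact (if_pos h).trans (if_neg hl)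

lemma active_toBS_iff (b : ℕ ⊕ ℕ) (ω : Ω) : S.Active (toBS b) ω ↔ (S.state p b ω).1 ≠ .off := by
  cases b with
  | inl i =>
    simp only [toBS, Active]
    by_cases h1 : S.avail (some i) ω = true
    · by_cases h2 : S.IsLoS p (some i) ω
      · simp [h1, state_los h1 h2]
      · simp [h1, state_nlos h1 h2]
    · simp [h1, state_off h1, offState]
  | inr k => simp [toBS, Active, state]

lemma rx_state (b : ℕ ⊕ ℕ) (ω : Ω) (h : S.Active (toBS b) ω) :
    p.rx (S.state p b ω) = ENNReal.ofReal (S.rxPower p (toBS b) ω) := by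
  cases b with
  | inl i =>
    by_cases h2 : S.IsLoS p (some i) ω
    · simp only [state_los h h2, toBS, rxPower, if_pos h2, NetParams.rx, NetParams.meanPower,
        NetParams.coef, NetParams.slant, NetParams.expo, distUav, uavAt]
      congr 1
      ring
    · simp only [state_nlos h h2, toBS, rxPower, if_neg h2, NetParams.rx, NetParams.meanPower,
        NetParams.coef, NetParams.slant, NetParams.expo, distUav, uavAt]
      congr 1
      ring
  | inr k =>
    simp only [toBS, state, rxPower, NetParams.rx, NetParams.meanPower, NetParams.coef,
      NetParams.slant, NetParams.expo]
    congr 1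
    ring

lemma rx_state_of_not_active (b : ℕ ⊕ ℕ) (ω : Ω) (h : ¬ S.Active (toBS b) ω) :
    p.rx (S.state p b ω) = 0 := by
  rw [active_toBS_iff (p := p), not_not] at h
  simp [NetParams.rx, h, NetParams.meanPower, NetParams.coef]

lemma avg_state (b : ℕ ⊕ ℕ) (ω : Ω) (h : S.Active (toBS b) ω) :
    p.avg (S.state p b ω) = ENNReal.ofReal (S.avgPower p (toBS b) ω) := by
  cases b with
  | inl i =>
    by_cases h2 : S.IsLoS p (some i) ω
    · simp only [state_los h h2, toBS, avgPower, if_pos h2]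
      rfl
    · simp only [state_nlos h h2, toBS, avgPower, if_neg h2]
      rfl
  | inr k => rfl

lemma avgPower_nonneg (c : BS) (ω : Ω) : 0 ≤ S.avgPower p c ω := by
  have h1 := p.etaL_pos
  have h2 := p.etaN_pos
  have h3 := p.rhoU_pos
  have h4 := p.rhoT_pos
  rcases c with i | k
  · simp only [avgPower, distUav]
    split_ifs <;> positivity
  · simp only [avgPower, distTbs]
    positivity

lemma state_inl_eq_los_iff (i : ℕ) (ω : Ω) : (S.state p (.inl i) ω).1 = .los ↔
    S.Active (.inl (some i)) ω ∧ S.IsLoS p (some i) ω := by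
  by_cases h1 : S.avail (some i) ω = true
  · by_cases h2 : S.IsLoS p (some i) ω
    · simp [Active, h1, h2, state_los h1 h2]
    · simp [Active, h1, h2, state_nlos h1 h2]
  · simp [Active, h1, state_off h1, offState]

lemma state_inl_eq_nlos_iff (i : ℕ) (ω : Ω) : (S.state p (.inl i) ω).1 = .nlos ↔
    S.Active (.inl (some i)) ω ∧ ¬ S.IsLoS p (some i) ω := by
  by_cases h1 : S.avail (some i) ω = true
  · by_cases h2 : S.IsLoS p (some i) ω
    · simp [Active, h1, h2, state_los h1 h2]
    · simp [Active, h1, h2, state_nlos h1 h2]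
  · simp [Active, h1, state_off h1, offState]

lemma interference_none (ω : Ω) :
    S.interference p (.inl none) ω = ∑' b, p.rx (S.state p b ω) := by
  classical
  rw [interference, tsum_bs]
  simp only [ne_eq, not_true_eq_false, false_and, if_false, zero_add]
  refine tsum_congr fun b => ?_
  by_cases h : S.Active (toBS b) ω
  · rw [if_pos ⟨toBS_ne b, h⟩, rx_state b ω h]
  · rw [if_neg fun h' => h h'.2, rx_state_of_not_active b ω h]

lemma interference_toBS (b : ℕ ⊕ ℕ) {ω : Ω} (hω : S.avail none ω = false) :
    S.interference p (toBS b) ω = ∑' j, if j = b then 0 else p.rx (S.state p j ω) := by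
  classical
  have h0 : ¬ S.Active (.inl none) ω := by simp [Active, hω]
  rw [interference, tsum_bs, if_neg fun h => h0 h.2, zero_add]
  refine tsum_congr fun j => ?_
  by_cases hj : j = b
  · simp [hj]
  rw [if_neg hj]
  by_cases h : S.Active (toBS j) ω
  · rw [if_pos ⟨fun h => hj (toBS_injective h), h⟩, rx_state j ω h]
  · rw [if_neg fun h' => h h'.2, rx_state_of_not_active j ω h]

/-- Service and coverage by a transmitter other than the cluster UAV. -/
lemma wins_state_iff {q : Link} (hq : q ≠ .off) (b : ℕ ⊕ ℕ) {ω : Ω}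
    (hω : S.avail none ω = false) :
    Wins p (S.state p) q b ω ↔ (S.state p b ω).1 = q ∧ S.Covers p (toBS b) ω := by
  have h0 : ¬ S.Active (.inl none) ω := by simp [Active, hω]
  refine and_congr_right fun hb => ?_
  have hact : S.Active (toBS b) ω := (active_toBS_iff b ω).2 (hb ▸ hq)
  rw [Covers, Serves, sinr, interference_toBS b hω, rx_state b ω hact]
  refine and_congr_left fun _ => ?_
  have hlt (j) (hj : S.Active (toBS j) ω) : p.avg (S.state p j ω) < p.avg (S.state p b ω) ↔
      S.avgPower p (toBS j) ω < S.avgPower p (toBS b) ω := by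
    rw [avg_state j ω hj, avg_state b ω hact,
      ENNReal.ofReal_lt_ofReal_iff_of_nonneg (avgPower_nonneg _ _)]
  constructor
  · refine fun h => ⟨hact, Or.inr ⟨hω, fun c hc hca => ?_⟩⟩
    obtain ⟨j, rfl⟩ := exists_toBS (c := c) (by rintro rfl; exact h0 hca)
    exact (hlt j hca).1 (h j (fun h => hc (h ▸ rfl)) ((active_toBS_iff j ω).1 hca))
  · rintro ⟨-, h | ⟨-, h⟩⟩ j hj hjo
    · exact absurd h (toBS_ne b)
    · have hja := (active_toBS_iff (p := p) j ω).2 hjo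
      exact (hlt j hja).2 (h _ (fun h => hj (toBS_injective h)) hja)

lemma exists_wins_los_iff {ω : Ω} (hω : S.avail none ω = false) :
    (∃ b, Wins p (S.state p) .los b ω) ↔
      ∃ i : ℕ, S.IsLoS p (some i) ω ∧ S.Covers p (.inl (some i)) ω := by
  constructor
  · rintro ⟨i | k, h⟩
    · rw [wins_state_iff (q := .los) (fun h => nomatch h) _ hω, state_inl_eq_los_iff] at h
      exact ⟨i, h.1.2, h.2⟩
    · exact absurd h.1 (fun h => nomatch h)
  · rintro ⟨i, h1, h2⟩
    refine ⟨.inl i, ?_⟩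
    rw [wins_state_iff (q := .los) (fun h => nomatch h) _ hω, state_inl_eq_los_iff]
    exact ⟨⟨h2.1.1, h1⟩, h2⟩

lemma exists_wins_nlos_iff {ω : Ω} (hω : S.avail none ω = false) :
    (∃ b, Wins p (S.state p) .nlos b ω) ↔
      ∃ i : ℕ, ¬ S.IsLoS p (some i) ω ∧ S.Covers p (.inl (some i)) ω := by
  constructor
  · rintro ⟨i | k, h⟩
    · rw [wins_state_iff (q := .nlos) (fun h => nomatch h) _ hω, state_inl_eq_nlos_iff] at h
      exact ⟨i, h.1.2, h.2⟩
    · exact absurd h.1 (fun h => nomatch h)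
  · rintro ⟨i, h1, h2⟩
    refine ⟨.inl i, ?_⟩
    rw [wins_state_iff (q := .nlos) (fun h => nomatch h) _ hω, state_inl_eq_nlos_iff]
    exact ⟨⟨h2.1.1, h1⟩, h2⟩

lemma exists_wins_tbs_iff {ω : Ω} (hω : S.avail none ω = false) :
    (∃ b, Wins p (S.state p) .tbs b ω) ↔ ∃ k : ℕ, S.Covers p (.inr k) ω := by
  constructor
  · rintro ⟨i | k, h⟩
    · have h1 := h.1
      simp only [state, NetParams.uavState] at h1
      split_ifs at h1
      exact nomatch h1
    · rw [wins_state_iff (q := .tbs) (fun h => nomatch h) _ hω] at h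
      exact ⟨k, h.2⟩
  · rintro ⟨k, h⟩
    refine ⟨.inr k, ?_⟩
    rw [wins_state_iff (q := .tbs) (fun h => nomatch h) _ hω]
    exact ⟨rfl, h⟩

namespace IsModel

variable [MeasurableSpace Ω] {P : Measure Ω} [IsProbabilityMeasure P]

/-- Given the user and the cluster UAV, the other transmitters are a Poisson process. -/
theorem hasPoissonLaplace_cond (hS : S.IsModel p P) {B : Set (Plane × Bool × ℝ × ℝ × ℝ)}
    (hB : MeasurableSet B) (hPB : P (S.center ⁻¹' B) ≠ 0) :
    HasPoissonLaplace (P[|S.center ⁻¹' B]) (S.state p) p.intensity offState := by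
  intro ψ hψ hψ0
  rw [ProbabilityTheory.cond, lintegral_smul_measure, hS.setLIntegral_laplace hB hψ hψ0,
    smul_eq_mul, ← mul_assoc, ENNReal.inv_mul_cancel hPB (measure_ne_top _ _), one_mul]

theorem hasPoissonLaplace (hS : S.IsModel p P) :
    HasPoissonLaplace P (S.state p) p.intensity offState := by
  intro ψ hψ hψ0
  simpa using hS.setLIntegral_laplace MeasurableSet.univ hψ hψ0

/-- Coverage by a transmitter of kind `q`, given that the cluster UAV is unavailable. -/
theorem cond_unavailable (hS : S.IsModel p P) (hPa : p.Pa < 1) {q : Link} (hq : q ≠ .off)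
    {E : Set Ω} (hE : ∀ ω, S.avail none ω = false →
      ((∃ b, Wins p (S.state p) q b ω) ↔ ω ∈ E)) :
    IntegrableOn (p.winDensity q) (Ioi 0) ∧
      (P[|{ω | S.avail none ω = false}]).real E = ∫ z in Ioi 0, p.winDensity q z := by
  -- Unavailability is an event of `center`, so conditioning on it leaves the law of the other
  -- transmitters Poisson with the same intensity.
  set B : Set (Plane × Bool × ℝ × ℝ × ℝ) := {c | c.2.1 = false} with hBdef
  have hB : MeasurableSet B :=
    (measurable_fst.comp measurable_snd) (measurableSet_singleton false)
  have hBA : {ω | S.avail none ω = false} = S.center ⁻¹' B := rfl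
  have mA : MeasurableSet {ω | S.avail none ω = false} := hBA ▸ hS.measurable_center hB
  have hP : P {ω | S.avail none ω = false} ≠ 0 := by
    have h1 : {ω | S.avail none ω = false} = {ω | S.avail none ω = true}ᶜ := by
      ext ω
      simp
    have h2 : MeasurableSet {ω | S.avail none ω = true} :=
      hS.measurable_avail none (measurableSet_singleton true)
    rw [h1, Ne, prob_compl_eq_zero_iff h2, hS.avail_law none, ENNReal.ofReal_eq_one]
    exact hPa.ne
  have := cond_isProbabilityMeasure hP
  have h := measureReal_wins (hBA ▸ hS.hasPoissonLaplace_cond hB (hBA ▸ hP)) hS.measurable_state hq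
  refine ⟨h.1, ?_⟩
  rw [← h.2]
  refine measureReal_congr ?_
  filter_upwards [ae_cond_mem mA] with ω hω
  exact propext (hE ω hω).symm

end IsModel

end Inputs

/-! ### Coverage by the cluster UAV -/

namespace NetParams

variable (p : NetParams)

/-- Probability that the link to a UAV at horizontal distance `z` is of the given kind. -/
def linkProb : Link → ℝ → ℝ
  | .los, z => p.pLoS (√(z ^ 2 + p.h ^ 2))
  | .nlos, z => p.pNLoS (√(z ^ 2 + p.h ^ 2))
  | _, _ => 0

lemma linkProb_nonneg (q : Link) (z : ℝ) : 0 ≤ p.linkProb q z := by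
  cases q
  exacts [le_rfl, (p.pLoS_pos _).le, (p.pNLoS_pos _).le, le_rfl]

@[fun_prop]
lemma measurable_linkProb (q : Link) : Measurable (p.linkProb q) := by
  cases q <;> unfold linkProb <;> fun_prop

/-- Density of the horizontal distance of the user covered by the cluster UAV with a link of
kind `q`. -/
def clusterDensity (q : Link) (z : ℝ) : ℝ :=
  2 * z / p.rc ^ 2 * (p.linkProb q z *
    p.derivSum .cluster (p.shape q) (p.gam / p.meanPower q z) (p.slant q z))

lemma clusterDensity_los {z : ℝ} (hz : 0 < z) : p.clusterDensity .los z =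
    z / √(z ^ 2 + p.h ^ 2) * p.integrandClusterL (√(z ^ 2 + p.h ^ 2)) := by
  have hr : 0 < √(z ^ 2 + p.h ^ 2) := by positivity
  rw [clusterDensity, ← gl_eq, integrandClusterL]
  simp only [slant, shape, linkProb]
  field_simp

lemma clusterDensity_nlos {z : ℝ} (hz : 0 < z) : p.clusterDensity .nlos z =
    z / √(z ^ 2 + p.h ^ 2) * p.integrandClusterN (√(z ^ 2 + p.h ^ 2)) := by
  have hr : 0 < √(z ^ 2 + p.h ^ 2) := by positivity
  rw [clusterDensity, ← gn_eq, integrandClusterN]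
  simp only [slant, shape, linkProb]
  field_simp

lemma voidAll_cluster (r : ℝ) : p.voidAll (p.lower .cluster r) = 1 := by
  simp [voidAll, lower, lowerL, lowerN, lowerT]

end NetParams

namespace Inputs

variable {Ω : Type*} {S : Inputs Ω} {p : NetParams}

/-- The cluster UAV, as seen from the user. -/
def clusterState (S : Inputs Ω) (p : NetParams) (ω : Ω) : State :=
  p.uavState ‖S.user ω‖ (S.mark none ω)

lemma distUav_none (ω : Ω) : S.distUav p none ω = √(‖S.user ω‖ ^ 2 + p.h ^ 2) := by
  simp [distUav, uavAt]

lemma clusterState_off {ω : Ω} (h : ¬ S.avail none ω = true) :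
    S.clusterState p ω = offState := by
  simp [clusterState, NetParams.uavState, mark, h]

lemma clusterState_los {ω : Ω} (h : S.avail none ω = true) (hl : S.IsLoS p none ω) :
    S.clusterState p ω = (.los, ‖S.user ω‖, S.gL none ω) := by
  rw [IsLoS, distUav_none] at hl
  exact (if_pos h).trans (if_pos hl)

lemma clusterState_nlos {ω : Ω} (h : S.avail none ω = true) (hl : ¬ S.IsLoS p none ω) :
    S.clusterState p ω = (.nlos, ‖S.user ω‖, S.gN none ω) := by
  rw [IsLoS, distUav_none] at hl
  exact (if_pos h).trans (if_neg hl)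

lemma rx_clusterState {ω : Ω} (h : S.avail none ω = true) :
    p.rx (S.clusterState p ω) = ENNReal.ofReal (S.rxPower p (.inl none) ω) := by
  by_cases h2 : S.IsLoS p none ω
  · simp only [clusterState_los h h2, rxPower, if_pos h2, NetParams.rx, NetParams.meanPower,
      NetParams.coef, NetParams.slant, NetParams.expo, distUav_none]
    congr 1
    ring
  · simp only [clusterState_nlos h h2, rxPower, if_neg h2, NetParams.rx, NetParams.meanPower,
      NetParams.coef, NetParams.slant, NetParams.expo, distUav_none]
    congr 1
    ring

lemma covers_none_iff {ω : Ω} (h : S.avail none ω = true) : S.Covers p (.inl none) ω ↔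
    ENNReal.ofReal p.gam ≤ p.rx (S.clusterState p ω) / interferenceNoise p (S.state p) ω := by
  rw [Covers, sinr, interference_none, ← rx_clusterState h, interferenceNoise]
  exact and_iff_right ⟨h, Or.inl rfl⟩

namespace IsModel

variable [MeasurableSpace Ω] {P : Measure Ω} [IsProbabilityMeasure P]

/-- The interference of the other transmitters is independent of the user and the cluster UAV. -/
lemma indepFun_interferenceNoise (hS : S.IsModel p P) :
    IndepFun S.center (interferenceNoise p (S.state p)) P := by
  have hJ : Measurable fun ω => ∑' b, p.rx (S.state p b ω) :=
    Measurable.tsum fun b => p.measurable_rx.comp (hS.measurable_state b)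
  have h : IndepFun S.center (fun ω => ∑' b, p.rx (S.state p b ω)) P := by
    -- The joint Laplace functional factors into the probability of an event of `center` and a term
    -- free of that event, which is what independence requires.
    refine indepFun_of_laplace hJ fun B hB k => ?_
    have e (ω : Ω) : eexp (∑' b, p.rx (S.state p b ω)) ^ k =
        eexp (∑' b, (k : ℝ≥0∞) * p.rx (S.state p b ω)) := by
      rw [ENNReal.tsum_mul_left, eexp_natCast_mul]
    have hm : Measurable fun y => (k : ℝ≥0∞) * p.rx y := p.measurable_rx.const_mul _
    simp_rw [e]
    rw [hS.setLIntegral_laplace hB hm (by simp), hS.hasPoissonLaplace _ hm (by simp)]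
  exact h.comp (ψ := fun x => x + ENNReal.ofReal p.noise) measurable_id (by fun_prop)

lemma map_center (hS : S.IsModel p P) :
    P.map S.center = (P.map S.user).prod (P.map (S.mark none)) := by
  have h : IndepFun S.user (S.mark none) P :=
    hS.indepFun_of_sigmaOf {.avail none, .losMark none, .gL none, .gN none}
      (measurable_user_sigmaOf (by simp))
      (measurable_mark_sigmaOf (by simp) (by simp) (by simp) (by simp))
  exact (indepFun_iff_map_prod_eq_prod_map_map hS.measurable_user.aemeasurable
    (hS.measurable_mark none).aemeasurable).1 h

omit [IsProbabilityMeasure P] in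
/-- The horizontal distance of the user from the cluster centre has density `2 z / rc ^ 2`. -/
lemma lintegral_user (hS : S.IsModel p P) {f : ℝ → ℝ≥0∞} (hf : Measurable f) :
    ∫⁻ x, f ‖x‖ ∂P.map S.user =
      ∫⁻ z in Ioc 0 p.rc, ENNReal.ofReal (2 * z / p.rc ^ 2) * f z := by
  have hrc := p.rc_pos
  have hπ := Real.pi_pos
  have hvol : (volume : Measure Plane) (Metric.closedBall 0 p.rc) =
      ENNReal.ofReal (Real.pi * p.rc ^ 2) := by
    rw [EuclideanSpace.volume_closedBall_fin_two, ← ENNReal.ofReal_pow hrc.le, mul_comm,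
      ← ENNReal.ofReal_mul hπ.le]
  have hlaw := hS.user_law
  rw [pdf.IsUniform] at hlaw
  have h1 : ∫⁻ x in Metric.closedBall (0 : Plane) p.rc, f ‖x‖ =
      ∫⁻ x : Plane, (Iic p.rc).indicator f ‖x‖ := by
    rw [← lintegral_indicator Metric.isClosed_closedBall.measurableSet]
    refine lintegral_congr fun x => ?_
    simp only [indicator, Metric.mem_closedBall, dist_zero_right, mem_Iic]
  have h2 : ∫⁻ z in Ioi (0 : ℝ), ENNReal.ofReal (2 * Real.pi * z) * (Iic p.rc).indicator f z =
      ∫⁻ z in Ioc 0 p.rc, ENNReal.ofReal (2 * Real.pi * z) * f z := by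
    rw [← Ioi_inter_Iic, inter_comm, ← setLIntegral_indicator measurableSet_Iic]
    refine lintegral_congr fun z => ?_
    by_cases hz : z ∈ Iic p.rc
    · simp only [indicator_of_mem hz]
    · simp only [indicator_of_notMem hz, mul_zero]
  rw [hlaw, ProbabilityTheory.cond, lintegral_smul_measure, h1,
    lintegral_norm_plane (hf.indicator measurableSet_Iic), h2, hvol, smul_eq_mul,
    ← lintegral_const_mul _ (by fun_prop)]
  refine setLIntegral_congr_fun measurableSet_Ioc fun z hz => ?_
  have hz0 := hz.1
  rw [← mul_assoc, ← ENNReal.ofReal_inv_of_pos (by positivity),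
    ← ENNReal.ofReal_mul (by positivity)]
  congr 2
  field_simp

/-- Averages over the cluster UAV, the user and an independent interference. -/
lemma lintegral_clusterState (hS : S.IsModel p P) {q : Link} (hq : q = .los ∨ q = .nlos)
    {Φ : State × ℝ≥0∞ → ℝ≥0∞} (hΦ : Measurable Φ) (hΦ0 : ∀ x, x.1.1 ≠ q → Φ x = 0) :
    ∫⁻ ω, Φ (S.clusterState p ω, interferenceNoise p (S.state p) ω) ∂P =
      ENNReal.ofReal p.Pa * ∫⁻ z in Ioc 0 p.rc, ENNReal.ofReal (2 * z / p.rc ^ 2) *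
        (ENNReal.ofReal (p.linkProb q z) *
          ∫⁻ j, ∫⁻ g, Φ ((q, z, g), j) ∂p.gain q ∂P.map (interferenceNoise p (S.state p))) := by
  have hqo : q ≠ .off := by rintro rfl; simp at hq
  have mJ := measurable_interferenceNoise (p := p) hS.measurable_state
  have mY : Measurable fun c : Plane × Bool × ℝ × ℝ × ℝ => p.uavState ‖c.1‖ c.2 :=
    p.measurable_uavState.comp ((measurable_norm.comp measurable_fst).prodMk measurable_snd)
  obtain ⟨Y, hY⟩ : ∃ Y : Plane × Bool × ℝ × ℝ × ℝ → State, ∀ c, Y c = p.uavState ‖c.1‖ c.2 :=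
    ⟨_, fun _ => rfl⟩
  have mY' : Measurable Y := by
    rw [funext hY]
    exact mY
  have hJi := hS.indepFun_interferenceNoise
  have hcs (ω : Ω) : S.clusterState p ω = Y (S.center ω) := (hY (S.center ω)).symm
  simp_rw [hcs]
  clear hcs mY
  -- Only the measurability of `J` and its independence of `center` matter from here on.
  generalize interferenceNoise p (S.state p) = J at *
  have pm1 := Measure.isProbabilityMeasure_map (μ := P) hS.measurable_center.aemeasurable
  have pm2 := Measure.isProbabilityMeasure_map (μ := P) mJ.aemeasurable
  have pm3 := Measure.isProbabilityMeasure_map (μ := P) hS.measurable_user.aemeasurable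
  have pm4 := Measure.isProbabilityMeasure_map (μ := P) (hS.measurable_mark none).aemeasurable
  have mF : Measurable fun x : (Plane × Bool × ℝ × ℝ × ℝ) × ℝ≥0∞ => Φ (Y x.1, x.2) :=
    hΦ.comp ((mY'.comp measurable_fst).prodMk measurable_snd)
  have mcJ : Measurable fun ω => (S.center ω, J ω) := hS.measurable_center.prodMk mJ
  have e2 : ∫⁻ ω, Φ (Y (S.center ω), J ω) ∂P =
      ∫⁻ c, ∫⁻ j, Φ (Y c, j) ∂P.map J ∂P.map S.center := by
    rw [← lintegral_map (f := fun x : (Plane × Bool × ℝ × ℝ × ℝ) × ℝ≥0∞ => Φ (Y x.1, x.2)) mF mcJ,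
      (indepFun_iff_map_prod_eq_prod_map_map hS.measurable_center.aemeasurable
        mJ.aemeasurable).1 hJi, lintegral_prod _ mF.aemeasurable]
  have mark_eq (x : Plane) (j : ℝ≥0∞) : ∫⁻ m, Φ (Y (x, m), j) ∂P.map (S.mark none) =
      ENNReal.ofReal p.Pa * (ENNReal.ofReal (p.linkProb q ‖x‖) *
        ∫⁻ g, Φ ((q, ‖x‖, g), j) ∂p.gain q) := by
    have := hS.lintegral_uavState none ‖x‖ (f := fun y => Φ (y, j))
      (hΦ.comp (measurable_id.prodMk measurable_const)) (hΦ0 _ fun h => hqo h.symm)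
    simp only [hY]
    rw [this]
    congr 1
    rcases hq with rfl | rfl
    · have : ∀ g, Φ ((.nlos, ‖x‖, g), j) = 0 := fun g => hΦ0 _ (fun h => nomatch h)
      simp only [this, lintegral_zero, mul_zero, add_zero]
      rfl
    · have : ∀ g, Φ ((.los, ‖x‖, g), j) = 0 := fun g => hΦ0 _ (fun h => nomatch h)
      simp only [this, lintegral_zero, mul_zero, zero_add]
      rfl
  have mKin : Measurable fun x : ℝ × ℝ≥0∞ => ∫⁻ g, Φ ((q, x.1, g), x.2) ∂p.gain q := by
    refine Measurable.lintegral_prod_right' (f := fun y : (ℝ × ℝ≥0∞) × ℝ =>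
      Φ ((q, y.1.1, y.2), y.1.2)) ?_
    exact hΦ.comp (by fun_prop)
  have mK : Measurable fun z => ∫⁻ j, ∫⁻ g, Φ ((q, z, g), j) ∂p.gain q ∂P.map J :=
    Measurable.lintegral_prod_right' mKin
  have e3 : ∫⁻ c, ∫⁻ j, Φ (Y c, j) ∂P.map J ∂P.map S.center =
      ∫⁻ x, ENNReal.ofReal p.Pa * (ENNReal.ofReal (p.linkProb q ‖x‖) *
        ∫⁻ j, ∫⁻ g, Φ ((q, ‖x‖, g), j) ∂p.gain q ∂P.map J) ∂P.map S.user := by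
    rw [hS.map_center, lintegral_prod _ mF.lintegral_prod_right'.aemeasurable]
    refine lintegral_congr fun x => ?_
    have mx : Measurable (Function.uncurry fun (m : Bool × ℝ × ℝ × ℝ) (j : ℝ≥0∞) =>
        Φ (Y (x, m), j)) :=
      hΦ.comp ((mY'.comp (measurable_const.prodMk measurable_fst)).prodMk measurable_snd)
    have mKx : Measurable fun j : ℝ≥0∞ => ∫⁻ g, Φ ((q, ‖x‖, g), j) ∂p.gain q :=
      mKin.comp measurable_prodMk_left
    rw [lintegral_lintegral_swap mx.aemeasurable, lintegral_congr (mark_eq x),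
      lintegral_const_mul _ (mKx.const_mul _), lintegral_const_mul _ mKx]
  have ml := p.measurable_linkProb q
  rw [e2, e3, hS.lintegral_user (f := fun z => ENNReal.ofReal p.Pa *
    (ENNReal.ofReal (p.linkProb q z) * ∫⁻ j, ∫⁻ g, Φ ((q, z, g), j) ∂p.gain q ∂P.map J))
    (by fun_prop), ← lintegral_const_mul' _ _ (by simp)]
  refine lintegral_congr fun z => ?_
  ring

/-- Probability that the cluster UAV is available, has a link of kind `q` and covers the user. -/
theorem measure_cluster (hS : S.IsModel p P) {q : Link} (hq : q = .los ∨ q = .nlos) :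
    P {ω | (S.clusterState p ω).1 = q ∧ ENNReal.ofReal p.gam ≤
        p.rx (S.clusterState p ω) / interferenceNoise p (S.state p) ω} =
      ENNReal.ofReal p.Pa * ∫⁻ z in Ioc 0 p.rc, ENNReal.ofReal (2 * z / p.rc ^ 2) *
        (ENNReal.ofReal (p.linkProb q z) * ∫⁻ ω, erlangTail (p.shape q)
          (ENNReal.ofReal (p.shape q * (p.gam / p.meanPower q z)) *
            interferenceNoise p (S.state p) ω) ∂P) := by
  have hqo : q ≠ .off := by rintro rfl; simp at hq
  have mJ := measurable_interferenceNoise (p := p) hS.measurable_state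
  set W : Set (State × ℝ≥0∞) := {x | x.1.1 = q ∧ ENNReal.ofReal p.gam ≤ p.rx x.1 / x.2} with hW
  have mW : MeasurableSet W :=
    ((measurable_fst.comp measurable_fst) (measurableSet_singleton q)).inter
      (measurableSet_le measurable_const ((p.measurable_rx.comp measurable_fst).div measurable_snd))
  have mcl : Measurable (S.clusterState p) :=
    p.measurable_uavState.comp ((measurable_norm.comp hS.measurable_user).prodMk
      (hS.measurable_mark none))
  have mE : MeasurableSet
      ((fun ω => (S.clusterState p ω, interferenceNoise p (S.state p) ω)) ⁻¹' W) :=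
    (mcl.prodMk mJ) mW
  have e1 : P {ω | (S.clusterState p ω).1 = q ∧ ENNReal.ofReal p.gam ≤
      p.rx (S.clusterState p ω) / interferenceNoise p (S.state p) ω} =
      ∫⁻ ω, W.indicator 1 (S.clusterState p ω, interferenceNoise p (S.state p) ω) ∂P := by
    change P ((fun ω => (S.clusterState p ω, interferenceNoise p (S.state p) ω)) ⁻¹' W) = _
    rw [← lintegral_indicator_one mE]
    rfl
  have gain_eq (z : ℝ) (hz : 0 < z) (j : ℝ≥0∞) :
      ∫⁻ g, W.indicator (1 : State × ℝ≥0∞ → ℝ≥0∞) ((q, z, g), j) ∂p.gain q =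
        erlangTail (p.shape q) (ENNReal.ofReal (p.shape q * (p.gam / p.meanPower q z)) * j) := by
    have hmp := p.meanPower_pos hqo hz
    rw [← gammaMeasure_setOf_le (p.shape_pos q) p.gam_pos hmp j]
    set G : Set ℝ := {g | ENNReal.ofReal p.gam * j ≤ ENNReal.ofReal (p.meanPower q z * g)}
    have mG : MeasurableSet G := measurableSet_le measurable_const (by fun_prop)
    change _ = p.gain q G
    rw [← lintegral_indicator_one mG]
    refine lintegral_congr_ae ?_
    -- A positive gain excludes `0 / 0`, which equals `0` and would break the equivalence when
    -- interference and noise both vanish.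
    filter_upwards [p.ae_gain_pos q] with g hg0
    have hr : p.rx (q, z, g) ≠ 0 := by
      simpa [NetParams.rx] using mul_pos hmp hg0
    have hiff : ((q, z, g), j) ∈ W ↔ g ∈ G := by
      refine (and_iff_right rfl).trans ?_
      exact ENNReal.le_div_iff_mul_le (Or.inr hr) (Or.inr ENNReal.ofReal_ne_top)
    by_cases h : g ∈ G
    · rw [indicator_of_mem h, indicator_of_mem (hiff.2 h)]
      rfl
    · rw [indicator_of_notMem h, indicator_of_notMem fun h' => h (hiff.1 h')]
  rw [e1, hS.lintegral_clusterState hq (measurable_one.indicator mW)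
    (fun x hx => indicator_of_notMem (fun h => hx h.1) _)]
  congr 1
  refine setLIntegral_congr_fun measurableSet_Ioc fun z hz => ?_
  simp only [gain_eq z hz.1]
  rw [lintegral_map (by fun_prop) mJ]

/-- Coverage by the cluster UAV with a link of kind `q`, given that it is available. -/
theorem cond_available (hS : S.IsModel p P) (hPa : 0 < p.Pa) {q : Link}
    (hq : q = .los ∨ q = .nlos) {E : Set Ω} (hE : ∀ ω, S.avail none ω = true ∧ ω ∈ E ↔
      (S.clusterState p ω).1 = q ∧ ENNReal.ofReal p.gam ≤
        p.rx (S.clusterState p ω) / interferenceNoise p (S.state p) ω) :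
    IntegrableOn (p.clusterDensity q) (Ioc 0 p.rc) ∧
      (P[|{ω | S.avail none ω = true}]).real E = ∫ z in Ioc 0 p.rc, p.clusterDensity q z := by
  have hqo : q ≠ .off := by rintro rfl; simp at hq
  have mJ := measurable_interferenceNoise (p := p) hS.measurable_state
  -- With `u = 0` and all lower limits `0` the void event is everything and the void factor is `1`:
  -- the cluster UAV serves regardless of the others.
  have hz0 (z : ℝ) (hz : 0 < z) := setLIntegral_erlangTail hS.hasPoissonLaplace hS.measurable_state
    (t := .cluster) (r := p.slant q z) (p.slant_nonneg q hz.le) (u := fun _ => 0) measurable_const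
    rfl (c := 0) (fun q' hq' z' hz' hne g => by
      cases q' <;> simpa [NetParams.lower, NetParams.lowerL, NetParams.lowerN, NetParams.lowerT]
        using hz')
    (p.shape_pos q) (div_pos p.gam_pos (p.meanPower_pos hqo hz))
  simp only [NetParams.voidAll_cluster, one_mul, iSup_const, le_refl, ofPred_true,
    Measure.restrict_univ] at hz0
  have mA : MeasurableSet {ω | S.avail none ω = true} :=
    hS.measurable_avail none (measurableSet_singleton true)
  have hcond : P[|{ω | S.avail none ω = true}] E = ∫⁻ z in Ioc 0 p.rc,
      ENNReal.ofReal (2 * z / p.rc ^ 2) *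
        (ENNReal.ofReal (p.linkProb q z) * ∫⁻ ω, erlangTail (p.shape q)
          (ENNReal.ofReal (p.shape q * (p.gam / p.meanPower q z)) *
            interferenceNoise p (S.state p) ω) ∂P) := by
    have : {ω | S.avail none ω = true} ∩ E = {ω | (S.clusterState p ω).1 = q ∧
        ENNReal.ofReal p.gam ≤
          p.rx (S.clusterState p ω) / interferenceNoise p (S.state p) ω} := by
      ext ω
      exact hE ω
    rw [cond_apply mA, this, hS.measure_cluster hq, hS.avail_law none, ← mul_assoc,
      ENNReal.inv_mul_cancel (by simpa using hPa) (by simp), one_mul]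
  have hval (z : ℝ) (hz : z ∈ Ioc 0 p.rc) : ENNReal.ofReal (2 * z / p.rc ^ 2) *
        (ENNReal.ofReal (p.linkProb q z) * ∫⁻ ω, erlangTail (p.shape q)
          (ENNReal.ofReal (p.shape q * (p.gam / p.meanPower q z)) *
            interferenceNoise p (S.state p) ω) ∂P) = ENNReal.ofReal (p.clusterDensity q z) := by
    have h0 := hz.1
    have hl := p.linkProb_nonneg q z
    rw [(hz0 z hz.1).2, ← ENNReal.ofReal_mul hl, ← ENNReal.ofReal_mul (by positivity)]
    rfl
  have hmeas : Measurable fun z : ℝ => ENNReal.ofReal (2 * z / p.rc ^ 2) *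
        (ENNReal.ofReal (p.linkProb q z) * ∫⁻ ω, erlangTail (p.shape q)
          (ENNReal.ofReal (p.shape q * (p.gam / p.meanPower q z)) *
            interferenceNoise p (S.state p) ω) ∂P) := by
    have ml := p.measurable_linkProb q
    have hm := p.measurable_meanPower q
    refine Measurable.mul (by fun_prop) (Measurable.mul (by fun_prop) ?_)
    refine Measurable.lintegral_prod_right' (f := fun x : ℝ × Ω => erlangTail (p.shape q)
      (ENNReal.ofReal (p.shape q * (p.gam / p.meanPower q x.1)) *
        interferenceNoise p (S.state p) x.2)) ?_
    fun_prop
  have := cond_isProbabilityMeasure (μ := P) (s := {ω | S.avail none ω = true})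
    (by rw [hS.avail_law none]; simpa using hPa)
  refine integrableOn_and_integral_eq measurableSet_Ioc (fun z hz => ?_) ?_ (measure_ne_top _ _) ?_
  · have h0 := hz.1
    have hl := p.linkProb_nonneg q z
    have := (hz0 z h0).1
    unfold NetParams.clusterDensity
    positivity
  · exact hmeas.aemeasurable.congr ((ae_restrict_iff' measurableSet_Ioc).2 (ae_of_all _ hval))
  · rw [hcond]
    exact (setLIntegral_congr_fun measurableSet_Ioc hval).symm

end IsModel

end Inputs

end

end UavNet

/-! ### The coverage probabilities -/

theorem theorem3 {Ω : Type*} [MeasurableSpace Ω] (P : Measure Ω) [IsProbabilityMeasure P]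
    (p : UavNet.NetParams) (S : UavNet.Inputs Ω) (hS : S.IsModel p P) :
    -- the Laplace transforms are smooth, so that the derivatives below are genuine ones
    (∀ (t : UavNet.Serving) (r : ℝ), 0 ≤ r →
      ContDiffOn ℝ ((⊤ : ℕ∞) : WithTop ℕ∞) (fun s => p.laplace t s r) (Set.Ioi 0)) ∧
    -- the cluster UAV is available
    (0 < p.Pa →
      (IntervalIntegrable p.integrandClusterL volume p.h (√(p.h ^ 2 + p.rc ^ 2)) ∧
        S.covClusterL p P = ∫ r in p.h..√(p.h ^ 2 + p.rc ^ 2), p.integrandClusterL r) ∧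
      (IntervalIntegrable p.integrandClusterN volume p.h (√(p.h ^ 2 + p.rc ^ 2)) ∧
        S.covClusterN p P = ∫ r in p.h..√(p.h ^ 2 + p.rc ^ 2), p.integrandClusterN r)) ∧
    -- the cluster UAV is unavailable
    (p.Pa < 1 →
      (IntegrableOn p.integrandOtherL (Set.Ioi p.h) ∧
        S.covOtherL p P = ∫ r in Set.Ioi p.h, p.integrandOtherL r) ∧
      (IntegrableOn p.integrandOtherN (Set.Ioi p.h) ∧
        S.covOtherN p P = ∫ r in Set.Ioi p.h, p.integrandOtherN r) ∧
      (IntegrableOn p.integrandTbs (Set.Ioi 0) ∧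
        S.covTbs p P = ∫ r in Set.Ioi 0, p.integrandTbs r)) := by
  have hh := p.h_pos
  have hle : p.h ≤ √(p.h ^ 2 + p.rc ^ 2) :=
    Real.le_sqrt_of_sq_le (le_add_of_nonneg_right (sq_nonneg _))
  refine ⟨fun t r hr => UavNet.contDiffOn_laplace hS.hasPoissonLaplace hS.measurable_state t hr,
    fun hPa => ⟨?_, ?_⟩, fun hPa => ⟨?_, ?_, ?_⟩⟩
  · have hI := UavNet.integral_slant hh measurableSet_Ioc (fun z hz => hz.1)
      (UavNet.image_slant_Ioc hh p.rc_pos) p.integrandClusterL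
      (fun z hz => p.clusterDensity_los hz.1)
    have h := hS.cond_available hPa (q := .los) (Or.inl rfl)
      (E := {ω | S.IsLoS p none ω ∧ S.Covers p (.inl none) ω}) fun ω => by
        by_cases h1 : S.avail none ω = true
        · by_cases h2 : S.IsLoS p none ω
          · simp [h1, h2, UavNet.Inputs.covers_none_iff h1, UavNet.Inputs.clusterState_los h1 h2]
          · simp [h1, h2, UavNet.Inputs.clusterState_nlos h1 h2]
        · simp [h1, UavNet.Inputs.clusterState_off h1, UavNet.offState]
    rw [intervalIntegrable_iff_integrableOn_Ioc_of_le hle, intervalIntegral.integral_of_le hle,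
      hI.1, hI.2]
    exact h
  · have hI := UavNet.integral_slant hh measurableSet_Ioc (fun z hz => hz.1)
      (UavNet.image_slant_Ioc hh p.rc_pos) p.integrandClusterN
      (fun z hz => p.clusterDensity_nlos hz.1)
    have h := hS.cond_available hPa (q := .nlos) (Or.inr rfl)
      (E := {ω | ¬ S.IsLoS p none ω ∧ S.Covers p (.inl none) ω}) fun ω => by
        by_cases h1 : S.avail none ω = true
        · by_cases h2 : S.IsLoS p none ω
          · simp [h1, h2, UavNet.Inputs.clusterState_los h1 h2]
          · simp [h1, h2, UavNet.Inputs.covers_none_iff h1, UavNet.Inputs.clusterState_nlos h1 h2]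
        · simp [h1, UavNet.Inputs.clusterState_off h1, UavNet.offState]
    rw [intervalIntegrable_iff_integrableOn_Ioc_of_le hle, intervalIntegral.integral_of_le hle,
      hI.1, hI.2]
    exact h
  · have hI := UavNet.integral_slant hh measurableSet_Ioi subset_rfl (UavNet.image_slant_Ioi hh)
      p.integrandOtherL (fun z hz => p.winDensity_los hz)
    rw [hI.1, hI.2]
    exact hS.cond_unavailable hPa (q := .los) (fun h => nomatch h)
      fun ω hω => UavNet.Inputs.exists_wins_los_iff hω
  · have hI := UavNet.integral_slant hh measurableSet_Ioi subset_rfl (UavNet.image_slant_Ioi hh)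
      p.integrandOtherN (fun z hz => p.winDensity_nlos hz)
    rw [hI.1, hI.2]
    exact hS.cond_unavailable hPa (q := .nlos) (fun h => nomatch h)
      fun ω hω => UavNet.Inputs.exists_wins_nlos_iff hω
  · have h := hS.cond_unavailable hPa (q := .tbs) (fun h => nomatch h)
      fun ω hω => UavNet.Inputs.exists_wins_tbs_iff hω
    -- TBSs are on the ground, so horizontal and Euclidean distance coincide and no change of
    -- variables is needed.
    have he : EqOn (p.winDensity .tbs) p.integrandTbs (Ioi 0) := fun z hz => p.winDensity_tbs hz
    exact ⟨(integrableOn_congr_fun he measurableSet_Ioi).1 h.1,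
      h.2.trans (setIntegral_congr_fun measurableSet_Ioi he)⟩
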